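/- Setting. Let $(n,p)=(2,0)$ or $(n,p)=(1,1)$, let $X=\mathbb C^n\times\mathbb C^p$ with coordinates $x_1,\dots,x_n$ (and $y$ if $p=1$), let $D=\{x_1\cdots x_n=0\}$, and let $\pi:\widetilde X=(\mathbb R_{\ge 0}\times S^1)^n\times\mathbb C^p\to X$, $x_i=r_ie^{i\theta_i}$, be the real oriented blow-up of $X$ along $D$. Let $\mathcal A$ be the sheaf on $\widetilde X$ of functions that are $C^\infty$ up to the boundary and holomorphic on $\widetilde X\setminus\pi^{-1}(D)=X\setminus D$ (equivalently, $C^\infty$ functions annihilated by all $\bar x_i\partial_{\bar x_i}$ and, if $p=1$, by $\partial_{\bar y}$). Let $\mathcal A^{\mathrm{mod}}$ be the sheaf on $\widetilde X$ whose sections over an open set $\Omega$ are the holomorphic functions $f$ on $\Omega\setminus\pi^{-1}(D)$ of moderate growth: for every compact $K\subset\Omega$ there are $C$ and $N\in\mathbb N^n$ with $|f(x)|\le C\prod_i|x_i|^{-N_i}$ on $K\setminus\pi^{-1}(D)$. Fix $\vartheta_0\in\pi^{-1}(0)$. (a) Crossing point, $(n,p)=(2,0)$. Let $m_1,m_2\ge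 0$ be integers, let $U\in\mathcal A_{\vartheta_0}$ be a germ with $U(\vartheta_0)\ne 0$, put $\alpha=x_1^{-m_1}x_2^{-m_2}U$, and let $\lambda_1,\lambda_2\in\mathbb C$. For $i=1,2$ put $P_iw=x_i\partial_iw+x_i\,\partial_i\alpha\cdot w+\lambda_iw$. If $\rho_1,\rho_2\in\mathcal A^{\mathrm{mod}}_{\vartheta_0}$ satisfy the integrability condition $P_1\rho_2=P_2\rho_1$, then there is $u\in\mathcal A^{\mathrm{mod}}_{\vartheta_0}$ with $$x_i\,\partial_iu=-x_i\,\partial_i\alpha\cdot u-\lambda_iu+\rho_i\qquad(i=1,2).$$ Moreover, if $i\in\{1,2\}$ and either $m_i>0$ or $m_1=m_2=0$, then for every $\rho_i\in\mathcal A^{\mathrm{mod}}_{\vartheta_0}$ the $i$-th equation alone has a solution $u\in\mathcal A^{\mathrm{mod}}_{\vartheta_0}$. (b) Smooth point, $(n,p)=(1,1)$. Let $m\ge 0$ be an integer, $\nu(y)$ a holomorphic function without zeros near $y=0$, and $U\in\mathcal A_{\vartheta_0}$ a germ with $U(0,\vartheta_0,y)=1$ for all $y$ near $0$; put $\alpha=x_1^{-m}\nu(y)U$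 and let $\lambda_1\in\mathbb C$. Put $P_1w=x_1\partial_1w+x_1\,\partial_1\alpha\cdot w+\lambda_1w$ and $P_2'w=\partial_yw+\partial_y\alpha\cdot w$. If $\rho_1,\rho_2\in\mathcal A^{\mathrm{mod}}_{\vartheta_0}$ satisfy $P_1\rho_2=P_2'\rho_1$, then there is $u\in\mathcal A^{\mathrm{mod}}_{\vartheta_0}$ with $$x_1\,\partial_1u=-x_1\,\partial_1\alpha\cdot u-\lambda_1u+\rho_1,\qquad \partial_yu=-\partial_y\alpha\cdot u+\rho_2.$$ Moreover, for every $\rho_1\in\mathcal A^{\mathrm{mod}}_{\vartheta_0}$ the first equation alone has a solution $u\in\mathcal A^{\mathrm{mod}}_{\vartheta_0}$. -/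

import Mathlib

open scoped ContDiff NNReal

/-- The local model `X = ℂⁿ × ℂᵖ`, with coordinates `x.1 i` and `x.2 j` and divisor
`D = {∏ i, x.1 i = 0}`. -/
abbrev Ambient (n p : ℕ) : Type := (Fin n → ℂ) × (Fin p → ℂ)

/-- The real oriented blow-up `(ℝ≥0 × S¹)ⁿ × ℂᵖ` of `X = ℂⁿ × ℂᵖ` along `D`. -/
abbrev RealBlowUp (n p : ℕ) : Type := (Fin n → ℝ≥0 × Circle) × (Fin p → ℂ)

namespace RealBlowUp

variable {n p : ℕ}

/-- The blow-down map `π`, given by `x_i = r_i e^{iθ_i}`. -/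
noncomputable def proj (b : RealBlowUp n p) : Ambient n p :=
  (fun i => (((b.1 i).1 : ℝ) : ℂ) * ((b.1 i).2 : ℂ), b.2)

/-- The inverse of `π` away from `D`: `x ↦ (|x_i|, x_i / |x_i|)`. (Its values on `D` are
never used.) -/
noncomputable def lift (x : Ambient n p) : RealBlowUp n p :=
  (fun i => (‖x.1 i‖₊, Circle.exp (Complex.arg (x.1 i))), x.2)

theorem proj_lift (x : Ambient n p) : proj (lift x) = x := by
  refine Prod.ext (funext fun i => ?_) rfl
  simp [proj, lift, Complex.norm_mul_exp_arg_mul_I]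

theorem lift_proj (b : RealBlowUp n p) (hb : ∀ i, (b.1 i).1 ≠ 0) : lift (proj b) = b := by
  refine Prod.ext (funext fun i => Prod.ext ?_ ?_) rfl
  · ext
    simp [proj, lift, Circle.norm_coe]
  · have hpos : (0 : ℝ) < ((b.1 i).1 : ℝ) := by
      exact_mod_cast pos_iff_ne_zero.mpr (hb i)
    simp [proj, lift, Complex.arg_real_mul _ hpos]

/-- `S ∖ π⁻¹(D)`, regarded as a subset of `X ∖ D`. -/
def offD (S : Set (RealBlowUp n p)) : Set (Ambient n p) :=
  {x | (∀ i, x.1 i ≠ 0) ∧ lift x ∈ S}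

/-- Polar coordinates `(r, θ, y)` on the real blow-up; used for `r_i ≥ 0` only. Locally
they are the charts of the real blow-up as a manifold with corners. -/
noncomputable def polar (c : (Fin n → ℝ) × (Fin n → ℝ) × (Fin p → ℂ)) : RealBlowUp n p :=
  (fun i => (Real.toNNReal (c.1 i), Circle.exp (c.2.1 i)), c.2.2)

/-- `F` is a section over `Ω` of the sheaf `𝒜` of holomorphic functions on the real
blow-up: it is `C^∞` up to the boundary and holomorphic away from the boundary. By
continuity this is the same as being `C^∞` and annihilated by all the operators
`x̄_i ∂/∂x̄_i = (r_i ∂/∂r_i + √-1 ∂/∂θ_i) / 2` and `∂/∂ȳ_j`. -/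
structure IsHolSection (Ω : Set (RealBlowUp n p)) (F : RealBlowUp n p → ℂ) : Prop where
  smooth : ContDiffOn ℝ ∞ (F ∘ polar) ({c | ∀ i, 0 ≤ c.1 i} ∩ polar ⁻¹' Ω)
  holo : DifferentiableOn ℂ (F ∘ lift) (offD Ω)

/-- `f` is a section over `Ω` of the sheaf `𝒜^{mod D}`: it is holomorphic away from `D`, and
on each compact subset `K` of `Ω` it is bounded by some `C ∏ |x_i|^{-N_i}`. -/
structure IsModSection (Ω : Set (RealBlowUp n p)) (f : Ambient n p → ℂ) : Prop where
  holo : DifferentiableOn ℂ f (offD Ω)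
  moderate : ∀ K ⊆ Ω, IsCompact K → ∃ (C : ℝ) (N : Fin n → ℕ), ∀ x ∈ offD K,
    ‖f x‖ ≤ C * ∏ i, ‖x.1 i‖ ^ (-(N i : ℤ))

/-- The logarithmic derivative `x_i ∂f/∂x_i`. -/
noncomputable def eulerDeriv (i : Fin n) (f : Ambient n p → ℂ) (x : Ambient n p) : ℂ :=
  x.1 i * fderiv ℂ f x (Pi.single i 1, 0)

/-- The derivative `∂f/∂y_j`. -/
noncomputable def paramDeriv (j : Fin p) (f : Ambient n p → ℂ) (x : Ambient n p) : ℂ :=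
  fderiv ℂ f x (0, Pi.single j 1)

/-- The operator `P_i w = x_i ∂w/∂x_i + x_i ∂α/∂x_i · w + l w`. -/
noncomputable def logOp (i : Fin n) (α : Ambient n p → ℂ) (l : ℂ) (w : Ambient n p → ℂ)
    (x : Ambient n p) : ℂ :=
  eulerDeriv i w x + eulerDeriv i α x * w x + l * w x

/-- The operator `P'_j w = ∂w/∂y_j + ∂α/∂y_j · w`. -/
noncomputable def paramOp (j : Fin p) (α : Ambient n p → ℂ) (w : Ambient n p → ℂ)
    (x : Ambient n p) : ℂ :=
  paramDeriv j w x + paramDeriv j α x * w x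

/-- Over `Ω`, `u` solves `x_i ∂u/∂x_i = - x_i ∂α/∂x_i · u - l u + ρ`. -/
def SolvesLog (Ω : Set (RealBlowUp n p)) (i : Fin n) (α : Ambient n p → ℂ) (l : ℂ)
    (ρ u : Ambient n p → ℂ) : Prop :=
  ∀ x ∈ offD Ω, eulerDeriv i u x = - eulerDeriv i α x * u x - l * u x + ρ x

/-- Over `Ω`, `u` solves `∂u/∂y_j = - ∂α/∂y_j · u + ρ`. -/
def SolvesParam (Ω : Set (RealBlowUp n p)) (j : Fin p) (α : Ambient n p → ℂ)
    (ρ u : Ambient n p → ℂ) : Prop :=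
  ∀ x ∈ offD Ω, paramDeriv j u x = - paramDeriv j α x * u x + ρ x

/-- The exponential factor `α = x_1^{-m_1} x_2^{-m_2} U` at a crossing point. -/
noncomputable def crossingExponent (m : Fin 2 → ℕ) (U : RealBlowUp 2 0 → ℂ)
    (x : Ambient 2 0) : ℂ :=
  x.1 0 ^ (-(m 0 : ℤ)) * x.1 1 ^ (-(m 1 : ℤ)) * U (lift x)

/-- The exponential factor `α = x_1^{-m} ν(y) U` at a smooth point. -/
noncomputable def smoothExponent (m : ℕ) (ν : ℂ → ℂ) (U : RealBlowUp 1 1 → ℂ)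
    (x : Ambient 1 1) : ℂ :=
  x.1 0 ^ (-(m : ℤ)) * ν (x.2 0) * U (lift x)

/-- The data over `Ω` at a point `ϑ` of `π⁻¹(0)`, `D = {x_1 x_2 = 0}`:
`U` is a section of `𝒜` with `U(ϑ) ≠ 0`. -/
structure CrossingData (ϑ : RealBlowUp 2 0) (Ω : Set (RealBlowUp 2 0))
    (U : RealBlowUp 2 0 → ℂ) : Prop where
  base : proj ϑ = 0
  isOpen : IsOpen Ω
  mem : ϑ ∈ Ω
  section_U : IsHolSection Ω U
  ne_zero : U ϑ ≠ 0

/-- The data over `Ω` at a point `ϑ` of `π⁻¹(0)`, `D = {x_1 = 0}`: `ν` is holomorphic without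
zeros, and `U` is a section of `𝒜` equal to `1` at the points `(0, ϑ, y)`. -/
structure SmoothData (ϑ : RealBlowUp 1 1) (Ω : Set (RealBlowUp 1 1)) (ν : ℂ → ℂ)
    (U : RealBlowUp 1 1 → ℂ) : Prop where
  base : proj ϑ = 0
  isOpen : IsOpen Ω
  mem : ϑ ∈ Ω
  analytic_ν : ∀ b ∈ Ω, AnalyticAt ℂ ν (b.2 0)
  ν_ne_zero : ∀ b ∈ Ω, ν (b.2 0) ≠ 0
  section_U : IsHolSection Ω U
  eq_one : ∀ y : Fin 1 → ℂ, (ϑ.1, y) ∈ Ω → U (ϑ.1, y) = 1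

end RealBlowUp

open RealBlowUp

/-!
# Twisted logarithmic systems with moderate growth on a real oriented blow-up

Both parts rest on one change of coordinates. Near a point of the boundary with angle `ζ`, the map
`x ↦ w = (ζ⁻¹ x)^{-k}` with `k = max m 1` sends a small sector onto a neighbourhood of infinity in
a narrow cone around the positive real axis (`sectorMap`, `sectorCoord`); moderate growth in `x`
becomes polynomial growth in `w`. A parameter `y` is merely translated. In coordinates `(w, z)`
both the crossing point and the smooth point become the system
`∂_w u + ∂_w A · u = r₁`, `∂_z u + ∂_z A · u = r₂` with
`A = c V w^a z^b + μ₁ log w + μ₂ log z`, where `a, b ∈ {0, 1}` record whether the pole orders are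
positive and the logarithms absorb the constants `λ_i`. The case `a = 0`, `b = 1` never occurs:
a variable with `m_i > 0` is taken first. Since `U` is smooth up to the boundary and holomorphic
inside, `x_i ∂_i U = O(|x_i|)` (`IsHolSection.exists_eulerDeriv_bound`). Hence `V` tends to a
constant `V₀ ≠ 0`, and its Euler derivatives tend to `0`, uniformly on the cone
(`isAsymptoticUnit_of_euler_bounds`); so `c V w^a z^b` behaves like `c V₀ w^a z^b`.

The function `e^A u` has to be a primitive of the closed form `e^A (r₁ dw + r₂ dz)`, and the
question is which primitive loses only a polynomial factor when divided by `e^A`.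

* If `a = 1` and `Re (c V₀) ≤ 0`, the cone contains a direction `τ` with `Re (c V₀ τ) < 0`, because
  `c V₀ ≠ 0`. Then `e^A` decays exponentially along the rays `w + t τ`, and the integral from
  infinity along these rays is the required primitive (`exists_solution_of_decay`). Closedness
  and differentiation under the integral sign give the equation in `z` for free.
* If `a = 1` and `Re (c V₀) > 0`, the real part of `c V w z^b` increases along the segment from a
  base point `w₀` to `w`; if `a = b = 0` it is bounded. In both cases integration from a base
  point works (`exists_solution_of_growth`, `exists_system_solution_of_growth`). For the system
  the primitive vanishing at `(w₀, z₀)` is estimated along the broken line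
  `(w₀, z₀) → (w₀, z) → (w, z)`.

`hasTwistedSolutions` combines the cases, and `LogChart.exists_solutions_of_unit` carries the
result back to the blow-up. The charts are `crossingChart` and `smoothChart`.
-/

section

open MeasureTheory Set Filter Topology Metric

/-! ### Integrals of holomorphic functions along rays and segments -/

/-- Differentiation under the integral sign for an integrand holomorphic in the parameter: by the
Schwarz lemma an integrable bound on the integrand alone already makes it Lipschitz in the
parameter with an integrable constant. -/
theorem hasFDerivAt_integral_of_holomorphic {E T : Type*} [NormedAddCommGroup E] [NormedSpace ℂ E]
    [MeasurableSpace T] {μ : Measure T} {G : E → T → ℂ} {x₀ : E} {r : ℝ} (hr : 0 < r) {b : T → ℝ}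
    (hb : Integrable b μ) (hmeas : ∀ x ∈ ball x₀ r, AEStronglyMeasurable (G x) μ)
    (hmeas' : AEStronglyMeasurable (fun t => fderiv ℂ (fun x => G x t) x₀) μ)
    (hd : ∀ᵐ t ∂μ, DifferentiableOn ℂ (fun x => G x t) (ball x₀ r))
    (hG : ∀ᵐ t ∂μ, ∀ x ∈ ball x₀ r, ‖G x t‖ ≤ b t) :
    Integrable (fun t => fderiv ℂ (fun x => G x t) x₀) μ ∧
      HasFDerivAt (fun x => ∫ t, G x t ∂μ) (∫ t, fderiv ℂ (fun x => G x t) x₀ ∂μ) x₀ := by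
  have hx₀ : x₀ ∈ ball x₀ r := mem_ball_self hr
  refine hasFDerivAt_integral_of_dominated_loc_of_lip' (ball_mem_nhds x₀ hr) hmeas
    (hb.mono' (hmeas x₀ hx₀) (hG.mono fun t ht => ht x₀ hx₀)) hmeas'
    (bound := fun t => (b t + b t) / r) ?_ ((hb.add hb).div_const r) ?_
  · filter_upwards [hd, hG] with t hdt hGt x hx
    rw [← dist_eq_norm, ← dist_eq_norm]
    refine Complex.dist_le_div_mul_dist_of_mapsTo_ball hdt (fun y hy => ?_) hx
    rw [mem_closedBall, dist_eq_norm]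
    exact (norm_sub_le _ _).trans (add_le_add (hGt y hy) (hGt x₀ hx₀))
  · filter_upwards [hd] with t hdt
    exact (hdt.differentiableAt (ball_mem_nhds x₀ hr)).hasFDerivAt

theorem exists_ball_bound {D : Set (ℂ × ℂ)} (hD : IsOpen D) {b : ℂ × ℂ → ℝ}
    (hb : ContinuousOn b D) {x₀ : ℂ × ℂ} (hx₀ : x₀ ∈ D) :
    ∃ r > 0, ball x₀ r ⊆ D ∧ ∀ x ∈ ball x₀ r, b x ≤ b x₀ + 1 := by
  have h1 : ∀ᶠ x in 𝓝 x₀, b x < b x₀ + 1 :=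
    (hb.continuousAt (hD.mem_nhds hx₀)).eventually_lt_const (by linarith)
  obtain ⟨r, hr, h⟩ := Metric.eventually_nhds_iff_ball.1 (h1.and (hD.mem_nhds hx₀))
  exact ⟨r, hr, fun x hx => (h x hx).2, fun x hx => (h x hx).1.le⟩

section Ray

variable {D : Set (ℂ × ℂ)} {e : ℂ × ℂ} {g : ℂ × ℂ → ℂ} {b : ℂ × ℂ → ℝ} {δ : ℝ}

theorem hasFDerivAt_rayIntegral (hD : IsOpen D)
    (hray : ∀ x ∈ D, ∀ t : ℝ, 0 ≤ t → x + (t : ℂ) • e ∈ D) (hg : DifferentiableOn ℂ g D)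
    (hb : ContinuousOn b D) (hδ : 0 < δ)
    (hbound : ∀ x ∈ D, ∀ t : ℝ, 0 ≤ t → ‖g (x + (t : ℂ) • e)‖ ≤ b x * Real.exp (-δ * t))
    {x : ℂ × ℂ} (hx : x ∈ D) :
    IntegrableOn (fun t : ℝ => fderiv ℂ g (x + (t : ℂ) • e)) (Ioi 0) ∧
      HasFDerivAt (fun x => ∫ t in Ioi (0 : ℝ), g (x + (t : ℂ) • e))
        (∫ t in Ioi (0 : ℝ), fderiv ℂ g (x + (t : ℂ) • e)) x := by
  obtain ⟨r, hr, hrD, hrb⟩ := exists_ball_bound hD hb hx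
  have hfd : ∀ t : ℝ, (fderiv ℂ (fun y => g (y + (t : ℂ) • e)) x)
      = fderiv ℂ g (x + (t : ℂ) • e) := fun t => fderiv_comp_add_right _
  have key := hasFDerivAt_integral_of_holomorphic (μ := volume.restrict (Ioi (0 : ℝ)))
    (G := fun y t => g (y + ((t : ℝ) : ℂ) • e)) (x₀ := x) hr
    (b := fun t => (b x + 1) * Real.exp (-δ * t)) ?_ ?_ ?_ ?_ ?_
  · simp only [hfd] at key
    exact key
  · exact (integrableOn_exp_mul_Ioi (by linarith) 0).const_mul _
  · intro y hy
    refine ContinuousOn.aestronglyMeasurable ?_ measurableSet_Ioi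
    refine hg.continuousOn.comp (by fun_prop) fun t ht => hray y (hrD hy) t (le_of_lt ht)
  · simp only [hfd]
    exact ((measurable_fderiv ℂ g).comp (by fun_prop)).aestronglyMeasurable
  · refine (ae_restrict_mem measurableSet_Ioi).mono fun t ht => ?_
    exact hg.comp (by fun_prop) fun y hy => hray y (hrD hy) t (le_of_lt ht)
  · refine (ae_restrict_mem measurableSet_Ioi).mono fun t ht y hy => ?_
    refine (hbound y (hrD hy) t (le_of_lt ht)).trans ?_
    gcongr
    exact hrb y hy

theorem norm_rayIntegral_le (hδ : 0 < δ) {x : ℂ × ℂ}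
    (hbound : ∀ t : ℝ, 0 ≤ t → ‖g (x + (t : ℂ) • e)‖ ≤ b x * Real.exp (-δ * t)) :
    ‖∫ t in Ioi (0 : ℝ), g (x + (t : ℂ) • e)‖ ≤ b x / δ := by
  have h := norm_integral_le_of_norm_le (μ := volume.restrict (Ioi (0 : ℝ)))
    ((integrableOn_exp_mul_Ioi (neg_lt_zero.2 hδ) 0).const_mul (b x))
    ((ae_restrict_mem measurableSet_Ioi).mono fun t ht => hbound t (le_of_lt ht))
  refine h.trans (le_of_eq ?_)
  rw [integral_const_mul, integral_exp_mul_Ioi (by linarith)]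
  simp [div_eq_mul_inv]

/-- If the form `g · e^* + g₂ · v^*` is closed and `g₂` vanishes at infinity along the rays, then
the ray integral of `g` has derivative `-g₂` in the direction `v`. The case `g₂ = g`, `v = e` is
the fundamental theorem of calculus. -/
theorem fderiv_rayIntegral_apply (hD : IsOpen D)
    (hray : ∀ x ∈ D, ∀ t : ℝ, 0 ≤ t → x + (t : ℂ) • e ∈ D) (hg : DifferentiableOn ℂ g D)
    (hb : ContinuousOn b D) (hδ : 0 < δ)
    (hbound : ∀ x ∈ D, ∀ t : ℝ, 0 ≤ t → ‖g (x + (t : ℂ) • e)‖ ≤ b x * Real.exp (-δ * t))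
    {g₂ : ℂ × ℂ → ℂ} {v : ℂ × ℂ} (hg₂ : DifferentiableOn ℂ g₂ D)
    (hclosed : ∀ y ∈ D, fderiv ℂ g y v = fderiv ℂ g₂ y e) {x : ℂ × ℂ} (hx : x ∈ D)
    (hlim : Tendsto (fun t : ℝ => g₂ (x + (t : ℂ) • e)) atTop (𝓝 0)) :
    fderiv ℂ (fun x => ∫ t in Ioi (0 : ℝ), g (x + (t : ℂ) • e)) x v = - g₂ x := by
  obtain ⟨hint, hder⟩ := hasFDerivAt_rayIntegral hD hray hg hb hδ hbound hx
  rw [hder.fderiv, ContinuousLinearMap.integral_apply hint]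
  have hint' : IntegrableOn (fun t : ℝ => fderiv ℂ g₂ (x + (t : ℂ) • e) e) (Ioi 0) := by
    refine IntegrableOn.congr_fun (hint.apply_continuousLinearMap v) (fun t ht => ?_)
      measurableSet_Ioi
    exact hclosed _ (hray x hx t (le_of_lt ht))
  rw [setIntegral_congr_fun measurableSet_Ioi
    (fun t ht => hclosed _ (hray x hx t (le_of_lt ht)))]
  have h := integral_Ioi_of_hasDerivAt_of_tendsto' (a := 0)
    (f := fun t : ℝ => g₂ (x + (t : ℂ) • e)) (fun t ht => ?_) hint' hlim
  · simpa using h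
  · have h1 : HasDerivAt (fun t : ℝ => x + (t : ℂ) • e) ((1 : ℂ) • e) t :=
      ((Complex.ofRealCLM.hasDerivAt (x := t)).smul_const e).const_add x
    rw [one_smul] at h1
    have h2 := (hg₂.differentiableAt (hD.mem_nhds (hray x hx t ht))).hasFDerivAt
    exact (h2.restrictScalars ℝ).comp_hasDerivAt t h1

end Ray

section Segment

variable {D : Set (ℂ × ℂ)} {g : ℂ × ℂ → ℂ} {w₀ : ℂ}

/-- The integral of `g dw` from `w₀` to `w` along the segment, with the second variable fixed, is
holomorphic in both variables, and its `w`-derivative is `g`: the differentiated integrand is the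
derivative of `t ↦ t g(w₀ + t (w - w₀), z)`. -/
theorem hasFDerivAt_segmentIntegral (hD : IsOpen D)
    (hseg : ∀ x ∈ D, ∀ t ∈ Icc (0 : ℝ) 1, (w₀ + t * (x.1 - w₀), x.2) ∈ D)
    (hg : DifferentiableOn ℂ g D) {x : ℂ × ℂ} (hx : x ∈ D) :
    ∃ F' : ℂ × ℂ →L[ℂ] ℂ, HasFDerivAt
      (fun x : ℂ × ℂ => ∫ t in Icc (0 : ℝ) 1, (x.1 - w₀) * g (w₀ + t * (x.1 - w₀), x.2)) F' x ∧
      F' (1, 0) = g x := by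
  set G : ℂ × ℂ → ℝ → ℂ := fun x t => (x.1 - w₀) * g (w₀ + t * (x.1 - w₀), x.2) with hGdef
  set p : ℂ × ℂ → ℝ → ℂ × ℂ := fun x t => (w₀ + t * (x.1 - w₀), x.2) with hp
  set A : ℝ → ℂ × ℂ →L[ℂ] ℂ × ℂ := fun t =>
    ((t : ℂ) • ContinuousLinearMap.fst ℂ ℂ ℂ).prod (ContinuousLinearMap.snd ℂ ℂ ℂ) with hA
  have hpder : ∀ (t : ℝ) (y : ℂ × ℂ), HasFDerivAt (fun y => p y t) (A t) y := by
    intro t y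
    refine HasFDerivAt.prodMk ?_ hasFDerivAt_snd
    exact ((hasFDerivAt_fst.sub_const w₀).const_mul (t : ℂ)).const_add w₀
  have hGder : ∀ t ∈ Icc (0 : ℝ) 1, ∀ y ∈ D, HasFDerivAt (fun y => G y t)
      ((y.1 - w₀) • (fderiv ℂ g (p y t)).comp (A t) +
        g (p y t) • ContinuousLinearMap.fst ℂ ℂ ℂ) y := by
    intro t ht y hy
    have h1 := ((hg.differentiableAt (hD.mem_nhds (hseg y hy t ht))).hasFDerivAt).comp y
      (hpder t y)
    exact (hasFDerivAt_fst.sub_const w₀).mul h1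
  -- a compact neighbourhood of `x` gives a uniform bound on the segments
  obtain ⟨r, hr, hrD, M, hM⟩ : ∃ r > 0, ball x r ⊆ D ∧ ∃ M : ℝ, ∀ y ∈ ball x r,
      ∀ t ∈ Icc (0 : ℝ) 1, ‖G y t‖ ≤ M := by
    obtain ⟨r, hr, hrD⟩ := Metric.nhds_basis_closedBall.mem_iff.1 (hD.mem_nhds hx)
    have hK : IsCompact (closedBall x r ×ˢ Icc (0 : ℝ) 1) :=
      (isCompact_closedBall x r).prod isCompact_Icc
    have hc : ContinuousOn (fun q : (ℂ × ℂ) × ℝ => G q.1 q.2)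
        (closedBall x r ×ˢ Icc (0 : ℝ) 1) := by
      refine ContinuousOn.mul (by fun_prop) ?_
      exact hg.continuousOn.comp (by fun_prop) fun q hq => hseg _ (hrD hq.1) _ hq.2
    obtain ⟨M, hM⟩ := hK.exists_bound_of_continuousOn hc
    exact ⟨r, hr, ball_subset_closedBall.trans hrD, M, fun y hy t ht =>
      hM (y, t) ⟨ball_subset_closedBall hy, ht⟩⟩
  have hmem := ae_restrict_mem (μ := volume) (measurableSet_Icc (a := (0 : ℝ)) (b := 1))
  have key := hasFDerivAt_integral_of_holomorphic (μ := volume.restrict (Icc (0 : ℝ) 1))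
    (G := G) (x₀ := x) hr (b := fun _ => M) (integrable_const _) ?_ ?_ ?_ ?_
  · refine ⟨_, key.2, ?_⟩
    rw [ContinuousLinearMap.integral_apply key.1]
    have hder : ∀ t ∈ Icc (0 : ℝ) 1, HasDerivAt (fun t : ℝ => (t : ℂ) * g (p x t))
        (fderiv ℂ (fun y => G y t) x (1, 0)) t := by
      intro t ht
      have h1 : HasDerivAt (fun t : ℝ => p x t) (x.1 - w₀, 0) t := by
        refine HasDerivAt.prodMk ?_ (hasDerivAt_const t x.2)
        simpa using ((Complex.ofRealCLM.hasDerivAt (x := t)).mul_const (x.1 - w₀)).const_add w₀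
      have h2 := (((hg.differentiableAt (hD.mem_nhds (hseg x hx t ht))).hasFDerivAt).restrictScalars
        ℝ).comp_hasDerivAt t h1
      have h3 := (Complex.ofRealCLM.hasDerivAt (x := t)).mul h2
      refine h3.congr_deriv ?_
      rw [(hGder t ht x hx).fderiv]
      have h4 : ((t : ℂ), (0 : ℂ)) = (t : ℂ) • ((1 : ℂ), (0 : ℂ)) := by simp
      have h5 : (x.1 - w₀, (0 : ℂ)) = (x.1 - w₀) • ((1 : ℂ), (0 : ℂ)) := by simp
      simp only [hA, add_apply, smul_apply,
        ContinuousLinearMap.comp_apply, ContinuousLinearMap.prod_apply,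
        ContinuousLinearMap.coe_fst', ContinuousLinearMap.coe_snd', smul_eq_mul, mul_one,
        ContinuousLinearMap.coe_restrictScalars', Complex.ofRealCLM_apply, Complex.ofReal_one,
        one_mul]
      rw [h4, h5, map_smul, map_smul]
      simp only [smul_eq_mul, hp, Function.comp_apply]
      ring
    rw [integral_Icc_eq_integral_Ioc, ← intervalIntegral.integral_of_le zero_le_one,
      intervalIntegral.integral_eq_sub_of_hasDerivAt
        (f := fun t : ℝ => (t : ℂ) * g (p x t)) ?_ ?_]
    · simp [hp]
    · intro t ht
      rw [uIcc_of_le zero_le_one] at ht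
      exact hder t ht
    · rw [intervalIntegrable_iff_integrableOn_Icc_of_le zero_le_one]
      exact key.1.apply_continuousLinearMap _
  · intro y hy
    refine ContinuousOn.aestronglyMeasurable ?_ measurableSet_Icc
    refine ContinuousOn.mul (by fun_prop) ?_
    exact hg.continuousOn.comp (by fun_prop) fun t ht => hseg _ (hrD hy) _ ht
  · have hcongr : (fun t => fderiv ℂ (fun y => G y t) x) =ᵐ[volume.restrict (Icc (0 : ℝ) 1)]
        fun t => (x.1 - w₀) • (fderiv ℂ g (p x t)).comp (A t) +
        g (p x t) • ContinuousLinearMap.fst ℂ ℂ ℂ :=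
      hmem.mono fun t ht => (hGder t ht x hx).fderiv
    refine AEStronglyMeasurable.congr ?_ hcongr.symm
    have hpc : Continuous (fun t => p x t) := by fun_prop
    have hAc : Continuous A := by
      have : A = fun t : ℝ => (t : ℂ) • (ContinuousLinearMap.fst ℂ ℂ ℂ).prod
          (0 : ℂ × ℂ →L[ℂ] ℂ) + (0 : ℂ × ℂ →L[ℂ] ℂ).prod (ContinuousLinearMap.snd ℂ ℂ ℂ) := by
        funext t
        ext <;> simp [hA]
      rw [this]
      fun_prop
    have h1 : Measurable fun t => fderiv ℂ g (p x t) :=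
      (measurable_fderiv ℂ g).comp hpc.measurable
    refine AEStronglyMeasurable.add ?_ ?_
    · have hcomp : Continuous fun q : (ℂ × ℂ →L[ℂ] ℂ) × (ℂ × ℂ →L[ℂ] ℂ × ℂ) => q.1.comp q.2 :=
        by fun_prop
      exact (hcomp.comp_aestronglyMeasurable
        (h1.aestronglyMeasurable.prodMk hAc.aestronglyMeasurable)).const_smul (x.1 - w₀)
    · refine AEStronglyMeasurable.smul_const ?_ _
      refine ContinuousOn.aestronglyMeasurable ?_ measurableSet_Icc
      exact hg.continuousOn.comp hpc.continuousOn fun t ht => hseg _ hx _ ht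
  · refine hmem.mono fun t ht y hy => ?_
    exact (hGder t ht y (hrD hy)).differentiableAt.differentiableWithinAt
  · exact hmem.mono fun t ht y hy => hM y hy t ht

end Segment

/-- The Poincaré lemma for a holomorphic form `g₁ dw + g₂ dz` on an open convex set. -/
theorem Convex.exists_primitive_of_closed {D : Set (ℂ × ℂ)} (hconv : Convex ℝ D) (hD : IsOpen D)
    {g₁ g₂ : ℂ × ℂ → ℂ} (hg₁ : DifferentiableOn ℂ g₁ D) (hg₂ : DifferentiableOn ℂ g₂ D)
    (hclosed : ∀ x ∈ D, fderiv ℂ g₁ x (0, 1) = fderiv ℂ g₂ x (1, 0)) :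
    ∃ F : ℂ × ℂ → ℂ, ∀ x ∈ D, HasFDerivAt F
      (g₁ x • ContinuousLinearMap.fst ℂ ℂ ℂ + g₂ x • ContinuousLinearMap.snd ℂ ℂ ℂ) x := by
  set form : ℂ × ℂ → ℂ × ℂ →L[ℂ] ℂ := fun x =>
    g₁ x • ContinuousLinearMap.fst ℂ ℂ ℂ + g₂ x • ContinuousLinearMap.snd ℂ ℂ ℂ with hform
  have hder : ∀ x ∈ D, HasFDerivAt form
      ((fderiv ℂ g₁ x).smulRight (ContinuousLinearMap.fst ℂ ℂ ℂ) +
        (fderiv ℂ g₂ x).smulRight (ContinuousLinearMap.snd ℂ ℂ ℂ)) x := fun x hx => by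
    have h1 := (hg₁.differentiableAt (hD.mem_nhds hx)).hasFDerivAt.smul_const
      (ContinuousLinearMap.fst ℂ ℂ ℂ)
    have h2 := (hg₂.differentiableAt (hD.mem_nhds hx)).hasFDerivAt.smul_const
      (ContinuousLinearMap.snd ℂ ℂ ℂ)
    exact h1.add h2
  refine hconv.exists_forall_hasFDerivAt_of_fderiv_symmetric hD
    (fun x hx => ((hder x hx).restrictScalars ℝ).differentiableAt.differentiableWithinAt)
    fun x hx a c => ?_
  rw [((hder x hx).restrictScalars ℝ).fderiv]
  have hdec : ∀ (f : ℂ × ℂ →L[ℂ] ℂ) (q : ℂ × ℂ), f q = q.1 * f (1, 0) + q.2 * f (0, 1) := by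
    intro f q
    have : q = q.1 • ((1 : ℂ), (0 : ℂ)) + q.2 • ((0 : ℂ), (1 : ℂ)) := by ext <;> simp
    conv_lhs => rw [this]
    simp only [map_add, map_smul, smul_eq_mul]
  simp only [ContinuousLinearMap.coe_restrictScalars', add_apply,
    ContinuousLinearMap.smulRight_apply, smul_apply, smul_eq_mul,
    ContinuousLinearMap.coe_fst', ContinuousLinearMap.coe_snd']
  rw [hdec (fderiv ℂ g₁ x) a, hdec (fderiv ℂ g₂ x) a, hdec (fderiv ℂ g₁ x) c,
    hdec (fderiv ℂ g₂ x) c, hclosed x hx]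
  ring

/-! ### Twisted equations on domains in `ℂ²` -/

/-- Polynomial growth on `D`. It is used where both coordinates have norm at least `1`, so that a
single exponent for the product `‖w‖ ‖z‖` suffices. -/
def PolyGrowthOn (D : Set (ℂ × ℂ)) (f : ℂ × ℂ → ℂ) : Prop :=
  ∃ (C : ℝ) (N : ℕ), ∀ p ∈ D, ‖f p‖ ≤ C * (‖p.1‖ * ‖p.2‖) ^ N

/-- On `D`, `u` solves the equation `∂_v u + ∂_v A · u = r`, whose homogeneous solution is
`e^{-A}`. -/
def SolvesTwisted (D : Set (ℂ × ℂ)) (A : ℂ × ℂ → ℂ) (v : ℂ × ℂ) (r u : ℂ × ℂ → ℂ) : Prop :=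
  ∀ p ∈ D, fderiv ℂ u p v + fderiv ℂ A p v * u p = r p

theorem fderiv_mul_exp_neg {A F : ℂ × ℂ → ℂ} {p v : ℂ × ℂ} {r : ℂ}
    (hA : DifferentiableAt ℂ A p) (hF : DifferentiableAt ℂ F p)
    (h : fderiv ℂ F p v = Complex.exp (A p) * r) :
    fderiv ℂ (fun q => F q * Complex.exp (-A q)) p v
      + fderiv ℂ A p v * (F p * Complex.exp (-A p)) = r := by
  have h1 := hF.hasFDerivAt.mul (hA.hasFDerivAt.neg.cexp)
  have h2 : fderiv ℂ (fun q => F q * Complex.exp (-A q)) p = _ := h1.fderiv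
  rw [h2]
  have h3 : Complex.exp (-A p) * Complex.exp (A p) = 1 := by
    rw [← Complex.exp_add]; simp
  simp only [add_apply, smul_apply, neg_apply, smul_eq_mul, h]
  linear_combination r * h3

theorem fderiv_exp_mul {A r : ℂ × ℂ → ℂ} {p v : ℂ × ℂ}
    (hA : DifferentiableAt ℂ A p) (hr : DifferentiableAt ℂ r p) :
    fderiv ℂ (fun q => Complex.exp (A q) * r q) p v
      = Complex.exp (A p) * (fderiv ℂ r p v + fderiv ℂ A p v * r p) := by
  have h1 := (hA.hasFDerivAt.cexp).mul hr.hasFDerivAt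
  have h2 : fderiv ℂ (fun q => Complex.exp (A q) * r q) p = _ := h1.fderiv
  rw [h2]
  simp only [add_apply, smul_apply, smul_eq_mul]
  ring

theorem exists_one_add_pow_le_exp (N : ℕ) {δ : ℝ} (hδ : 0 < δ) :
    ∃ K : ℝ, 0 ≤ K ∧ ∀ t : ℝ, 0 ≤ t → (1 + t) ^ N ≤ K * Real.exp (δ * t) := by
  refine ⟨N.factorial / δ ^ N * Real.exp δ, by positivity, fun t ht => ?_⟩
  have h := Real.pow_div_factorial_le_exp (δ * (1 + t)) (by positivity) N
  have hN : (0 : ℝ) < N.factorial := by positivity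
  rw [div_le_iff₀ hN, mul_pow] at h
  have h2 : Real.exp (δ * (1 + t)) = Real.exp δ * Real.exp (δ * t) := by
    rw [← Real.exp_add]; ring_nf
  rw [h2] at h
  rw [mul_assoc, div_mul_eq_mul_div, le_div_iff₀ (by positivity)]
  linarith

section Decay

variable {D : Set (ℂ × ℂ)} {A : ℂ × ℂ → ℂ} {τ : ℂ} {δ : ℝ}

/-- The exponential decay of `e^A` along the rays absorbs the polynomial growth of `r`, at the
cost of half the rate. -/
theorem exists_decay_along_rays (hD1 : ∀ p ∈ D, 1 ≤ ‖p.1‖ ∧ 1 ≤ ‖p.2‖) (hδ : 0 < δ)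
    (hray : ∀ p ∈ D, ∀ t : ℝ, 0 ≤ t → p + (t : ℂ) • (τ, (0 : ℂ)) ∈ D)
    {C : ℝ} {N : ℕ}
    (hdecay : ∀ p ∈ D, ∀ t : ℝ, 0 ≤ t → ‖Complex.exp (A (p + (t : ℂ) • (τ, (0 : ℂ))) - A p)‖
      ≤ C * (‖p.1‖ * ‖p.2‖ * (1 + t)) ^ N * Real.exp (-δ * t))
    {r : ℂ × ℂ → ℂ} (hr : PolyGrowthOn D r) :
    ∃ (K : ℝ) (M : ℕ), ∀ p ∈ D, ∀ t : ℝ, 0 ≤ t →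
      ‖Complex.exp (A (p + (t : ℂ) • (τ, (0 : ℂ)))) * r (p + (t : ℂ) • (τ, (0 : ℂ)))‖
      ≤ ‖Complex.exp (A p)‖ * (K * (‖p.1‖ * ‖p.2‖) ^ M) * Real.exp (-(δ / 2) * t) := by
  obtain ⟨C₁, N₁, h₁⟩ := hr
  obtain ⟨K, hK0, hK⟩ := exists_one_add_pow_le_exp (N + N₁) (half_pos hδ)
  refine ⟨|C| * (|C₁| * (1 + ‖τ‖) ^ N₁) * K, N + N₁, fun p hp t ht => ?_⟩
  obtain ⟨hp1, hp2⟩ := hD1 p hp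
  set q := p + (t : ℂ) • (τ, (0 : ℂ)) with hq
  have hq1 : q.1 = p.1 + t * τ := by simp [hq]
  have hq2 : q.2 = p.2 := by simp [hq]
  have hnorm : ‖q.1‖ ≤ ‖p.1‖ * ((1 + ‖τ‖) * (1 + t)) := by
    have h1 : ‖q.1‖ ≤ ‖p.1‖ + t * ‖τ‖ := by
      rw [hq1]
      refine (norm_add_le _ _).trans ?_
      rw [norm_mul, Complex.norm_real, Real.norm_of_nonneg ht]
    nlinarith [mul_nonneg ht (norm_nonneg τ),
      mul_nonneg (sub_nonneg.2 hp1) (mul_nonneg ht (norm_nonneg τ)),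
      mul_nonneg (norm_nonneg p.1) (norm_nonneg τ), mul_nonneg (norm_nonneg p.1) ht]
  have hexp : ‖Complex.exp (A q)‖ = ‖Complex.exp (A p)‖ * ‖Complex.exp (A q - A p)‖ := by
    rw [← norm_mul, ← Complex.exp_add]; ring_nf
  have hr1 : ‖r q‖ ≤ |C₁| * (1 + ‖τ‖) ^ N₁ * (‖p.1‖ * ‖p.2‖ * (1 + t)) ^ N₁ := by
    refine (h₁ q (hray p hp t ht)).trans ?_
    rw [mul_assoc, ← mul_pow]
    refine (mul_le_mul_of_nonneg_right (le_abs_self C₁) (by positivity)).trans ?_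
    refine mul_le_mul_of_nonneg_left (pow_le_pow_left₀ (by positivity) ?_ _) (abs_nonneg _)
    rw [hq2]
    calc ‖q.1‖ * ‖p.2‖ ≤ ‖p.1‖ * ((1 + ‖τ‖) * (1 + t)) * ‖p.2‖ := by gcongr
      _ = (1 + ‖τ‖) * (‖p.1‖ * ‖p.2‖ * (1 + t)) := by ring
  have he1 : ‖Complex.exp (A q - A p)‖
      ≤ |C| * (‖p.1‖ * ‖p.2‖ * (1 + t)) ^ N * Real.exp (-δ * t) := by
    refine (hdecay p hp t ht).trans ?_
    gcongr
    exact le_abs_self C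
  have hsplit : Real.exp (-δ * t) * Real.exp (δ / 2 * t) = Real.exp (-(δ / 2) * t) := by
    rw [← Real.exp_add]; ring_nf
  rw [norm_mul, hexp, mul_assoc, mul_assoc]
  refine mul_le_mul_of_nonneg_left ?_ (norm_nonneg _)
  calc ‖Complex.exp (A q - A p)‖ * ‖r q‖
      ≤ (|C| * (‖p.1‖ * ‖p.2‖ * (1 + t)) ^ N * Real.exp (-δ * t)) *
        (|C₁| * (1 + ‖τ‖) ^ N₁ * (‖p.1‖ * ‖p.2‖ * (1 + t)) ^ N₁) := by gcongr
    _ = |C| * (|C₁| * (1 + ‖τ‖) ^ N₁) * (‖p.1‖ * ‖p.2‖) ^ (N + N₁) *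
        ((1 + t) ^ (N + N₁) * Real.exp (-δ * t)) := by
      rw [mul_pow _ (1 + t), mul_pow _ (1 + t), pow_add, pow_add]; ring
    _ ≤ |C| * (|C₁| * (1 + ‖τ‖) ^ N₁) * (‖p.1‖ * ‖p.2‖) ^ (N + N₁) *
        (K * Real.exp (δ / 2 * t) * Real.exp (-δ * t)) := by
      gcongr
      exact hK t ht
    _ = _ := by rw [← hsplit]; ring

/-- If `e^A` decays exponentially along the rays in direction `τ`, integration of `e^A r₁` from
infinity along these rays gives a solution of polynomial growth. The same function solves the
second equation for every compatible right-hand side `r₂`. -/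
theorem exists_solution_of_decay (hD : IsOpen D) (hD1 : ∀ p ∈ D, 1 ≤ ‖p.1‖ ∧ 1 ≤ ‖p.2‖)
    (hδ : 0 < δ)
    (hray : ∀ p ∈ D, ∀ t : ℝ, 0 ≤ t → p + (t : ℂ) • (τ, (0 : ℂ)) ∈ D)
    (hA : DifferentiableOn ℂ A D) {C : ℝ} {N : ℕ}
    (hdecay : ∀ p ∈ D, ∀ t : ℝ, 0 ≤ t → ‖Complex.exp (A (p + (t : ℂ) • (τ, (0 : ℂ))) - A p)‖
      ≤ C * (‖p.1‖ * ‖p.2‖ * (1 + t)) ^ N * Real.exp (-δ * t))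
    {r₁ : ℂ × ℂ → ℂ} (hr₁ : DifferentiableOn ℂ r₁ D) (hg₁ : PolyGrowthOn D r₁) :
    ∃ u : ℂ × ℂ → ℂ, DifferentiableOn ℂ u D ∧ PolyGrowthOn D u ∧
      SolvesTwisted D A (1, 0) r₁ u ∧
      ∀ r₂ : ℂ × ℂ → ℂ, DifferentiableOn ℂ r₂ D → PolyGrowthOn D r₂ →
        (∀ p ∈ D, fderiv ℂ r₂ p (1, 0) + fderiv ℂ A p (1, 0) * r₂ p
          = fderiv ℂ r₁ p (0, 1) + fderiv ℂ A p (0, 1) * r₁ p) →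
        SolvesTwisted D A (0, 1) r₂ u := by
  set e : ℂ × ℂ := (τ, 0) with he
  have hee : e = τ • ((1 : ℂ), (0 : ℂ)) := by simp [he]
  have hAat : ∀ p ∈ D, DifferentiableAt ℂ A p := fun p hp => hA.differentiableAt (hD.mem_nhds hp)
  have hr₁at : ∀ p ∈ D, DifferentiableAt ℂ r₁ p := fun p hp =>
    hr₁.differentiableAt (hD.mem_nhds hp)
  have hE : ∀ r : ℂ × ℂ → ℂ, DifferentiableOn ℂ r D →
      DifferentiableOn ℂ (fun q => Complex.exp (A q) * r q) D := fun r hr => hA.cexp.mul hr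
  set g : ℂ × ℂ → ℂ := fun q => τ * (Complex.exp (A q) * r₁ q) with hgdef
  have hgdiff : DifferentiableOn ℂ g D := (hE r₁ hr₁).const_mul τ
  have hgder : ∀ p ∈ D, ∀ v, fderiv ℂ g p v
      = τ * fderiv ℂ (fun q => Complex.exp (A q) * r₁ q) p v := by
    intro p hp v
    rw [hgdef, fderiv_const_mul ((hE r₁ hr₁).differentiableAt (hD.mem_nhds hp))]
    simp
  obtain ⟨K, M, hK⟩ := exists_decay_along_rays hD1 hδ hray hdecay hg₁
  set b : ℂ × ℂ → ℝ := fun p =>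
    ‖τ‖ * (‖Complex.exp (A p)‖ * (K * (‖p.1‖ * ‖p.2‖) ^ M)) with hb
  have hbc : ContinuousOn b D := by
    have := hA.continuousOn.cexp.norm
    fun_prop
  have hbound : ∀ p ∈ D, ∀ t : ℝ, 0 ≤ t →
      ‖g (p + (t : ℂ) • e)‖ ≤ b p * Real.exp (-(δ / 2) * t) := by
    intro p hp t ht
    rw [hgdef, norm_mul, hb, mul_assoc]
    exact mul_le_mul_of_nonneg_left (hK p hp t ht) (norm_nonneg _)
  have hδ2 := half_pos hδ
  set H : ℂ × ℂ → ℂ := fun p => ∫ t in Ioi (0 : ℝ), g (p + (t : ℂ) • e) with hH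
  have hHd : ∀ p ∈ D, DifferentiableAt ℂ H p := fun p hp =>
    (hasFDerivAt_rayIntegral hD hray hgdiff hbc hδ2 hbound hp).2.differentiableAt
  have hlim : ∀ r : ℂ × ℂ → ℂ, PolyGrowthOn D r → ∀ p ∈ D, Tendsto (fun t : ℝ =>
      Complex.exp (A (p + (t : ℂ) • e)) * r (p + (t : ℂ) • e)) atTop (𝓝 0) := by
    intro r hr p hp
    obtain ⟨K', M', hK'⟩ := exists_decay_along_rays hD1 hδ hray hdecay hr
    refine squeeze_zero_norm' ((eventually_ge_atTop 0).mono fun t ht => hK' p hp t ht) ?_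
    have h1 : Tendsto (fun t : ℝ => Real.exp (-(δ / 2) * t)) atTop (𝓝 0) :=
      Real.tendsto_exp_atBot.comp (tendsto_id.const_mul_atTop_of_neg (by linarith))
    simpa using h1.const_mul (‖Complex.exp (A p)‖ * (K' * (‖p.1‖ * ‖p.2‖) ^ M'))
  have hfinal : ∀ (v : ℂ × ℂ) (r : ℂ × ℂ → ℂ), DifferentiableOn ℂ r D → PolyGrowthOn D r →
      (∀ p ∈ D, fderiv ℂ g p v = fderiv ℂ (fun q => Complex.exp (A q) * r q) p e) →
      SolvesTwisted D A v r (fun q => -H q * Complex.exp (-A q)) := by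
    intro v r hr hrg hcl p hp
    refine fderiv_mul_exp_neg (hAat p hp) (hHd p hp).neg ?_
    have := fderiv_rayIntegral_apply hD hray hgdiff hbc hδ2 hbound (hE r hr) hcl hp
      (hlim r hrg p hp)
    have h2 : fderiv ℂ (fun q => -H q) p v = -fderiv ℂ H p v := by
      rw [fderiv_fun_neg]; rfl
    rw [h2, this, neg_neg]
  refine ⟨fun q => -H q * Complex.exp (-A q), ?_, ?_, ?_, ?_⟩
  · intro p hp
    exact ((hHd p hp).neg.mul (hAat p hp).neg.cexp).differentiableWithinAt
  · refine ⟨‖τ‖ * K / (δ / 2), M, fun p hp => ?_⟩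
    have h1 := norm_rayIntegral_le hδ2 (hbound p hp)
    rw [norm_mul, norm_neg]
    have h3 : ‖Complex.exp (A p)‖ * ‖Complex.exp (-A p)‖ = 1 := by
      rw [← norm_mul, ← Complex.exp_add]; simp
    calc ‖H p‖ * ‖Complex.exp (-A p)‖ ≤ b p / (δ / 2) * ‖Complex.exp (-A p)‖ := by gcongr
      _ = ‖τ‖ * K / (δ / 2) * (‖p.1‖ * ‖p.2‖) ^ M *
          (‖Complex.exp (A p)‖ * ‖Complex.exp (-A p)‖) := by rw [hb]; ring
      _ = _ := by rw [h3, mul_one]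
  · refine hfinal _ r₁ hr₁ hg₁ fun p hp => ?_
    rw [hgder p hp, hee, map_smul, smul_eq_mul]
  · intro r₂ hr₂ hg₂ hcl
    refine hfinal _ r₂ hr₂ hg₂ fun p hp => ?_
    rw [hgder p hp, hee, map_smul, smul_eq_mul, fderiv_exp_mul (hAat p hp) (hr₁at p hp),
      fderiv_exp_mul (hAat p hp) (hr₂.differentiableAt (hD.mem_nhds hp)), hcl p hp]

end Decay

section Growth

variable {S Z S' Z' : Set ℂ} {A : ℂ × ℂ → ℂ} {w₀ z₀ : ℂ}

theorem add_mul_sub_mem {S : Set ℂ} (hS : Convex ℝ S) {a x : ℂ} (ha : a ∈ S) (hx : x ∈ S)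
    {t : ℝ} (ht : t ∈ Icc (0 : ℝ) 1) : a + t * (x - a) ∈ S := by
  have h := hS ha hx (sub_nonneg.2 ht.2) ht.1 (by ring)
  convert h using 1
  simp only [Complex.real_smul]
  push_cast
  ring

theorem norm_add_mul_sub_le {a x : ℂ} (hx : 1 ≤ ‖x‖) {t : ℝ} (ht : t ∈ Icc (0 : ℝ) 1) :
    ‖a + t * (x - a)‖ ≤ (1 + ‖a‖) * ‖x‖ := by
  have h1 : a + t * (x - a) = (1 - t : ℝ) * a + t * x := by push_cast; ring
  have h2 : ‖a + t * (x - a)‖ ≤ (1 - t) * ‖a‖ + t * ‖x‖ := by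
    rw [h1]
    refine (norm_add_le _ _).trans ?_
    rw [norm_mul, norm_mul, Complex.norm_real, Complex.norm_real,
      Real.norm_of_nonneg (sub_nonneg.2 ht.2), Real.norm_of_nonneg ht.1]
  nlinarith [norm_nonneg a, norm_nonneg x, ht.1, ht.2, mul_nonneg (norm_nonneg a) (sub_nonneg.2 hx),
    mul_nonneg ht.1 (norm_nonneg a), mul_nonneg (sub_nonneg.2 ht.2) (norm_nonneg x)]

/-- If `e^A` on the segment from `w₀` to `w` is at most polynomially larger than at the endpoint
`w`, the integrand of the segment integral is bounded by `‖e^{A(w, z)}‖` times a polynomial. -/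
theorem exists_bound_along_first_segment {C : ℝ} {N : ℕ} (hS : Convex ℝ S) (hw₀ : w₀ ∈ S)
    (hS' : S' ⊆ S) (hZ' : Z' ⊆ Z)
    (hS1 : ∀ w ∈ S, 1 ≤ ‖w‖) (hZ1 : ∀ z ∈ Z, 1 ≤ ‖z‖)
    (hgrow : ∀ w ∈ S', ∀ z ∈ Z', ∀ t ∈ Icc (0 : ℝ) 1,
      ‖Complex.exp (A (w₀ + t * (w - w₀), z) - A (w, z))‖ ≤ C * (‖w‖ * ‖z‖) ^ N)
    {r : ℂ × ℂ → ℂ} (hr : PolyGrowthOn (S ×ˢ Z) r) :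
    ∃ (K : ℝ) (M : ℕ), 0 ≤ K ∧ ∀ w ∈ S', ∀ z ∈ Z', ∀ t ∈ Icc (0 : ℝ) 1,
      ‖(w - w₀) * (Complex.exp (A (w₀ + t * (w - w₀), z)) * r (w₀ + t * (w - w₀), z))‖
        ≤ ‖Complex.exp (A (w, z))‖ * (K * (‖w‖ * ‖z‖) ^ M) := by
  obtain ⟨C₁, N₁, h₁⟩ := hr
  refine ⟨(1 + ‖w₀‖) * (|C| * (|C₁| * (1 + ‖w₀‖) ^ N₁)), 1 + (N + N₁), by positivity,
    fun w hw z hz t ht => ?_⟩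
  have hw1 := hS1 w (hS' hw)
  have hz1 := hZ1 z (hZ' hz)
  have hmem := add_mul_sub_mem hS hw₀ (hS' hw) ht
  set w' := w₀ + t * (w - w₀) with hw'
  have h1 : ‖w - w₀‖ ≤ (1 + ‖w₀‖) * (‖w‖ * ‖z‖) := by
    refine (norm_sub_le _ _).trans ?_
    have : ‖w‖ + ‖w₀‖ ≤ (1 + ‖w₀‖) * ‖w‖ := by
      nlinarith [mul_nonneg (norm_nonneg w₀) (sub_nonneg.2 hw1)]
    refine this.trans ?_
    gcongr
    nlinarith
  have hexp : ‖Complex.exp (A (w', z))‖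
      = ‖Complex.exp (A (w, z))‖ * ‖Complex.exp (A (w', z) - A (w, z))‖ := by
    rw [← norm_mul, ← Complex.exp_add]; ring_nf
  have h2 : ‖Complex.exp (A (w', z) - A (w, z))‖ ≤ |C| * (‖w‖ * ‖z‖) ^ N :=
    (hgrow w hw z hz t ht).trans (by gcongr; exact le_abs_self C)
  have h3 : ‖r (w', z)‖ ≤ |C₁| * (1 + ‖w₀‖) ^ N₁ * (‖w‖ * ‖z‖) ^ N₁ := by
    refine (h₁ _ ⟨hmem, hZ' hz⟩).trans ?_
    rw [mul_assoc, ← mul_pow]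
    refine (mul_le_mul_of_nonneg_right (le_abs_self C₁) (by positivity)).trans ?_
    refine mul_le_mul_of_nonneg_left (pow_le_pow_left₀ (by positivity) ?_ _) (abs_nonneg _)
    rw [← mul_assoc]
    gcongr
    exact norm_add_mul_sub_le hw1 ht
  rw [norm_mul, norm_mul, hexp]
  calc ‖w - w₀‖ * (‖Complex.exp (A (w, z))‖ * ‖Complex.exp (A (w', z) - A (w, z))‖ * ‖r (w', z)‖)
      ≤ ((1 + ‖w₀‖) * (‖w‖ * ‖z‖)) * (‖Complex.exp (A (w, z))‖ * (|C| * (‖w‖ * ‖z‖) ^ N) *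
        (|C₁| * (1 + ‖w₀‖) ^ N₁ * (‖w‖ * ‖z‖) ^ N₁)) := by gcongr
    _ = _ := by rw [pow_add, pow_add, pow_one]; ring

theorem polyGrowthOn_mul_exp_neg {D : Set (ℂ × ℂ)} {F : ℂ × ℂ → ℂ} {K : ℝ} {M : ℕ}
    (h : ∀ p ∈ D, ‖F p‖ ≤ ‖Complex.exp (A p)‖ * (K * (‖p.1‖ * ‖p.2‖) ^ M)) :
    PolyGrowthOn D (fun p => F p * Complex.exp (-A p)) := by
  refine ⟨K, M, fun p hp => ?_⟩
  have h3 : ‖Complex.exp (A p)‖ * ‖Complex.exp (-A p)‖ = 1 := by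
    rw [← norm_mul, ← Complex.exp_add]; simp
  rw [norm_mul]
  calc ‖F p‖ * ‖Complex.exp (-A p)‖
      ≤ ‖Complex.exp (A p)‖ * (K * (‖p.1‖ * ‖p.2‖) ^ M) * ‖Complex.exp (-A p)‖ := by
        gcongr; exact h p hp
    _ = (K * (‖p.1‖ * ‖p.2‖) ^ M) * (‖Complex.exp (A p)‖ * ‖Complex.exp (-A p)‖) := by ring
    _ = _ := by rw [h3, mul_one]

/-- One equation, solved by integration along the segment from `w₀` when `e^A` is, up to a
polynomial factor, largest at the endpoint. -/
theorem exists_solution_of_growth {C : ℝ} {N : ℕ} (hSo : IsOpen S) (hZo : IsOpen Z)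
    (hS : Convex ℝ S) (hw₀ : w₀ ∈ S)
    (hS' : S' ⊆ S) (hZ' : Z' ⊆ Z) (hS1 : ∀ w ∈ S, 1 ≤ ‖w‖) (hZ1 : ∀ z ∈ Z, 1 ≤ ‖z‖)
    (hA : DifferentiableOn ℂ A (S ×ˢ Z))
    (hgrow : ∀ w ∈ S', ∀ z ∈ Z', ∀ t ∈ Icc (0 : ℝ) 1,
      ‖Complex.exp (A (w₀ + t * (w - w₀), z) - A (w, z))‖ ≤ C * (‖w‖ * ‖z‖) ^ N)
    {r : ℂ × ℂ → ℂ} (hr : DifferentiableOn ℂ r (S ×ˢ Z)) (hg : PolyGrowthOn (S ×ˢ Z) r) :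
    ∃ u : ℂ × ℂ → ℂ, DifferentiableOn ℂ u (S' ×ˢ Z') ∧ PolyGrowthOn (S' ×ˢ Z') u ∧
      SolvesTwisted (S' ×ˢ Z') A (1, 0) r u := by
  have hD : IsOpen (S ×ˢ Z) := hSo.prod hZo
  have hsub : S' ×ˢ Z' ⊆ S ×ˢ Z := prod_mono hS' hZ'
  set g : ℂ × ℂ → ℂ := fun q => Complex.exp (A q) * r q with hgdef
  have hgd : DifferentiableOn ℂ g (S ×ˢ Z) := hA.cexp.mul hr
  set F : ℂ × ℂ → ℂ := fun x => ∫ t in Icc (0 : ℝ) 1, (x.1 - w₀) * g (w₀ + t * (x.1 - w₀), x.2)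
    with hF
  have key : ∀ x ∈ S ×ˢ Z, DifferentiableAt ℂ F x ∧ fderiv ℂ F x (1, 0) = g x := by
    intro x hx
    obtain ⟨F', h1, h2⟩ := hasFDerivAt_segmentIntegral (w₀ := w₀) hD
      (fun y hy t ht => ⟨add_mul_sub_mem hS hw₀ hy.1 ht, hy.2⟩) hgd hx
    exact ⟨h1.differentiableAt, by rw [hF, h1.fderiv, h2]⟩
  have hAat : ∀ p ∈ S ×ˢ Z, DifferentiableAt ℂ A p :=
    fun p hp => hA.differentiableAt (hD.mem_nhds hp)
  obtain ⟨K, M, hK0, hK⟩ := exists_bound_along_first_segment hS hw₀ hS' hZ' hS1 hZ1 hgrow hg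
  refine ⟨fun p => F p * Complex.exp (-A p), fun p hp => ?_, ?_, fun p hp => ?_⟩
  · exact ((key p (hsub hp)).1.mul (hAat p (hsub hp)).neg.cexp).differentiableWithinAt
  · refine polyGrowthOn_mul_exp_neg (K := K) (M := M) fun p hp => ?_
    have h := norm_setIntegral_le_of_norm_le_const (μ := volume) (s := Icc (0 : ℝ) 1)
      (f := fun t : ℝ => (p.1 - w₀) * g (w₀ + t * (p.1 - w₀), p.2)) (by simp)
      (fun t ht => hK p.1 hp.1 p.2 hp.2 t ht)
    simpa using h
  · exact fderiv_mul_exp_neg (hAat p (hsub hp)) (key p (hsub hp)).1 (key p (hsub hp)).2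

theorem norm_sub_le_of_segment_bound {f : ℂ → ℂ} {f' : ℂ → ℂ} {a x : ℂ} {B : ℝ}
    (hf : ∀ t ∈ Icc (0 : ℝ) 1, HasDerivAt f (f' (a + t * (x - a))) (a + t * (x - a)))
    (hB : ∀ t ∈ Icc (0 : ℝ) 1, ‖(x - a) * f' (a + t * (x - a))‖ ≤ B) : ‖f x - f a‖ ≤ B := by
  have h : ∀ t ∈ Icc (0 : ℝ) 1, HasDerivWithinAt (fun t : ℝ => f (a + t * (x - a)))
      ((x - a) * f' (a + t * (x - a))) (Icc 0 1) t := by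
    intro t ht
    have h1 : HasDerivAt (fun t : ℝ => a + t * (x - a)) (x - a) t := by
      simpa using ((Complex.ofRealCLM.hasDerivAt (x := t)).mul_const (x - a)).const_add a
    have h2 := (hf t ht).comp t h1
    rw [mul_comm] at h2
    exact h2.hasDerivWithinAt
  have := norm_image_sub_le_of_norm_deriv_le_segment_01' h
    (fun t ht => hB t (Ico_subset_Icc_self ht))
  simpa using this

/-- The system, solved by the primitive of `e^A (r₁ dw + r₂ dz)` vanishing at `(w₀, z₀)`. It is
estimated along the broken line `(w₀, z₀) → (w₀, z) → (w, z)`; on the first leg only the growth of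
`A(w₀, ·)` matters. -/
theorem exists_system_solution_of_growth {C : ℝ} {N : ℕ} (hSo : IsOpen S) (hZo : IsOpen Z)
    (hS : Convex ℝ S) (hZ : Convex ℝ Z) (hw₀ : w₀ ∈ S) (hz₀ : z₀ ∈ Z)
    (hS' : S' ⊆ S) (hZ' : Z' ⊆ Z) (hS1 : ∀ w ∈ S, 1 ≤ ‖w‖) (hZ1 : ∀ z ∈ Z, 1 ≤ ‖z‖)
    (hA : DifferentiableOn ℂ A (S ×ˢ Z))
    (hgrow : ∀ w ∈ S', ∀ z ∈ Z', ∀ t ∈ Icc (0 : ℝ) 1,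
      ‖Complex.exp (A (w₀ + t * (w - w₀), z) - A (w, z))‖ ≤ C * (‖w‖ * ‖z‖) ^ N)
    {C₂ : ℝ} {N₂ : ℕ}
    (hgrow₂ : ∀ z ∈ Z', ∀ t ∈ Icc (0 : ℝ) 1,
      ‖Complex.exp (A (w₀, z₀ + t * (z - z₀)) - A (w₀, z))‖ ≤ C₂ * ‖z‖ ^ N₂)
    {r₁ r₂ : ℂ × ℂ → ℂ} (hr₁ : DifferentiableOn ℂ r₁ (S ×ˢ Z)) (hg₁ : PolyGrowthOn (S ×ˢ Z) r₁)
    (hr₂ : DifferentiableOn ℂ r₂ (S ×ˢ Z)) (hg₂ : PolyGrowthOn (S ×ˢ Z) r₂)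
    (hclosed : ∀ p ∈ S ×ˢ Z, fderiv ℂ r₂ p (1, 0) + fderiv ℂ A p (1, 0) * r₂ p
          = fderiv ℂ r₁ p (0, 1) + fderiv ℂ A p (0, 1) * r₁ p) :
    ∃ u : ℂ × ℂ → ℂ, DifferentiableOn ℂ u (S' ×ˢ Z') ∧ PolyGrowthOn (S' ×ˢ Z') u ∧
      SolvesTwisted (S' ×ˢ Z') A (1, 0) r₁ u ∧ SolvesTwisted (S' ×ˢ Z') A (0, 1) r₂ u := by
  have hD : IsOpen (S ×ˢ Z) := hSo.prod hZo
  have hsub : S' ×ˢ Z' ⊆ S ×ˢ Z := prod_mono hS' hZ'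
  have hAat : ∀ p ∈ S ×ˢ Z, DifferentiableAt ℂ A p :=
    fun p hp => hA.differentiableAt (hD.mem_nhds hp)
  obtain ⟨F₀, hF₀⟩ := (hS.prod hZ).exists_primitive_of_closed hD (hA.cexp.mul hr₁)
    (hA.cexp.mul hr₂) (fun p hp => by
      have h1 := fderiv_exp_mul (v := (0, 1)) (hAat p hp)
        (hr₁.differentiableAt (hD.mem_nhds hp))
      have h2 := fderiv_exp_mul (v := (1, 0)) (hAat p hp)
        (hr₂.differentiableAt (hD.mem_nhds hp))
      exact h1.trans ((congrArg _ (hclosed p hp).symm).trans h2.symm))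
  set g₁ : ℂ × ℂ → ℂ := fun q => Complex.exp (A q) * r₁ q with hg₁def
  set g₂ : ℂ × ℂ → ℂ := fun q => Complex.exp (A q) * r₂ q with hg₂def
  set F : ℂ × ℂ → ℂ := fun p => F₀ p - F₀ (w₀, z₀) with hFdef
  have hF : ∀ x ∈ S ×ˢ Z, HasFDerivAt F
      (g₁ x • ContinuousLinearMap.fst ℂ ℂ ℂ + g₂ x • ContinuousLinearMap.snd ℂ ℂ ℂ) x :=
    fun x hx => (hF₀ x hx).sub_const _
  have hFw : ∀ w ∈ S, ∀ z ∈ Z, HasDerivAt (fun w => F (w, z)) (g₁ (w, z)) w := by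
    intro w hw z hz
    have h := (hF (w, z) ⟨hw, hz⟩).comp_hasDerivAt w
      ((hasDerivAt_id w).prodMk (hasDerivAt_const w z))
    exact h.congr_deriv (by simp)
  have hFz : ∀ w ∈ S, ∀ z ∈ Z, HasDerivAt (fun z => F (w, z)) (g₂ (w, z)) z := by
    intro w hw z hz
    have h := (hF (w, z) ⟨hw, hz⟩).comp_hasDerivAt z
      ((hasDerivAt_const z w).prodMk (hasDerivAt_id z))
    exact h.congr_deriv (by simp)
  obtain ⟨K, M, hK0, hK⟩ := exists_bound_along_first_segment hS hw₀ hS' hZ' hS1 hZ1 hgrow hg₁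
  -- the leg in the second variable is a first leg after exchanging the two variables
  obtain ⟨K₂, M₂, hK₂0, hK₂⟩ := exists_bound_along_first_segment (S := Z) (Z := {w₀})
    (S' := Z') (Z' := {w₀}) (A := fun q => A (q.2, q.1)) (w₀ := z₀) (C := |C₂|) (N := N₂)
    (r := fun q => r₂ (q.2, q.1)) hZ hz₀ hZ'
    le_rfl hZ1 (by simpa using hS1 w₀ hw₀) (by
      rintro z hz _ rfl t ht
      refine (hgrow₂ z hz t ht).trans ?_
      gcongr
      · exact le_abs_self _
      · exact le_mul_of_one_le_right (norm_nonneg _) (hS1 _ hw₀)) (by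
      obtain ⟨C', N', h'⟩ := hg₂
      refine ⟨C', N', fun q hq => ?_⟩
      have := h' (q.2, q.1) ⟨by rw [show q.2 = w₀ from hq.2]; exact hw₀, hq.1⟩
      rwa [mul_comm ‖q.1‖])
  refine ⟨fun p => F p * Complex.exp (-A p), fun p hp => ?_, ?_, fun p hp => ?_, fun p hp => ?_⟩
  · exact ((hF p (hsub hp)).differentiableAt.mul
      (hAat p (hsub hp)).neg.cexp).differentiableWithinAt
  · refine polyGrowthOn_mul_exp_neg (K := K + |C| * (K₂ * ‖w₀‖ ^ M₂)) (M := M + (N + M₂))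
      fun p hp => ?_
    obtain ⟨w, z⟩ := p
    have hwS := hS' hp.1
    have hzZ := hZ' hp.2
    simp only at hwS hzZ ⊢
    have hw1 := hS1 w hwS
    have hz1 := hZ1 z hzZ
    have h1 : ‖F (w, z) - F (w₀, z)‖ ≤ ‖Complex.exp (A (w, z))‖ * (K * (‖w‖ * ‖z‖) ^ M) :=
      norm_sub_le_of_segment_bound (f := fun w => F (w, z)) (f' := fun w => g₁ (w, z))
        (fun t ht => hFw _ (add_mul_sub_mem hS hw₀ hwS ht) z hzZ)
        (fun t ht => hK w hp.1 z hp.2 t ht)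
    have h2 : ‖F (w₀, z) - F (w₀, z₀)‖
        ≤ ‖Complex.exp (A (w₀, z))‖ * (K₂ * (‖z‖ * ‖w₀‖) ^ M₂) :=
      norm_sub_le_of_segment_bound (f := fun z => F (w₀, z)) (f' := fun z => g₂ (w₀, z))
        (fun t ht => hFz w₀ hw₀ _ (add_mul_sub_mem hZ hz₀ hzZ ht))
        (fun t ht => hK₂ z hp.2 w₀ rfl t ht)
    have h3 : F (w₀, z₀) = 0 := sub_self _
    have h4 : ‖Complex.exp (A (w₀, z))‖ ≤ ‖Complex.exp (A (w, z))‖ * (|C| * (‖w‖ * ‖z‖) ^ N) := by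
      have h5 : Complex.exp (A (w₀, z)) =
          Complex.exp (A (w, z)) * Complex.exp (A (w₀, z) - A (w, z)) := by
        rw [← Complex.exp_add]; ring_nf
      rw [h5, norm_mul]
      gcongr
      have := hgrow w hp.1 z hp.2 0 (by simp)
      simp only [Complex.ofReal_zero, zero_mul, add_zero] at this
      exact this.trans (by gcongr; exact le_abs_self C)
    rw [h3, sub_zero] at h2
    have hQ : 1 ≤ ‖w‖ * ‖z‖ := one_le_mul_of_one_le_of_one_le hw1 hz1
    have hzQ : ‖z‖ ≤ ‖w‖ * ‖z‖ := le_mul_of_one_le_left (norm_nonneg _) hw1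
    have h6 : (‖w‖ * ‖z‖) ^ M ≤ (‖w‖ * ‖z‖) ^ (M + (N + M₂)) :=
      pow_le_pow_right₀ hQ (by omega)
    have h7 : (‖w‖ * ‖z‖) ^ (N + M₂) ≤ (‖w‖ * ‖z‖) ^ (M + (N + M₂)) :=
      pow_le_pow_right₀ hQ (by omega)
    calc ‖F (w, z)‖ = ‖(F (w, z) - F (w₀, z)) + F (w₀, z)‖ := by ring_nf
      _ ≤ ‖F (w, z) - F (w₀, z)‖ + ‖F (w₀, z)‖ := norm_add_le _ _
      _ ≤ ‖Complex.exp (A (w, z))‖ * (K * (‖w‖ * ‖z‖) ^ M) +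
          ‖Complex.exp (A (w, z))‖ * (|C| * (‖w‖ * ‖z‖) ^ N) *
            (K₂ * ((‖w‖ * ‖z‖) * ‖w₀‖) ^ M₂) := by
        refine add_le_add h1 (h2.trans ?_)
        gcongr
      _ = ‖Complex.exp (A (w, z))‖ * (K * (‖w‖ * ‖z‖) ^ M +
          |C| * (K₂ * ‖w₀‖ ^ M₂) * (‖w‖ * ‖z‖) ^ (N + M₂)) := by
        rw [mul_pow _ ‖w₀‖, pow_add]; ring
      _ ≤ ‖Complex.exp (A (w, z))‖ * (K * (‖w‖ * ‖z‖) ^ (M + (N + M₂)) +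
          |C| * (K₂ * ‖w₀‖ ^ M₂) * (‖w‖ * ‖z‖) ^ (M + (N + M₂))) := by gcongr
      _ = _ := by ring
  · refine fderiv_mul_exp_neg (hAat p (hsub hp)) (hF p (hsub hp)).differentiableAt ?_
    rw [(hF p (hsub hp)).fderiv]
    simp [hg₁def]
  · refine fderiv_mul_exp_neg (hAat p (hsub hp)) (hF p (hsub hp)).differentiableAt ?_
    rw [(hF p (hsub hp)).fderiv]
    simp [hg₂def]

end Growth

/-! ### Cones and sectors -/

/-- The part `Re w > R` of the sector of slope `ε` around the positive real axis. -/
def cone (R ε : ℝ) : Set ℂ := {w | R < w.re ∧ |w.im| < ε * w.re}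

theorem isOpen_cone (R ε : ℝ) : IsOpen (cone R ε) :=
  (isOpen_lt continuous_const Complex.continuous_re).inter
    (isOpen_lt Complex.continuous_im.abs (continuous_const.mul Complex.continuous_re))

theorem convex_cone (R ε : ℝ) : Convex ℝ (cone R ε) := by
  intro x hx y hy a b ha hb hab
  obtain ⟨hx1, hx2⟩ := hx
  obtain ⟨hy1, hy2⟩ := hy
  rw [abs_lt] at hx2 hy2
  simp only [cone, mem_ofPred_eq, Complex.add_re, Complex.real_smul, Complex.re_ofReal_mul,
    Complex.add_im, Complex.im_ofReal_mul, abs_lt]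
  rcases eq_or_lt_of_le ha with rfl | ha'
  · obtain rfl : b = 1 := by linarith
    simp only [zero_mul, zero_add, one_mul]
    exact ⟨hy1, hy2⟩
  · obtain rfl : b = 1 - a := by linarith
    refine ⟨?_, ?_, ?_⟩ <;> nlinarith

theorem cone_mono {R R' ε ε' : ℝ} (hR' : 0 ≤ R') (hR : R ≤ R') (hε : ε' ≤ ε) :
    cone R' ε' ⊆ cone R ε := fun w ⟨h1, h2⟩ =>
  ⟨by linarith, h2.trans_le (mul_le_mul_of_nonneg_right hε (by linarith))⟩

theorem lt_norm_of_mem_cone {R ε : ℝ} {w : ℂ} (hw : w ∈ cone R ε) : R < ‖w‖ :=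
  hw.1.trans_le (Complex.re_le_norm w)

theorem add_mul_mem_cone {R ε : ℝ} {w τ : ℂ} (hw : w ∈ cone R ε) (hτ : 0 < τ.re)
    (hτ' : |τ.im| < ε * τ.re) {t : ℝ} (ht : 0 ≤ t) : w + t * τ ∈ cone R ε := by
  obtain ⟨h1, h2⟩ := hw
  rw [abs_lt] at h2 hτ'
  simp only [cone, mem_ofPred_eq, Complex.add_re, Complex.re_ofReal_mul, Complex.add_im,
    Complex.im_ofReal_mul, abs_lt]
  refine ⟨?_, ?_, ?_⟩ <;> nlinarith

/-- The domain of the second coordinate: a cone at infinity if it comes from a second component of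
the divisor (`true`), and a disc of radius `1 / R` if it is a parameter (`false`). The disc is
centred at `2`, so that `Re z ≥ 1` in both cases and `log z` is defined and holomorphic. -/
def paramRegion : Bool → ℝ → ℝ → Set ℂ
  | true, R, ε => cone R ε
  | false, R, _ => ball 2 (1 / R)

section ParamRegion

variable {s : Bool} {R R' ε ε' : ℝ} {z : ℂ}

theorem isOpen_paramRegion : IsOpen (paramRegion s R ε) := by
  cases s
  · exact isOpen_ball
  · exact isOpen_cone R ε

theorem convex_paramRegion : Convex ℝ (paramRegion s R ε) := by
  cases s
  · exact convex_ball _ _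
  · exact convex_cone R ε

theorem paramRegion_mono (hR0 : 1 ≤ R) (hR : R ≤ R') (hε : ε' ≤ ε) :
    paramRegion s R' ε' ⊆ paramRegion s R ε := by
  cases s
  · exact ball_subset_ball (one_div_le_one_div_of_le (by linarith) hR)
  · exact cone_mono (by linarith) hR hε

theorem one_le_re_of_mem_paramRegion (hR : 1 ≤ R) (hz : z ∈ paramRegion s R ε) : 1 ≤ z.re := by
  cases s
  · have h1 : ‖z - 2‖ < 1 / R := mem_ball_iff_norm.1 hz
    have h2 : 1 / R ≤ 1 := by
      rw [div_le_one (by linarith)]; exact hR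
    have h3 := Complex.abs_re_le_norm (z - 2)
    have h4 : (z - 2).re = z.re - 2 := by simp
    rw [h4] at h3
    have := (abs_le.1 h3).1
    linarith
  · exact (hR.trans_lt hz.1).le

theorem one_le_norm_of_mem_paramRegion (hR : 1 ≤ R) (hz : z ∈ paramRegion s R ε) : 1 ≤ ‖z‖ :=
  (one_le_re_of_mem_paramRegion hR hz).trans (Complex.re_le_norm z)

theorem pow_mem_sector_of_mem_paramRegion {b : ℕ} (hb : b ≤ 1) (hs : s = false → b = 0)
    (hR : 1 ≤ R) (hε : 0 ≤ ε) (hz : z ∈ paramRegion s R ε) :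
    1 ≤ (z ^ b).re ∧ |(z ^ b).im| ≤ ε * (z ^ b).re := by
  interval_cases b
  · simpa using hε
  · cases s
    · simp at hs
    · simp only [pow_one]
      exact ⟨one_le_re_of_mem_paramRegion hR hz, hz.2.le⟩

end ParamRegion

/-- If `Re c < 0`, the direction `1` decays; if `Re c = 0`, it has to be tilted slightly. -/
theorem exists_direction_re_neg {c : ℂ} (hc : c ≠ 0) (hre : c.re ≤ 0) {ε : ℝ} (hε : 0 < ε) :
    ∃ τ : ℂ, 0 < τ.re ∧ |τ.im| < ε * τ.re ∧ (c * τ).re < 0 := by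
  rcases hre.lt_or_eq with h | h
  · exact ⟨1, by simp, by simpa using hε, by simpa using h⟩
  · have him : c.im ≠ 0 := fun h' => hc (Complex.ext h h')
    rcases lt_or_gt_of_ne him with h' | h'
    · refine ⟨⟨1, -(ε / 2)⟩, by simp, ?_, ?_⟩
      · simp only [abs_neg, mul_one]
        rw [abs_of_pos (by linarith)]; linarith
      · simp only [Complex.mul_re, h]; nlinarith
    · refine ⟨⟨1, ε / 2⟩, by simp, ?_, ?_⟩
      · simp only [mul_one]
        rw [abs_of_pos (by linarith)]; linarith
      · simp only [Complex.mul_re, h]; nlinarith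

/-- Multiplication by an element of a narrow sector keeps a negative real part negative. -/
theorem re_mul_le_of_mem_sector {κ y : ℂ} {ε δ : ℝ} (hδ : 0 ≤ δ) (h1 : 1 ≤ κ.re)
    (h2 : |κ.im| ≤ ε * κ.re) (hy : y.re ≤ -(2 * δ)) (hε : ε * ‖y‖ ≤ δ) : (κ * y).re ≤ -δ := by
  have h3 : -(κ.im * y.im) ≤ κ.re * δ := by
    calc -(κ.im * y.im) ≤ |κ.im * y.im| := neg_le_abs _
      _ = |κ.im| * |y.im| := abs_mul _ _
      _ ≤ (ε * κ.re) * ‖y‖ := by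
        gcongr
        exacts [(abs_nonneg _).trans h2, Complex.abs_im_le_norm y]
      _ = κ.re * (ε * ‖y‖) := by ring
      _ ≤ κ.re * δ := by gcongr
  rw [Complex.mul_re]
  nlinarith

theorem re_mul_nonneg_of_mem_sector {m y : ℂ} {ε δ : ℝ} (h1 : 0 ≤ m.re)
    (h2 : |m.im| ≤ ε * m.re) (hy : δ ≤ y.re) (hε : ε * ‖y‖ ≤ δ) : 0 ≤ (m * y).re := by
  have h3 : m.im * y.im ≤ m.re * δ := by
    calc m.im * y.im ≤ |m.im * y.im| := le_abs_self _
      _ = |m.im| * |y.im| := abs_mul _ _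
      _ ≤ (ε * m.re) * ‖y‖ := by
        gcongr
        exacts [(abs_nonneg _).trans h2, Complex.abs_im_le_norm y]
      _ = m.re * (ε * ‖y‖) := by ring
      _ ≤ m.re * δ := by gcongr
  rw [Complex.mul_re]
  nlinarith

theorem mul_mem_sector {κ h : ℂ} {ε : ℝ} (hε0 : 0 ≤ ε) (hε : ε ≤ 1 / 2) (h1 : 0 ≤ κ.re)
    (h2 : |κ.im| ≤ ε * κ.re) (h3 : 0 ≤ h.re) (h4 : |h.im| ≤ 2 * ε * h.re) :
    0 ≤ (κ * h).re ∧ |(κ * h).im| ≤ 6 * ε * (κ * h).re := by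
  have h5 : |κ.im * h.im| ≤ (ε * κ.re) * (2 * ε * h.re) := by
    rw [abs_mul]; gcongr
  have h6 : |κ.re * h.im| ≤ κ.re * (2 * ε * h.re) := by
    rw [abs_mul, abs_of_nonneg h1]; gcongr
  have h7 : |κ.im * h.re| ≤ (ε * κ.re) * h.re := by
    rw [abs_mul, abs_of_nonneg h3]; gcongr
  have hp : 0 ≤ κ.re * h.re := mul_nonneg h1 h3
  have hre : κ.re * h.re / 2 ≤ (κ * h).re := by
    rw [Complex.mul_re]
    have := (abs_le.1 h5).2
    nlinarith [mul_nonneg hε0 hp]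
  refine ⟨by linarith, ?_⟩
  rw [Complex.mul_im]
  refine (abs_add_le _ _).trans ?_
  nlinarith

/-- Powers of `w` change at most polynomially between two points of norm at least `1`. -/
theorem norm_exp_mul_log_sub_le (μ : ℂ) {w w' : ℂ} (hw : 1 ≤ ‖w‖) (hw' : 1 ≤ ‖w'‖) :
    ‖Complex.exp (μ * (Complex.log w' - Complex.log w))‖
      ≤ Real.exp (‖μ‖ * (2 * Real.pi)) * (‖w‖ * ‖w'‖) ^ ⌈‖μ‖⌉₊ := by
  have hlog : ∀ v : ℂ, 1 ≤ ‖v‖ → ‖Complex.log v‖ ≤ Real.log ‖v‖ + Real.pi := by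
    intro v hv
    refine (Complex.norm_le_abs_re_add_abs_im _).trans ?_
    rw [Complex.log_re, Complex.log_im, abs_of_nonneg (Real.log_nonneg hv)]
    gcongr
    exact Complex.abs_arg_le_pi v
  have hX : 1 ≤ ‖w‖ * ‖w'‖ := one_le_mul_of_one_le_of_one_le hw hw'
  rw [Complex.norm_exp]
  have h1 : (μ * (Complex.log w' - Complex.log w)).re
      ≤ ‖μ‖ * (2 * Real.pi) + ⌈‖μ‖⌉₊ * Real.log (‖w‖ * ‖w'‖) := by
    refine (Complex.re_le_norm _).trans ?_
    rw [norm_mul]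
    have h2 : ‖Complex.log w' - Complex.log w‖ ≤ 2 * Real.pi + Real.log (‖w‖ * ‖w'‖) := by
      refine (norm_sub_le _ _).trans ?_
      rw [Real.log_mul (by linarith) (by linarith)]
      linarith [hlog w hw, hlog w' hw']
    calc ‖μ‖ * ‖Complex.log w' - Complex.log w‖
        ≤ ‖μ‖ * (2 * Real.pi + Real.log (‖w‖ * ‖w'‖)) := by gcongr
      _ = ‖μ‖ * (2 * Real.pi) + ‖μ‖ * Real.log (‖w‖ * ‖w'‖) := by ring
      _ ≤ _ := by
        gcongr
        · exact Real.log_nonneg hX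
        · exact Nat.le_ceil _
  refine (Real.exp_le_exp.2 h1).trans (le_of_eq ?_)
  rw [Real.exp_add, Real.exp_nat_mul, Real.exp_log (by linarith)]

theorem norm_exp_mul_log_sub_le_of_norm_le (μ : ℂ) {w w' : ℂ} {L : ℝ} (hw : 1 ≤ ‖w‖)
    (hw' : 1 ≤ ‖w'‖) (hL : ‖w'‖ ≤ L * ‖w‖) :
    ‖Complex.exp (μ * (Complex.log w' - Complex.log w))‖
      ≤ Real.exp (‖μ‖ * (2 * Real.pi)) * L ^ ⌈‖μ‖⌉₊ * ‖w‖ ^ (2 * ⌈‖μ‖⌉₊) := by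
  refine (norm_exp_mul_log_sub_le μ hw hw').trans ?_
  rw [mul_assoc, pow_mul, ← mul_pow]
  refine mul_le_mul_of_nonneg_left (pow_le_pow_left₀ (by positivity) ?_ _) (Real.exp_nonneg _)
  nlinarith [norm_nonneg w]

theorem re_sub_le_neg_mul {f f' : ℝ → ℂ} {δ : ℝ} (hf : ∀ t, 0 ≤ t → HasDerivAt f (f' t) t)
    (h : ∀ t, 0 ≤ t → (f' t).re ≤ -δ) {t : ℝ} (ht : 0 ≤ t) : (f t - f 0).re ≤ -δ * t := by
  have hre : ∀ t, 0 ≤ t → HasDerivAt (fun t => (f t).re) (f' t).re t := fun t ht =>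
    (Complex.reCLM.hasFDerivAt (x := f t)).comp_hasDerivAt t (hf t ht)
  have := (convex_Ici (0 : ℝ)).image_sub_le_mul_sub_of_deriv_le (f := fun t => (f t).re)
    (C := -δ) (fun x hx => (hre x hx).continuousAt.continuousWithinAt)
    (fun x hx => (hre x (interior_subset hx)).differentiableAt.differentiableWithinAt)
    (fun x hx => by rw [(hre x (interior_subset hx)).deriv]; exact h x (interior_subset hx))
    0 self_mem_Ici t ht ht
  simpa using this

theorem re_le_of_re_deriv_nonneg {f : ℂ → ℂ} {f' : ℂ → ℂ} {a x : ℂ}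
    (hf : ∀ t ∈ Icc (0 : ℝ) 1, HasDerivAt f (f' (a + t * (x - a))) (a + t * (x - a)))
    (h : ∀ t ∈ Icc (0 : ℝ) 1, 0 ≤ ((x - a) * f' (a + t * (x - a))).re)
    {t : ℝ} (ht : t ∈ Icc (0 : ℝ) 1) : (f (a + t * (x - a))).re ≤ (f x).re := by
  have hd : ∀ t ∈ Icc (0 : ℝ) 1, HasDerivAt (fun t : ℝ => (f (a + t * (x - a))).re)
      ((x - a) * f' (a + t * (x - a))).re t := by
    intro t ht
    have h1 : HasDerivAt (fun t : ℝ => a + t * (x - a)) (x - a) t := by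
      simpa using ((Complex.ofRealCLM.hasDerivAt (x := t)).mul_const (x - a)).const_add a
    have h2 := (hf t ht).comp t h1
    rw [mul_comm] at h2
    exact (Complex.reCLM.hasFDerivAt).comp_hasDerivAt t h2
  have := monotoneOn_of_deriv_nonneg (convex_Icc (0 : ℝ) 1)
    (f := fun t : ℝ => (f (a + t * (x - a))).re)
    (fun x hx => (hd x hx).continuousAt.continuousWithinAt)
    (fun x hx => (hd x (interior_subset hx)).differentiableAt.differentiableWithinAt)
    (fun x hx => by rw [(hd x (interior_subset hx)).deriv]; exact h x (interior_subset hx))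
    ht (right_mem_Icc.2 zero_le_one) ht.2
  simpa using this

section Core

variable {s : Bool} {a b : ℕ} {c V₀ μ₁ μ₂ : ℂ} {V : ℂ × ℂ → ℂ} {R₀ ε₀ : ℝ}

/-! ### Solvability for an asymptotically constant unit -/

/-- The polar part `c V w^a z^b` of the exponent; `a` and `b` are `0` or `1`. -/
noncomputable def principalPart (c : ℂ) (a b : ℕ) (V : ℂ × ℂ → ℂ) (p : ℂ × ℂ) : ℂ :=
  c * V p * p.1 ^ a * p.2 ^ b

/-- The exponent `c V w^a z^b + μ₁ log w + μ₂ log z`; the logarithms account for the constant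
terms of the two equations. -/
noncomputable def twistExponent (c : ℂ) (a b : ℕ) (V : ℂ × ℂ → ℂ) (μ₁ μ₂ : ℂ) (p : ℂ × ℂ) : ℂ :=
  principalPart c a b V p + μ₁ * Complex.log p.1 + μ₂ * Complex.log p.2

/-- `V` is holomorphic, tends to `V₀` at infinity, and its Euler derivatives tend to `0`. The
limits are uniform on the whole aperture `ε₀`: the direction of the rays for integration from
infinity is chosen in the cone before `R` is, and a narrower cone might not be stable under it.
The second Euler derivative matters only for `b = 1`. -/
structure IsAsymptoticUnit (s : Bool) (b : ℕ) (V : ℂ × ℂ → ℂ) (V₀ : ℂ) (R₀ ε₀ : ℝ) : Prop where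
  diff : DifferentiableOn ℂ V (cone R₀ ε₀ ×ˢ paramRegion s R₀ ε₀)
  lim : ∀ η > 0, ∃ R ≥ R₀, ∀ p ∈ cone R ε₀ ×ˢ paramRegion s R ε₀,
    ‖V p - V₀‖ ≤ η ∧ ‖p.1 * fderiv ℂ V p (1, 0)‖ ≤ η ∧
      (b = 1 → ‖p.2 * fderiv ℂ V p (0, 1)‖ ≤ η)

theorem isOpen_cone_prod (R ε : ℝ) : IsOpen (cone R ε ×ˢ paramRegion s R ε) :=
  (isOpen_cone R ε).prod isOpen_paramRegion

theorem cone_prod_mono {R R' ε ε' : ℝ} (hR0 : 1 ≤ R) (hR : R ≤ R') (hε : ε' ≤ ε) :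
    cone R' ε' ×ˢ paramRegion s R' ε' ⊆ cone R ε ×ˢ paramRegion s R ε :=
  prod_mono (cone_mono (by linarith) hR hε) (paramRegion_mono hR0 hR hε)

theorem differentiableOn_twistExponent (hR₀ : 1 ≤ R₀)
    (hV : DifferentiableOn ℂ V (cone R₀ ε₀ ×ˢ paramRegion s R₀ ε₀)) :
    DifferentiableOn ℂ (twistExponent c a b V μ₁ μ₂) (cone R₀ ε₀ ×ˢ paramRegion s R₀ ε₀) := by
  have h1 : DifferentiableOn ℂ (fun p : ℂ × ℂ => Complex.log p.1)
      (cone R₀ ε₀ ×ˢ paramRegion s R₀ ε₀) :=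
    differentiableOn_fst.clog fun p hp => Or.inl (by linarith [hp.1.1])
  have h2 : DifferentiableOn ℂ (fun p : ℂ × ℂ => Complex.log p.2)
      (cone R₀ ε₀ ×ˢ paramRegion s R₀ ε₀) :=
    differentiableOn_snd.clog fun p hp => Or.inl (by
      linarith [one_le_re_of_mem_paramRegion hR₀ hp.2])
  unfold twistExponent principalPart
  exact ((((hV.const_mul c).mul (differentiableOn_fst.pow a)).mul
    (differentiableOn_snd.pow b)).add (h1.const_mul μ₁)).add (h2.const_mul μ₂)

/-- For `a = 1` the derivative in `w` is `c z^b (1 + w ∂_w) V`, which is close to `c V₀ z^b`. -/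
theorem hasDerivAt_principalPart_fst {w z : ℂ} (hV : DifferentiableAt ℂ V (w, z)) :
    HasDerivAt (fun w => principalPart c 1 b V (w, z))
      (z ^ b * (c * (V (w, z) + w * fderiv ℂ V (w, z) (1, 0)))) w := by
  have h1 : HasDerivAt (fun w => V (w, z)) (fderiv ℂ V (w, z) (1, 0)) w :=
    hV.hasFDerivAt.comp_hasDerivAt w ((hasDerivAt_id w).prodMk (hasDerivAt_const w z))
  have h2 := (((h1.const_mul c).mul ((hasDerivAt_id w).pow 1)).mul_const (z ^ b))
  refine h2.congr_deriv ?_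
  simp
  ring

theorem hasDerivAt_principalPart_snd {w z : ℂ} (hV : DifferentiableAt ℂ V (w, z)) :
    HasDerivAt (fun z => principalPart c a 1 V (w, z))
      (w ^ a * (c * (V (w, z) + z * fderiv ℂ V (w, z) (0, 1)))) z := by
  have h1 : HasDerivAt (fun z => V (w, z)) (fderiv ℂ V (w, z) (0, 1)) z :=
    hV.hasFDerivAt.comp_hasDerivAt z ((hasDerivAt_const z w).prodMk (hasDerivAt_id z))
  have h2 := ((h1.const_mul c).mul_const (w ^ a)).mul ((hasDerivAt_id z).pow 1)
  refine h2.congr_deriv ?_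
  simp
  ring

theorem norm_mul_add_sub_le {η : ℝ} {v d : ℂ} (h1 : ‖v - V₀‖ ≤ η) (h2 : ‖d‖ ≤ η) :
    ‖c * (v + d) - c * V₀‖ ≤ ‖c‖ * (2 * η) := by
  rw [← mul_sub, norm_mul]
  gcongr
  calc ‖v + d - V₀‖ = ‖(v - V₀) + d‖ := by ring_nf
    _ ≤ ‖v - V₀‖ + ‖d‖ := norm_add_le _ _
    _ ≤ 2 * η := by linarith

theorem norm_exp_twist_sub (p q : ℂ × ℂ) :
    ‖Complex.exp (twistExponent c a b V μ₁ μ₂ q - twistExponent c a b V μ₁ μ₂ p)‖ =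
      Real.exp (principalPart c a b V q - principalPart c a b V p).re *
      ‖Complex.exp (μ₁ * (Complex.log q.1 - Complex.log p.1))‖ *
      ‖Complex.exp (μ₂ * (Complex.log q.2 - Complex.log p.2))‖ := by
  rw [← Complex.norm_exp, ← norm_mul, ← norm_mul, ← Complex.exp_add, ← Complex.exp_add]
  unfold twistExponent
  ring_nf

/-- On a smaller region of the same kind, the equation in `w` with exponent `A` has a solution of
polynomial growth, and so does the system for every compatible `r₂`. The smaller region may depend
on `r₁`, but not on `r₂`. -/
def HasTwistedSolutions (s : Bool) (R₀ ε₀ : ℝ) (A : ℂ × ℂ → ℂ) : Prop :=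
  ∀ r₁ : ℂ × ℂ → ℂ, DifferentiableOn ℂ r₁ (cone R₀ ε₀ ×ˢ paramRegion s R₀ ε₀) →
    PolyGrowthOn (cone R₀ ε₀ ×ˢ paramRegion s R₀ ε₀) r₁ →
    ∃ R ≥ R₀, ∃ ε > 0, ε ≤ ε₀ ∧
      (∃ u : ℂ × ℂ → ℂ, DifferentiableOn ℂ u (cone R ε ×ˢ paramRegion s R ε) ∧
        PolyGrowthOn (cone R ε ×ˢ paramRegion s R ε) u ∧
        SolvesTwisted (cone R ε ×ˢ paramRegion s R ε) A (1, 0) r₁ u) ∧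
      ∀ r₂ : ℂ × ℂ → ℂ, DifferentiableOn ℂ r₂ (cone R₀ ε₀ ×ˢ paramRegion s R₀ ε₀) →
        PolyGrowthOn (cone R₀ ε₀ ×ˢ paramRegion s R₀ ε₀) r₂ →
        (∀ p ∈ cone R₀ ε₀ ×ˢ paramRegion s R₀ ε₀,
          fderiv ℂ r₂ p (1, 0) + fderiv ℂ A p (1, 0) * r₂ p
            = fderiv ℂ r₁ p (0, 1) + fderiv ℂ A p (0, 1) * r₁ p) →
        ∃ u : ℂ × ℂ → ℂ, DifferentiableOn ℂ u (cone R ε ×ˢ paramRegion s R ε) ∧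
          PolyGrowthOn (cone R ε ×ˢ paramRegion s R ε) u ∧
          SolvesTwisted (cone R ε ×ˢ paramRegion s R ε) A (1, 0) r₁ u ∧
          SolvesTwisted (cone R ε ×ˢ paramRegion s R ε) A (0, 1) r₂ u

theorem PolyGrowthOn.mono {D D' : Set (ℂ × ℂ)} {f : ℂ × ℂ → ℂ} (h : PolyGrowthOn D f)
    (hD : D' ⊆ D) : PolyGrowthOn D' f := by
  obtain ⟨C, N, hCN⟩ := h
  exact ⟨C, N, fun p hp => hCN p (hD hp)⟩

/-- The case of decay: integration from infinity along a direction `τ` with `Re (c V₀ τ) < 0`. -/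
theorem hasTwistedSolutions_of_re_nonpos (hR₀ : 1 ≤ R₀) (hε₀ : 0 < ε₀) (hb : b ≤ 1)
    (hs : s = false → b = 0) (hV : IsAsymptoticUnit s b V V₀ R₀ ε₀) (hc : c * V₀ ≠ 0)
    (hre : (c * V₀).re ≤ 0) :
    HasTwistedSolutions s R₀ ε₀ (twistExponent c 1 b V μ₁ μ₂) := by
  intro r₁ hr₁ hg₁
  obtain ⟨τ, hτ1, hτ2, hτ3⟩ := exists_direction_re_neg hc hre hε₀
  obtain ⟨δ, hδ, hδτ⟩ : ∃ δ > 0, (c * V₀ * τ).re = -(4 * δ) :=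
    ⟨-(c * V₀ * τ).re / 4, by linarith, by ring⟩
  have hcτ : 0 ≤ ‖c‖ * ‖τ‖ := by positivity
  obtain ⟨R, hR, hRlim⟩ := hV.lim (δ / (‖c‖ * ‖τ‖ + 1)) (by positivity)
  have hη : ‖c‖ * (2 * (δ / (‖c‖ * ‖τ‖ + 1))) * ‖τ‖ ≤ 2 * δ := by
    have : ‖c‖ * (2 * (δ / (‖c‖ * ‖τ‖ + 1))) * ‖τ‖
        = 2 * δ * ((‖c‖ * ‖τ‖) / (‖c‖ * ‖τ‖ + 1)) := by ring
    rw [this]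
    have h1 : (‖c‖ * ‖τ‖) / (‖c‖ * ‖τ‖ + 1) ≤ 1 := by
      rw [div_le_one (by positivity)]; linarith
    nlinarith
  set η := δ / (‖c‖ * ‖τ‖ + 1) with hηdef
  set B := ‖c * V₀ * τ‖ + 2 * δ with hB
  have hBpos : 0 < B := by positivity
  set ε := min ε₀ (δ / B) with hε
  have hεpos : 0 < ε := lt_min hε₀ (by positivity)
  have hεle : ε ≤ ε₀ := min_le_left _ _
  have hR1 : 1 ≤ R := hR₀.trans hR
  -- the first factor keeps the full aperture, so that it stays stable under the flow of `τ`
  set D : Set (ℂ × ℂ) := cone R ε₀ ×ˢ paramRegion s R ε with hD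
  have hDo : IsOpen D := (isOpen_cone _ _).prod isOpen_paramRegion
  have hDsub : D ⊆ cone R ε₀ ×ˢ paramRegion s R ε₀ :=
    prod_mono subset_rfl (paramRegion_mono hR1 le_rfl hεle)
  have hDsub₀ : D ⊆ cone R₀ ε₀ ×ˢ paramRegion s R₀ ε₀ :=
    hDsub.trans (cone_prod_mono hR₀ hR le_rfl)
  have hDsub' : cone R ε ×ˢ paramRegion s R ε ⊆ D :=
    prod_mono (cone_mono (by linarith) le_rfl hεle) subset_rfl
  have hray : ∀ p ∈ D, ∀ t : ℝ, 0 ≤ t → p + (t : ℂ) • (τ, (0 : ℂ)) ∈ D := by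
    intro p hp t ht
    refine ⟨?_, ?_⟩
    · simpa using add_mul_mem_cone hp.1 hτ1 hτ2 ht
    · simpa using hp.2
  have hD1 : ∀ p ∈ D, 1 ≤ ‖p.1‖ ∧ 1 ≤ ‖p.2‖ := fun p hp =>
    ⟨hR1.trans (lt_norm_of_mem_cone hp.1).le, one_le_norm_of_mem_paramRegion hR1 hp.2⟩
  have hre' : ∀ p ∈ D, ∀ t : ℝ, 0 ≤ t →
      (principalPart c 1 b V (p + (t : ℂ) • (τ, (0 : ℂ))) - principalPart c 1 b V p).re
        ≤ -δ * t := by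
    rintro ⟨w, z⟩ hp t ht
    have hder : ∀ t : ℝ, 0 ≤ t → HasDerivAt (fun t : ℝ => principalPart c 1 b V (w + t * τ, z))
        (z ^ b * (c * (V (w + t * τ, z) + (w + t * τ) * fderiv ℂ V (w + t * τ, z) (1, 0)) * τ))
        t := by
      intro t ht
      have hmem : (w + t * τ, z) ∈ D := by simpa using hray (w, z) hp t ht
      have h1 : HasDerivAt (fun t : ℝ => w + t * τ) τ t := by
        simpa using ((Complex.ofRealCLM.hasDerivAt (x := t)).mul_const τ).const_add w
      have h2 := (hasDerivAt_principalPart_fst (c := c) (b := b) (hV.diff.differentiableAt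
        ((isOpen_cone_prod R₀ ε₀).mem_nhds (hDsub₀ hmem)))).comp t h1
      exact h2.congr_deriv (by ring)
    have hder' : ∀ t : ℝ, 0 ≤ t → (z ^ b * (c * (V (w + t * τ, z) +
        (w + t * τ) * fderiv ℂ V (w + t * τ, z) (1, 0)) * τ)).re ≤ -δ := by
      intro t ht
      have hmem : (w + t * τ, z) ∈ D := by simpa using hray (w, z) hp t ht
      obtain ⟨h1, h2, -⟩ := hRlim _ (hDsub hmem)
      have h3 := norm_mul_add_sub_le (c := c) h1 h2
      set Q := c * (V (w + t * τ, z) + (w + t * τ) * fderiv ℂ V (w + t * τ, z) (1, 0)) with hQ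
      have h4 : ‖Q * τ - c * V₀ * τ‖ ≤ 2 * δ := by
        rw [← sub_mul, norm_mul]
        exact (mul_le_mul_of_nonneg_right h3 (norm_nonneg _)).trans hη
      have h5 : (Q * τ).re ≤ -(2 * δ) := by
        have := (Complex.re_le_norm _).trans h4
        rw [Complex.sub_re, hδτ] at this
        linarith
      have h6 : ‖Q * τ‖ ≤ B := by
        have := norm_add_le (Q * τ - c * V₀ * τ) (c * V₀ * τ)
        rw [sub_add_cancel] at this
        linarith
      obtain ⟨hκ1, hκ2⟩ := pow_mem_sector_of_mem_paramRegion hb hs hR1 hεpos.le hmem.2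
      refine re_mul_le_of_mem_sector hδ.le hκ1 hκ2 h5 ?_
      calc ε * ‖Q * τ‖ ≤ (δ / B) * B := by
            gcongr
            exact min_le_right _ _
        _ = δ := by field_simp
    have := re_sub_le_neg_mul hder hder' ht
    simpa using this
  obtain ⟨u, hu1, hu2, hu3, hu4⟩ := exists_solution_of_decay (A := twistExponent c 1 b V μ₁ μ₂)
    (C := Real.exp (‖μ₁‖ * (2 * Real.pi)) * (1 + ‖τ‖) ^ ⌈‖μ₁‖⌉₊) (N := 2 * ⌈‖μ₁‖⌉₊)
    hDo hD1 hδ hray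
    ((differentiableOn_twistExponent hR₀ hV.diff).mono hDsub₀) (by
      intro p hp t ht
      obtain ⟨hp1, hp2⟩ := hD1 p hp
      have hq := hD1 _ (hray p hp t ht)
      set q := p + (t : ℂ) • (τ, (0 : ℂ)) with hqdef
      have hq1 : q.1 = p.1 + t * τ := by simp [hqdef]
      have hq2 : q.2 = p.2 := by simp [hqdef]
      have hL : ‖q.1‖ ≤ ((1 + ‖τ‖) * (1 + t)) * ‖p.1‖ := by
        have h1 : ‖q.1‖ ≤ ‖p.1‖ + t * ‖τ‖ := by
          rw [hq1]
          refine (norm_add_le _ _).trans ?_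
          rw [norm_mul, Complex.norm_real, Real.norm_of_nonneg ht]
        nlinarith [mul_nonneg ht (norm_nonneg τ),
          mul_nonneg (sub_nonneg.2 hp1) (mul_nonneg ht (norm_nonneg τ)),
          mul_nonneg (norm_nonneg p.1) (norm_nonneg τ), mul_nonneg (norm_nonneg p.1) ht]
      rw [norm_exp_twist_sub, hq2, sub_self, mul_zero, Complex.exp_zero, norm_one, mul_one]
      have h1 := norm_exp_mul_log_sub_le_of_norm_le μ₁ hp1 hq.1 hL
      have h2 : ((1 + ‖τ‖) * (1 + t)) ^ ⌈‖μ₁‖⌉₊ * ‖p.1‖ ^ (2 * ⌈‖μ₁‖⌉₊)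
          ≤ (1 + ‖τ‖) ^ ⌈‖μ₁‖⌉₊ * (‖p.1‖ * ‖p.2‖ * (1 + t)) ^ (2 * ⌈‖μ₁‖⌉₊) := by
        rw [mul_pow, mul_assoc]
        refine mul_le_mul_of_nonneg_left ?_ (by positivity)
        rw [mul_pow, mul_comm]
        refine mul_le_mul ?_ ?_ (by positivity) (by positivity)
        · exact pow_le_pow_left₀ (norm_nonneg _)
            (le_mul_of_one_le_right (norm_nonneg _) hp2) _
        · exact pow_le_pow_right₀ (by linarith) (by omega)
      calc _ ≤ Real.exp (-δ * t) * (Real.exp (‖μ₁‖ * (2 * Real.pi)) *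
            ((1 + ‖τ‖) * (1 + t)) ^ ⌈‖μ₁‖⌉₊ * ‖p.1‖ ^ (2 * ⌈‖μ₁‖⌉₊)) :=
            mul_le_mul (Real.exp_le_exp.2 (hre' p hp t ht)) h1 (norm_nonneg _)
              (Real.exp_nonneg _)
        _ = Real.exp (-δ * t) * Real.exp (‖μ₁‖ * (2 * Real.pi)) *
            (((1 + ‖τ‖) * (1 + t)) ^ ⌈‖μ₁‖⌉₊ * ‖p.1‖ ^ (2 * ⌈‖μ₁‖⌉₊)) := by ring
        _ ≤ Real.exp (-δ * t) * Real.exp (‖μ₁‖ * (2 * Real.pi)) *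
            ((1 + ‖τ‖) ^ ⌈‖μ₁‖⌉₊ * (‖p.1‖ * ‖p.2‖ * (1 + t)) ^ (2 * ⌈‖μ₁‖⌉₊)) := by gcongr
        _ = _ := by ring)
    (hr₁.mono hDsub₀) (hg₁.mono hDsub₀)
  refine ⟨R, hR, ε, hεpos, hεle, ⟨u, hu1.mono hDsub', hu2.mono hDsub',
    fun p hp => hu3 p (hDsub' hp)⟩, fun r₂ hr₂ hg₂ hcl => ⟨u, hu1.mono hDsub', hu2.mono hDsub',
    fun p hp => hu3 p (hDsub' hp), fun p hp => ?_⟩⟩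
  exact hu4 r₂ (hr₂.mono hDsub₀) (hg₂.mono hDsub₀) (fun p hp => hcl p (hDsub₀ hp)) p (hDsub' hp)

end Core

section CoreGrowth

variable {s : Bool} {a b : ℕ} {c V₀ μ₁ μ₂ : ℂ} {V : ℂ × ℂ → ℂ} {R₀ ε₀ : ℝ}

/-- The case of growth: `Re (c V w^a z^b)` is, up to an additive constant, largest at the endpoint
of each of the two legs. -/
theorem hasTwistedSolutions_of_re_le {R R' ε M : ℝ} {w₀ z₀ : ℂ} (hR₀ : 1 ≤ R₀) (hR : R₀ ≤ R)
    (hR' : R ≤ R') (hε : 0 < ε) (hε₀ : ε ≤ ε₀)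
    (hV : DifferentiableOn ℂ V (cone R₀ ε₀ ×ˢ paramRegion s R₀ ε₀))
    (hw₀ : w₀ ∈ cone R ε) (hz₀ : z₀ ∈ paramRegion s R ε)
    (h₁ : ∀ w ∈ cone R' ε, ∀ z ∈ paramRegion s R' ε, ∀ t ∈ Icc (0 : ℝ) 1,
      (principalPart c a b V (w₀ + t * (w - w₀), z)).re ≤ (principalPart c a b V (w, z)).re + M)
    (h₂ : ∀ z ∈ paramRegion s R' ε, ∀ t ∈ Icc (0 : ℝ) 1,
      (principalPart c a b V (w₀, z₀ + t * (z - z₀))).re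
        ≤ (principalPart c a b V (w₀, z)).re + M) :
    HasTwistedSolutions s R₀ ε₀ (twistExponent c a b V μ₁ μ₂) := by
  intro r₁ hr₁ hg₁
  have hR1 : 1 ≤ R := hR₀.trans hR
  have hsub : cone R ε ×ˢ paramRegion s R ε ⊆ cone R₀ ε₀ ×ˢ paramRegion s R₀ ε₀ :=
    cone_prod_mono hR₀ hR hε₀
  have hS' : cone R' ε ⊆ cone R ε := cone_mono (by linarith) hR' le_rfl
  have hZ' : paramRegion s R' ε ⊆ paramRegion s R ε := paramRegion_mono hR1 hR' le_rfl
  have hS1 : ∀ w ∈ cone R ε, 1 ≤ ‖w‖ := fun w hw => hR1.trans (lt_norm_of_mem_cone hw).le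
  have hZ1 : ∀ z ∈ paramRegion s R ε, 1 ≤ ‖z‖ := fun z hz => one_le_norm_of_mem_paramRegion hR1 hz
  have hA := (differentiableOn_twistExponent (c := c) (a := a) (b := b) (μ₁ := μ₁) (μ₂ := μ₂)
    hR₀ hV).mono hsub
  have hgrow : ∀ w ∈ cone R' ε, ∀ z ∈ paramRegion s R' ε, ∀ t ∈ Icc (0 : ℝ) 1,
      ‖Complex.exp (twistExponent c a b V μ₁ μ₂ (w₀ + t * (w - w₀), z) -
        twistExponent c a b V μ₁ μ₂ (w, z))‖ ≤
      (Real.exp M * (Real.exp (‖μ₁‖ * (2 * Real.pi)) * (1 + ‖w₀‖) ^ ⌈‖μ₁‖⌉₊)) *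
        (‖w‖ * ‖z‖) ^ (2 * ⌈‖μ₁‖⌉₊) := by
    intro w hw z hz t ht
    have hmem := add_mul_sub_mem (convex_cone R ε) hw₀ (hS' hw) ht
    rw [norm_exp_twist_sub, sub_self, mul_zero, Complex.exp_zero, norm_one, mul_one, mul_assoc]
    refine mul_le_mul (Real.exp_le_exp.2 ?_) ?_ (norm_nonneg _) (Real.exp_nonneg _)
    · rw [Complex.sub_re]; linarith [h₁ w hw z hz t ht]
    · refine (norm_exp_mul_log_sub_le_of_norm_le μ₁ (hS1 w (hS' hw)) (hS1 _ hmem)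
        (norm_add_mul_sub_le (hS1 w (hS' hw)) ht)).trans ?_
      refine mul_le_mul_of_nonneg_left (pow_le_pow_left₀ (norm_nonneg _)
        (le_mul_of_one_le_right (norm_nonneg _) (hZ1 z (hZ' hz))) _) (by positivity)
  have hgrow₂ : ∀ z ∈ paramRegion s R' ε, ∀ t ∈ Icc (0 : ℝ) 1,
      ‖Complex.exp (twistExponent c a b V μ₁ μ₂ (w₀, z₀ + t * (z - z₀)) -
        twistExponent c a b V μ₁ μ₂ (w₀, z))‖ ≤
      (Real.exp M * (Real.exp (‖μ₂‖ * (2 * Real.pi)) * (1 + ‖z₀‖) ^ ⌈‖μ₂‖⌉₊)) *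
        ‖z‖ ^ (2 * ⌈‖μ₂‖⌉₊) := by
    intro z hz t ht
    have hmem := add_mul_sub_mem convex_paramRegion hz₀ (hZ' hz) ht
    rw [norm_exp_twist_sub, sub_self, mul_zero, Complex.exp_zero, norm_one, mul_one, mul_assoc]
    refine mul_le_mul (Real.exp_le_exp.2 ?_) ?_ (norm_nonneg _) (Real.exp_nonneg _)
    · rw [Complex.sub_re]; linarith [h₂ z hz t ht]
    · exact norm_exp_mul_log_sub_le_of_norm_le μ₂ (hZ1 z (hZ' hz)) (hZ1 _ hmem)
        (norm_add_mul_sub_le (hZ1 z (hZ' hz)) ht)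
  refine ⟨R', hR.trans hR', ε, hε, hε₀, ?_, fun r₂ hr₂ hg₂ hcl => ?_⟩
  · exact exists_solution_of_growth (isOpen_cone _ _) isOpen_paramRegion (convex_cone _ _) hw₀
      hS' hZ' hS1 hZ1 hA hgrow (hr₁.mono hsub) (hg₁.mono hsub)
  · exact exists_system_solution_of_growth (isOpen_cone _ _) isOpen_paramRegion (convex_cone _ _)
      convex_paramRegion hw₀ hz₀ hS' hZ' hS1 hZ1 hA hgrow hgrow₂ (hr₁.mono hsub) (hg₁.mono hsub)
      (hr₂.mono hsub) (hg₂.mono hsub) fun p hp => hcl p (hsub hp)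

/-- The base point of the second coordinate for integration from a point. -/
def basePoint (s : Bool) (R : ℝ) : ℂ := if s then ((2 * R : ℝ) : ℂ) else 2

theorem two_mul_mem_cone {R ε : ℝ} (hR : 1 ≤ R) (hε : 0 < ε) : ((2 * R : ℝ) : ℂ) ∈ cone R ε := by
  refine ⟨?_, ?_⟩
  · rw [Complex.ofReal_re]; linarith
  · rw [Complex.ofReal_re, Complex.ofReal_im, abs_zero]; positivity

theorem basePoint_mem {R ε : ℝ} (hR : 1 ≤ R) (hε : 0 < ε) :
    basePoint s R ∈ paramRegion s R ε := by
  cases s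
  · exact mem_ball_self (by positivity)
  · exact two_mul_mem_cone hR hε

/-- Far out in the cone, the vector from the base point `2 R` to `w` still lies in a sector. -/
theorem sub_two_mul_mem_sector {R ε : ℝ} (hR : 1 ≤ R) (hε : 0 < ε) {w : ℂ}
    (hw : w ∈ cone (4 * R) ε) : 0 ≤ (w - ((2 * R : ℝ) : ℂ)).re ∧
      |(w - ((2 * R : ℝ) : ℂ)).im| ≤ 2 * ε * (w - ((2 * R : ℝ) : ℂ)).re := by
  obtain ⟨h1, h2⟩ := hw
  rw [Complex.sub_re, Complex.sub_im, Complex.ofReal_re, Complex.ofReal_im, sub_zero]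
  refine ⟨by linarith, h2.le.trans ?_⟩
  nlinarith

theorem re_sub_le_of_norm_le {x y : ℂ} {B : ℝ} (hx : ‖x‖ ≤ B) (hy : ‖y‖ ≤ B) :
    x.re ≤ y.re + 2 * B := by
  have h1 := (Complex.re_le_norm x).trans hx
  have h2 := (abs_le.1 ((Complex.abs_re_le_norm y).trans hy)).1
  linarith

theorem norm_le_of_norm_sub_le {v : ℂ} (h : ‖v - V₀‖ ≤ 1) : ‖v‖ ≤ ‖V₀‖ + 1 := by
  have := norm_add_le (v - V₀) V₀
  rw [sub_add_cancel] at this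
  linarith

theorem hasTwistedSolutions_of_bounded (hR₀ : 1 ≤ R₀) (hε₀ : 0 < ε₀)
    (hV : IsAsymptoticUnit s 0 V V₀ R₀ ε₀) :
    HasTwistedSolutions s R₀ ε₀ (twistExponent c 0 0 V μ₁ μ₂) := by
  obtain ⟨R, hR, hlim⟩ := hV.lim 1 one_pos
  have hR1 := hR₀.trans hR
  have hw₀ : ((2 * R : ℝ) : ℂ) ∈ cone R ε₀ := two_mul_mem_cone hR1 hε₀
  have hz₀ : basePoint s R ∈ paramRegion s R ε₀ := basePoint_mem hR1 hε₀
  have hbd : ∀ p ∈ cone R ε₀ ×ˢ paramRegion s R ε₀,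
      ‖principalPart c 0 0 V p‖ ≤ ‖c‖ * (‖V₀‖ + 1) := by
    intro p hp
    rw [principalPart, pow_zero, pow_zero, mul_one, mul_one, norm_mul]
    gcongr
    exact norm_le_of_norm_sub_le (hlim p hp).1
  exact hasTwistedSolutions_of_re_le (M := 2 * (‖c‖ * (‖V₀‖ + 1))) hR₀ hR le_rfl hε₀ le_rfl
    hV.diff hw₀ hz₀
    (fun w hw z hz t ht => re_sub_le_of_norm_le
      (hbd _ ⟨add_mul_sub_mem (convex_cone _ _) hw₀ hw ht, hz⟩) (hbd _ ⟨hw, hz⟩))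
    (fun z hz t ht => re_sub_le_of_norm_le
      (hbd _ ⟨hw₀, add_mul_sub_mem convex_paramRegion hz₀ hz ht⟩) (hbd _ ⟨hw₀, hz⟩))

/-- The derivative of `Re (c V w z^b)` along the segment from `2 R` to `w` is `Re ((w - 2 R) z^b ·
c (1 + w ∂_w) V)`. It is nonnegative, as `(w - 2 R) z^b` lies in a narrow sector and `c (1 + w
∂_w) V` is close to `c V₀`. On the other leg the same argument applies if `b = 1`, and the polar
part is bounded if `b = 0`. -/
theorem hasTwistedSolutions_of_re_pos (hR₀ : 1 ≤ R₀) (hε₀ : 0 < ε₀) (hb : b ≤ 1)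
    (hs : s = false → b = 0) (hV : IsAsymptoticUnit s b V V₀ R₀ ε₀) (hre : 0 < (c * V₀).re) :
    HasTwistedSolutions s R₀ ε₀ (twistExponent c 1 b V μ₁ μ₂) := by
  set δ := (c * V₀).re / 2 with hδ
  have hδpos : 0 < δ := by positivity
  set η := min 1 (δ / (2 * ‖c‖ + 1)) with hη
  have hηpos : 0 < η := by positivity
  have hcη : ‖c‖ * (2 * η) ≤ δ := by
    have h1 : η ≤ δ / (2 * ‖c‖ + 1) := min_le_right _ _
    rw [le_div_iff₀ (by positivity)] at h1
    linarith
  obtain ⟨R, hR, hlim⟩ := hV.lim η hηpos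
  have hR1 := hR₀.trans hR
  set B := ‖c * V₀‖ + δ with hB
  have hBpos : 0 < B := by positivity
  set ε := min ε₀ (min (1 / 2) (δ / (6 * B))) with hε
  have hεpos : 0 < ε := by positivity
  have hεle : ε ≤ ε₀ := min_le_left _ _
  have hεhalf : ε ≤ 1 / 2 := (min_le_right _ _).trans (min_le_left _ _)
  have hεB : 6 * ε * B ≤ δ := by
    have h1 : ε ≤ δ / (6 * B) := (min_le_right _ _).trans (min_le_right _ _)
    rw [le_div_iff₀ (by positivity)] at h1
    linarith
  have hsub : cone R ε ×ˢ paramRegion s R ε ⊆ cone R ε₀ ×ˢ paramRegion s R ε₀ :=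
    cone_prod_mono hR1 le_rfl hεle
  have hdiff : ∀ p ∈ cone R ε ×ˢ paramRegion s R ε, DifferentiableAt ℂ V p := fun p hp =>
    hV.diff.differentiableAt ((isOpen_cone_prod R₀ ε₀).mem_nhds
      (cone_prod_mono hR₀ hR le_rfl (hsub hp)))
  -- the factor `Q` below is `c (1 + x∂) V`, which stays close to `c V₀`
  have hQ : ∀ v d : ℂ, ‖v - V₀‖ ≤ η → ‖d‖ ≤ η →
      δ ≤ (c * (v + d)).re ∧ ‖c * (v + d)‖ ≤ B := by
    intro v d h1 h2
    have h3 := (norm_mul_add_sub_le (c := c) h1 h2).trans hcη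
    refine ⟨?_, ?_⟩
    · have := (abs_le.1 ((Complex.abs_re_le_norm _).trans h3)).1
      rw [Complex.sub_re] at this
      linarith
    · have := norm_add_le (c * (v + d) - c * V₀) (c * V₀)
      rw [sub_add_cancel] at this
      linarith
  have hR4 : R ≤ 4 * R := by linarith
  have hw₀ : ((2 * R : ℝ) : ℂ) ∈ cone R ε := two_mul_mem_cone hR1 hεpos
  have hz₀ : basePoint s R ∈ paramRegion s R ε := basePoint_mem hR1 hεpos
  have hS' : cone (4 * R) ε ⊆ cone R ε := cone_mono (by linarith) hR4 le_rfl
  have hZ' : paramRegion s (4 * R) ε ⊆ paramRegion s R ε := paramRegion_mono hR1 hR4 le_rfl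
  have hM : 0 ≤ 2 * (‖c‖ * (‖V₀‖ + 1) * ‖((2 * R : ℝ) : ℂ)‖) := by positivity
  refine hasTwistedSolutions_of_re_le (M := 2 * (‖c‖ * (‖V₀‖ + 1) * ‖((2 * R : ℝ) : ℂ)‖))
    hR₀ hR hR4 hεpos hεle hV.diff hw₀ hz₀ (fun w hw z hz t ht => ?_) (fun z hz t ht => ?_)
  · have hmem : ∀ t ∈ Icc (0 : ℝ) 1, (((2 * R : ℝ) : ℂ) + t * (w - ((2 * R : ℝ) : ℂ)), z) ∈
        cone R ε ×ˢ paramRegion s R ε := fun t ht =>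
      ⟨add_mul_sub_mem (convex_cone _ _) hw₀ (hS' hw) ht, hZ' hz⟩
    refine (re_le_of_re_deriv_nonneg (f := fun w => principalPart c 1 b V (w, z))
      (f' := fun w => z ^ b * (c * (V (w, z) + w * fderiv ℂ V (w, z) (1, 0))))
      (fun t ht => hasDerivAt_principalPart_fst (hdiff _ (hmem t ht))) (fun t ht => ?_) ht).trans
      (le_add_of_nonneg_right hM)
    obtain ⟨h1, h2, -⟩ := hlim _ (hsub (hmem t ht))
    obtain ⟨h3, h4⟩ := hQ _ _ h1 h2
    obtain ⟨hκ1, hκ2⟩ := pow_mem_sector_of_mem_paramRegion hb hs hR1 hεpos.le (hZ' hz)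
    obtain ⟨hw1, hw2⟩ := sub_two_mul_mem_sector hR1 hεpos hw
    obtain ⟨hm1, hm2⟩ := mul_mem_sector hεpos.le hεhalf (zero_le_one.trans hκ1) hκ2 hw1 hw2
    rw [← mul_assoc, mul_comm (w - _)]
    refine re_mul_nonneg_of_mem_sector hm1 hm2 h3 (le_trans ?_ hεB)
    gcongr
  · interval_cases b
    · have hbd : ∀ z ∈ paramRegion s R ε, ‖principalPart c 1 0 V (((2 * R : ℝ) : ℂ), z)‖
          ≤ ‖c‖ * (‖V₀‖ + 1) * ‖((2 * R : ℝ) : ℂ)‖ := by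
        intro z hz
        rw [principalPart, pow_zero, mul_one, pow_one, norm_mul, norm_mul]
        gcongr
        exact norm_le_of_norm_sub_le
          ((hlim _ (hsub ⟨hw₀, hz⟩)).1.trans (min_le_left _ _))
      exact re_sub_le_of_norm_le
        (hbd _ (add_mul_sub_mem convex_paramRegion hz₀ (hZ' hz) ht)) (hbd _ (hZ' hz))
    · cases s
      · simp at hs
      · have hmem : ∀ t ∈ Icc (0 : ℝ) 1,
            (((2 * R : ℝ) : ℂ), basePoint true R + t * (z - basePoint true R)) ∈
            cone R ε ×ˢ paramRegion true R ε := fun t ht =>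
          ⟨hw₀, add_mul_sub_mem convex_paramRegion hz₀ (hZ' hz) ht⟩
        refine (re_le_of_re_deriv_nonneg
          (f := fun z => principalPart c 1 1 V (((2 * R : ℝ) : ℂ), z))
          (f' := fun z => ((2 * R : ℝ) : ℂ) ^ 1 * (c * (V (((2 * R : ℝ) : ℂ), z) +
            z * fderiv ℂ V (((2 * R : ℝ) : ℂ), z) (0, 1))))
          (fun t ht => hasDerivAt_principalPart_snd (hdiff _ (hmem t ht)))
          (fun t ht => ?_) ht).trans (le_add_of_nonneg_right hM)
        obtain ⟨h1, -, h2⟩ := hlim _ (hsub (hmem t ht))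
        obtain ⟨h3, h4⟩ := hQ _ _ h1 (h2 rfl)
        obtain ⟨hw1, hw2⟩ := sub_two_mul_mem_sector hR1 hεpos hz
        obtain ⟨hm1, hm2⟩ := mul_mem_sector (κ := ((2 * R : ℝ) : ℂ) ^ 1) hεpos.le hεhalf
          (by rw [pow_one, Complex.ofReal_re]; linarith)
          (by rw [pow_one, Complex.ofReal_re, Complex.ofReal_im, abs_zero]; positivity) hw1 hw2
        rw [← mul_assoc, mul_comm (z - _)]
        refine re_mul_nonneg_of_mem_sector hm1 hm2 h3 (le_trans ?_ hεB)
        gcongr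

theorem hasTwistedSolutions (hR₀ : 1 ≤ R₀) (hε₀ : 0 < ε₀) (hb : b ≤ 1)
    (hs : s = false → b = 0) (hab : a = 1 ∨ a = 0 ∧ b = 0)
    (hV : IsAsymptoticUnit s b V V₀ R₀ ε₀) (hc : c * V₀ ≠ 0) :
    HasTwistedSolutions s R₀ ε₀ (twistExponent c a b V μ₁ μ₂) := by
  rcases hab with rfl | ⟨rfl, rfl⟩
  · rcases le_or_gt (c * V₀).re 0 with h | h
    · exact hasTwistedSolutions_of_re_nonpos hR₀ hε₀ hb hs hV hc h
    · exact hasTwistedSolutions_of_re_pos hR₀ hε₀ hb hs hV h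
  · exact hasTwistedSolutions_of_bounded hR₀ hε₀ hV

end CoreGrowth

/-! ### Coordinates on a sector -/

/-- The map `w ↦ ζ w^{-1/k}` from a cone at infinity to a sector around the direction `ζ`. -/
noncomputable def sectorMap (ζ : Circle) (k : ℕ) (w : ℂ) : ℂ :=
  ζ * Complex.exp (-(Complex.log w) / k)

/-- The coordinate `w = (ζ⁻¹ x)^{-k}`, inverse to `sectorMap ζ k` on a narrow sector. -/
noncomputable def sectorCoord (ζ : Circle) (k : ℕ) (x : ℂ) : ℂ := (((ζ : ℂ)⁻¹ * x) ^ k)⁻¹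

/-- The polar coordinates of `sectorMap ζ k w`, as a point of the real blow-up of the line. -/
noncomputable def sectorLift (ζ : Circle) (k : ℕ) (w : ℂ) : ℝ≥0 × Circle :=
  (⟨Real.exp (-(Real.log ‖w‖) / k), Real.exp_nonneg _⟩, ζ * Circle.exp (-(Complex.arg w) / k))

section Sector

variable {ζ : Circle} {k : ℕ}

theorem sectorLift_fst_ne_zero (w : ℂ) : (sectorLift ζ k w).1 ≠ 0 := by
  intro h
  have : Real.exp (-(Real.log ‖w‖) / k) = 0 := congrArg NNReal.toReal h
  exact (Real.exp_pos _).ne' this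

theorem sectorMap_eq (w : ℂ) :
    sectorMap ζ k w = (((sectorLift ζ k w).1 : ℝ) : ℂ) * ((sectorLift ζ k w).2 : ℂ) := by
  have h : -(Complex.log w) / k = ((-(Real.log ‖w‖) / k : ℝ) : ℂ) +
      ((-(Complex.arg w) / k : ℝ) : ℂ) * Complex.I := by
    rw [Complex.log]; push_cast; ring
  have h1 : (((sectorLift ζ k w).1 : ℝ) : ℂ) = Complex.exp ((-(Real.log ‖w‖) / k : ℝ) : ℂ) :=
    Complex.ofReal_exp _
  have h2 : ((sectorLift ζ k w).2 : ℂ)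
      = (ζ : ℂ) * Complex.exp (((-(Complex.arg w) / k : ℝ) : ℂ) * Complex.I) := by
    simp [sectorLift]
  rw [h1, h2, sectorMap, h, Complex.exp_add]
  ring

theorem norm_sectorMap (w : ℂ) : ‖sectorMap ζ k w‖ = Real.exp (-(Real.log ‖w‖) / k) := by
  rw [sectorMap_eq, norm_mul, Circle.norm_coe, mul_one, Complex.norm_real,
    Real.norm_of_nonneg (NNReal.coe_nonneg _)]
  rfl

theorem hasDerivAt_sectorMap {w : ℂ} (hw : 0 < w.re) :
    HasDerivAt (sectorMap ζ k) (-(1 / (k * w)) * sectorMap ζ k w) w := by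
  have h1 := ((Complex.hasDerivAt_log (Or.inl hw)).neg.div_const (k : ℂ)).cexp.const_mul (ζ : ℂ)
  refine h1.congr_deriv ?_
  simp only [sectorMap, Pi.neg_apply]
  rw [one_div, mul_inv]
  ring

theorem hasDerivAt_sectorCoord {x : ℂ} (hx : x ≠ 0) :
    HasDerivAt (sectorCoord ζ k) (-(k * sectorCoord ζ k x) / x) x := by
  have hζ := Circle.coe_ne_zero ζ
  have h0 : (ζ : ℂ)⁻¹ * x ≠ 0 := mul_ne_zero (inv_ne_zero hζ) hx
  have h1 := (((hasDerivAt_id x).const_mul (ζ : ℂ)⁻¹).pow k).inv (pow_ne_zero k h0)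
  refine h1.congr_deriv ?_
  simp only [sectorCoord, id, Pi.pow_apply]
  rcases k with _ | k
  · simp
  · simp only [Nat.add_sub_cancel]
    have := pow_ne_zero k h0
    set y := (ζ : ℂ)⁻¹ * x with hy
    have hyx : (ζ : ℂ)⁻¹ = y / x := by rw [hy]; field_simp
    rw [hyx, mul_one]
    field_simp
    ring

theorem norm_sectorCoord (x : ℂ) : ‖sectorCoord ζ k x‖ = (‖x‖ ^ k)⁻¹ := by
  rw [sectorCoord, norm_inv, norm_pow, norm_mul, norm_inv, Circle.norm_coe, inv_one, one_mul]

theorem norm_sectorMap_inv_le (hk : 1 ≤ k) {w : ℂ} (hw : 1 ≤ ‖w‖) :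
    ‖sectorMap ζ k w‖⁻¹ ≤ ‖w‖ := by
  rw [norm_sectorMap, ← Real.exp_neg, neg_div, neg_neg]
  calc Real.exp (Real.log ‖w‖ / k) ≤ Real.exp (Real.log ‖w‖) := by
        apply Real.exp_le_exp.2
        exact div_le_self (Real.log_nonneg hw) (by exact_mod_cast hk)
    _ = ‖w‖ := Real.exp_log (by linarith)

theorem tendsto_exp_neg_log_div (hk : 1 ≤ k) :
    Tendsto (fun x : ℝ => Real.exp (-(Real.log x) / k)) atTop (𝓝 0) := by
  have hk' : (0 : ℝ) < k := by exact_mod_cast hk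
  refine Real.tendsto_exp_atBot.comp ?_
  exact (tendsto_neg_atTop_atBot.comp Real.tendsto_log_atTop).atBot_div_const hk'

theorem exists_norm_sectorMap_le (hk : 1 ≤ k) {η : ℝ} (hη : 0 < η) :
    ∃ R ≥ 1, ∀ w : ℂ, R ≤ ‖w‖ → ‖sectorMap ζ k w‖ ≤ η := by
  obtain ⟨R, hR⟩ := eventually_atTop.1 ((tendsto_exp_neg_log_div hk).eventually_lt_const hη)
  refine ⟨max 1 R, le_max_left _ _, fun w hw => ?_⟩
  rw [norm_sectorMap]
  exact (hR _ ((le_max_right _ _).trans hw)).le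

/-- In the coordinate `w` with `k = max m 1`, the pole `x^{-m}` becomes `w` if `m > 0`, and `1` if
`m = 0`. -/
theorem sectorMap_zpow_neg_eq {m : ℕ} {w : ℂ} (hw : w ≠ 0) :
    sectorMap ζ (max m 1) w ^ (-(m : ℤ)) = (ζ : ℂ) ^ (-(m : ℤ)) * w ^ (min m 1) := by
  rcases Nat.eq_zero_or_pos m with rfl | hm
  · simp
  · rw [max_eq_left hm, min_eq_right hm, pow_one, sectorMap, mul_zpow, zpow_neg _ (m : ℤ),
      zpow_neg (Complex.exp _), zpow_natCast, zpow_natCast, ← Complex.exp_nat_mul,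
      ← Complex.exp_neg]
    have hm' : (m : ℂ) ≠ 0 := by exact_mod_cast hm.ne'
    have : -((m : ℂ) * (-Complex.log w / m)) = Complex.log w := by field_simp
    rw [this, Complex.exp_log hw]

theorem exists_abs_arg_lt {η : ℝ} (hη : 0 < η) :
    ∃ ε > 0, ∀ w : ℂ, 0 < w.re → |w.im| < ε * w.re → |Complex.arg w| < η := by
  have h1 : ContinuousAt Complex.arg 1 := Complex.continuousAt_arg (by simp)
  obtain ⟨ε, hε, h⟩ := Metric.continuousAt_iff.1 h1 η hη
  refine ⟨ε, hε, fun w hw him => ?_⟩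
  have h2 : ((w.re⁻¹ : ℝ) : ℂ) * w - 1 = ((w.re⁻¹ * w.im : ℝ) : ℂ) * Complex.I := by
    apply Complex.ext <;> simp [hw.ne']
  have h3 : dist (((w.re⁻¹ : ℝ) : ℂ) * w) 1 < ε := by
    rw [dist_eq_norm, h2, norm_mul, Complex.norm_I, mul_one, Complex.norm_real, Real.norm_eq_abs,
      abs_mul, abs_of_pos (inv_pos.2 hw), inv_mul_lt_iff₀ hw, mul_comm]
    exact him
  have h4 := h h3
  rw [Complex.arg_real_mul _ (inv_pos.2 hw), Complex.arg_one, dist_zero_right] at h4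
  exact h4

theorem exists_cone_sectorLift_mem (hk : 1 ≤ k) {O : Set (ℝ≥0 × Circle)}
    (hO : O ∈ 𝓝 ((0 : ℝ≥0), ζ)) :
    ∃ R ≥ 1, ∃ ε > 0, ∀ w ∈ cone R ε, sectorLift ζ k w ∈ O := by
  set f : ℝ × ℝ → ℝ≥0 × Circle := fun q => (Real.toNNReal q.1, ζ * Circle.exp (-q.2 / k)) with hf
  have hfc : Continuous f := by fun_prop
  have hf0 : f (0, 0) = (0, ζ) := by simp [hf]
  obtain ⟨η, hη, h⟩ := Metric.mem_nhds_iff.1 (hfc.continuousAt.preimage_mem_nhds (hf0.symm ▸ hO))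
  obtain ⟨R, hR, hR'⟩ := exists_norm_sectorMap_le (ζ := ζ) hk (half_pos hη)
  obtain ⟨ε, hε, hε'⟩ := exists_abs_arg_lt hη
  refine ⟨R, hR, ε, hε, fun w hw => ?_⟩
  have h1 := hR' w (lt_norm_of_mem_cone hw).le
  rw [norm_sectorMap] at h1
  have h2 := hε' w (by linarith [hw.1]) hw.2
  have h3 : ((Real.exp (-(Real.log ‖w‖) / k), Complex.arg w) : ℝ × ℝ) ∈
      ball ((0 : ℝ), (0 : ℝ)) η := by
    rw [mem_ball, Prod.dist_eq, max_lt_iff]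
    simp only [dist_zero_right, Real.norm_eq_abs, Real.abs_exp]
    exact ⟨by linarith, h2⟩
  have h4 := h h3
  have h5 : f (Real.exp (-(Real.log ‖w‖) / k), Complex.arg w) = sectorLift ζ k w := by
    simp only [hf, sectorLift]
    congr 1
    exact Real.toNNReal_of_nonneg (Real.exp_nonneg _)
  rw [← h5]
  exact h4

theorem eventually_sectorCoord_mem_cone (hk : 1 ≤ k) {R ε : ℝ} (hR : 1 ≤ R) (hε : 0 < ε) :
    ∀ᶠ q : ℝ≥0 × Circle in 𝓝 ((0 : ℝ≥0), ζ), q.1 ≠ 0 →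
      sectorCoord ζ k (((q.1 : ℝ) : ℂ) * (q.2 : ℂ)) ∈ cone R ε ∧
      sectorMap ζ k (sectorCoord ζ k (((q.1 : ℝ) : ℂ) * (q.2 : ℂ))) =
        ((q.1 : ℝ) : ℂ) * (q.2 : ℂ) := by
  have hζ := Circle.coe_ne_zero ζ
  have hk0 : (k : ℂ) ≠ 0 := by exact_mod_cast (by omega : k ≠ 0)
  have hkpos : (0 : ℝ) < k := by exact_mod_cast hk
  set y : ℝ≥0 × Circle → ℂ := fun q => (ζ : ℂ)⁻¹ * (q.2 : ℂ) with hy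
  have hyc : Continuous y := by fun_prop
  have hy0 : y (0, ζ) = 1 := inv_mul_cancel₀ hζ
  have hyne : ∀ q, y q ≠ 0 := fun q => mul_ne_zero (inv_ne_zero hζ) (Circle.coe_ne_zero _)
  set κ : ℝ≥0 × Circle → ℂ := fun q => (y q ^ k)⁻¹ with hκ
  have hκc : Continuous κ := (hyc.pow k).inv₀ fun q => pow_ne_zero k (hyne q)
  have hκ0 : κ (0, ζ) = 1 := by simp [hκ, hy0]
  have e1 : ∀ᶠ q in 𝓝 ((0 : ℝ≥0), ζ), 1 / 2 < (κ q).re :=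
    (Complex.continuous_re.comp hκc).continuousAt.eventually_const_lt (by
      simp only [Function.comp_apply, hκ0, Complex.one_re]; norm_num)
  have e2 : ∀ᶠ q in 𝓝 ((0 : ℝ≥0), ζ), |(κ q).im| - ε * (κ q).re < 0 := by
    refine Filter.Tendsto.eventually_lt_const (v := |(κ (0, ζ)).im| - ε * (κ (0, ζ)).re) ?_ ?_
    · simp only [hκ0, Complex.one_re, Complex.one_im, abs_zero]; linarith
    · exact Continuous.tendsto' (by fun_prop) _ _ rfl
  have e3 : ∀ᶠ q : ℝ≥0 × Circle in 𝓝 ((0 : ℝ≥0), ζ), (q.1 : ℝ) < 1 / (2 * R) := by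
    refine Filter.Tendsto.eventually_lt_const (v := ((0 : ℝ≥0) : ℝ)) ?_ ?_
    · simp only [NNReal.coe_zero]; positivity
    · exact Continuous.tendsto' (NNReal.continuous_coe.comp continuous_fst) _ _ rfl
  -- the branch condition: `k` times the angle stays below `π`, so that `log` inverts the power
  have e4 : ∀ᶠ q in 𝓝 ((0 : ℝ≥0), ζ), |Complex.arg (y q)| < Real.pi / k := by
    have h1 : ContinuousAt (fun q => |Complex.arg (y q)|) (0, ζ) := by
      refine ContinuousAt.abs ?_
      refine ContinuousAt.comp (g := Complex.arg) (f := y) ?_ hyc.continuousAt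
      rw [hy0]
      exact Complex.continuousAt_arg (by simp)
    refine Filter.Tendsto.eventually_lt_const ?_ h1
    show |Complex.arg (y (0, ζ))| < _
    rw [hy0, Complex.arg_one, abs_zero]
    positivity
  filter_upwards [e1, e2, e3, e4] with q h1 h2 h3 h4 hq
  have hr : (0 : ℝ) < q.1 := by exact_mod_cast pos_iff_ne_zero.2 hq
  have hxy : (ζ : ℂ)⁻¹ * (((q.1 : ℝ) : ℂ) * (q.2 : ℂ)) = ((q.1 : ℝ) : ℂ) * y q := by
    simp only [hy]; ring
  have hW : sectorCoord ζ k (((q.1 : ℝ) : ℂ) * (q.2 : ℂ)) =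
      ((((q.1 : ℝ) ^ k)⁻¹ : ℝ) : ℂ) * κ q := by
    rw [sectorCoord, hxy, mul_pow, mul_inv]
    push_cast
    rfl
  have hrk : 2 * R < ((q.1 : ℝ) ^ k)⁻¹ := by
    rw [lt_inv_comm₀ (by linarith) (by positivity)]
    rw [one_div] at h3
    have h2R : (2 * R)⁻¹ ≤ 1 := inv_le_one_of_one_le₀ (by linarith)
    calc (q.1 : ℝ) ^ k ≤ (q.1 : ℝ) ^ 1 :=
          pow_le_pow_of_le_one hr.le (by linarith) hk
      _ < (2 * R)⁻¹ := by rw [pow_one]; exact h3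
  have hrk0 : 0 < ((q.1 : ℝ) ^ k)⁻¹ := by positivity
  refine ⟨?_, ?_⟩
  · rw [hW]
    refine ⟨?_, ?_⟩
    · rw [Complex.re_ofReal_mul]; nlinarith
    · rw [Complex.re_ofReal_mul, Complex.im_ofReal_mul, abs_mul, abs_of_pos hrk0]
      nlinarith
  · set v : ℂ := (ζ : ℂ)⁻¹ * (((q.1 : ℝ) : ℂ) * (q.2 : ℂ)) with hv
    have hargv : |Complex.arg v| < Real.pi / k := by
      rw [hxy, Complex.arg_real_mul _ hr]; exact h4
    rw [lt_div_iff₀ hkpos, mul_comm] at hargv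
    replace hargv : |k * Complex.arg v| < Real.pi := by rwa [abs_mul, abs_of_pos hkpos]
    rw [abs_lt] at hargv
    have hv0 : v ≠ 0 := by
      rw [hxy]
      exact mul_ne_zero (by exact_mod_cast hr.ne') (hyne q)
    have him : ((k : ℂ) * Complex.log v).im = k * Complex.arg v := by
      rw [← Complex.ofReal_natCast, Complex.im_ofReal_mul, Complex.log_im]
    have hlog : Complex.log (v ^ k) = k * Complex.log v := by
      rw [← Complex.log_exp (x := k * Complex.log v) (by rw [him]; exact hargv.1)
        (by rw [him]; exact hargv.2.le), Complex.exp_nat_mul, Complex.exp_log hv0]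
    have hargpow : Complex.arg (v ^ k) ≠ Real.pi := by
      have := congrArg Complex.im hlog
      rw [Complex.log_im, him] at this
      rw [this]
      exact hargv.2.ne
    rw [sectorMap, sectorCoord, Complex.log_inv _ hargpow, neg_neg, hlog,
      mul_div_cancel_left₀ _ hk0, Complex.exp_log hv0, hv, mul_inv_cancel_left₀ hζ]

end Sector

/-! ### Functions on the real blow-up -/

section BlowUp

variable {n p : ℕ}

theorem coe_circleExp_arg {x : ℂ} (hx : x ≠ 0) :
    (Circle.exp (Complex.arg x) : ℂ) = x / ‖x‖ := by
  have h : (‖x‖ : ℂ) ≠ 0 := by simpa using hx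
  rw [Circle.coe_exp, eq_div_iff h, mul_comm]
  exact Complex.norm_mul_exp_arg_mul_I x

theorem continuousAt_lift {x : Ambient n p} (hx : ∀ i, x.1 i ≠ 0) :
    ContinuousAt (lift : Ambient n p → RealBlowUp n p) x := by
  refine ContinuousAt.prodMk (continuousAt_pi.2 fun i => ContinuousAt.prodMk ?_ ?_)
    continuousAt_snd
  · exact Continuous.continuousAt (by fun_prop)
  · have h1 : ContinuousAt (fun z : ℂ => Circle.exp (Complex.arg z)) (x.1 i) := by
      have hind : Topology.IsInducing (fun z : Circle => (z : ℂ)) := ⟨rfl⟩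
      refine hind.continuousAt_iff.2 ?_
      have h2 : ContinuousAt (fun z : ℂ => z / (‖z‖ : ℂ)) (x.1 i) :=
        continuousAt_id.div (by fun_prop) (by simpa using hx i)
      refine h2.congr ?_
      filter_upwards [isOpen_ne.mem_nhds (hx i)] with z hz
      exact (coe_circleExp_arg hz).symm
    exact ContinuousAt.comp (f := fun x : Ambient n p => x.1 i) h1 (by fun_prop)

theorem isOpen_offD {Ω : Set (RealBlowUp n p)} (hΩ : IsOpen Ω) : IsOpen (offD Ω) := by
  rw [isOpen_iff_mem_nhds]
  rintro x ⟨hx, hxΩ⟩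
  have h1 : ∀ᶠ y : Ambient n p in 𝓝 x, ∀ i, y.1 i ≠ 0 :=
    eventually_all.2 fun i => ContinuousAt.eventually_ne (by fun_prop) (hx i)
  filter_upwards [h1, (continuousAt_lift hx).preimage_mem_nhds (hΩ.mem_nhds hxΩ)] with y h2 h3
  exact ⟨h2, h3⟩

theorem offD_mono {S T : Set (RealBlowUp n p)} (h : S ⊆ T) : offD S ⊆ offD T :=
  fun _ hx => ⟨hx.1, h hx.2⟩

theorem proj_mem_offD {Ω : Set (RealBlowUp n p)} {b : RealBlowUp n p} (hb : ∀ i, (b.1 i).1 ≠ 0)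
    (hbΩ : b ∈ Ω) : proj b ∈ offD Ω := by
  refine ⟨fun i => mul_ne_zero ?_ (Circle.coe_ne_zero _), by rwa [lift_proj b hb]⟩
  exact_mod_cast hb i

theorem continuous_polar : Continuous (polar : (Fin n → ℝ) × (Fin n → ℝ) × (Fin p → ℂ) → _) := by
  unfold polar
  fun_prop

/-- A right inverse of `polar` that is continuous at `ϑ`: the angles are chosen near the arguments
of those of `ϑ`. -/
noncomputable def localPolar (ϑ b : RealBlowUp n p) : (Fin n → ℝ) × (Fin n → ℝ) × (Fin p → ℂ) :=
  (fun i => ((b.1 i).1 : ℝ),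
    fun i => Complex.arg (ϑ.1 i).2 + Complex.arg ((b.1 i).2 * ((ϑ.1 i).2)⁻¹ : Circle), b.2)

theorem polar_localPolar (ϑ b : RealBlowUp n p) : polar (localPolar ϑ b) = b := by
  refine Prod.ext (funext fun i => Prod.ext ?_ ?_) rfl
  · simp [polar, localPolar]
  · simp only [polar, localPolar, Circle.exp_add, Circle.exp_arg]
    rw [mul_comm, inv_mul_cancel_right]

theorem continuousAt_localPolar (ϑ : RealBlowUp n p) : ContinuousAt (localPolar ϑ) ϑ := by
  refine ContinuousAt.prodMk (continuousAt_pi.2 fun i => Continuous.continuousAt (by fun_prop))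
    (ContinuousAt.prodMk (continuousAt_pi.2 fun i => ContinuousAt.add continuousAt_const ?_)
      continuousAt_snd)
  refine ContinuousAt.comp (g := Complex.arg)
    (f := fun b : RealBlowUp n p => (((b.1 i).2 * ((ϑ.1 i).2)⁻¹ : Circle) : ℂ)) ?_
    (Continuous.continuousAt (by fun_prop))
  rw [mul_inv_cancel, Circle.coe_one]
  exact Complex.continuousAt_arg (by simp)

/-- A radial step in polar coordinates is a step of the same length along the ray through `x_i`.
-/
theorem localPolar_lift_add {ϑ : RealBlowUp n p} {x : Ambient n p} (hx : ∀ i, x.1 i ≠ 0)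
    (i : Fin n) {h : ℝ} (hh : -‖x.1 i‖ < h) :
    polar (localPolar ϑ (lift x) + h • (Pi.single i 1, 0)) =
      lift (x + (h : ℂ) • (Pi.single i (x.1 i / ‖x.1 i‖), 0)) := by
  have hn : (‖x.1 i‖ : ℂ) ≠ 0 := by simpa using hx i
  have hkey : x.1 i + h * (x.1 i / ‖x.1 i‖) = ((‖x.1 i‖ + h) / ‖x.1 i‖ : ℝ) * x.1 i := by
    push_cast
    field_simp
  have hpos : 0 < (‖x.1 i‖ + h) / ‖x.1 i‖ :=
    div_pos (by linarith) (norm_pos_iff.2 (hx i))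
  have hl := polar_localPolar ϑ (lift x)
  refine Prod.ext (funext fun j => Prod.ext ?_ ?_) ?_
  · by_cases hj : j = i
    · subst hj
      ext
      simp only [polar, localPolar, lift, Prod.fst_add, Prod.smul_fst, Pi.add_apply,
        Pi.smul_apply, Pi.single_eq_same, smul_eq_mul, mul_one, coe_nnnorm]
      rw [hkey, norm_mul, Complex.norm_real, Real.norm_of_nonneg hpos.le,
        div_mul_cancel₀ _ (norm_ne_zero_iff.2 (hx j)), Real.coe_toNNReal _ (by linarith)]
    · simp [polar, localPolar, lift, hj]
  · have h1 := congrArg (fun b : RealBlowUp n p => (b.1 j).2) hl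
    simp only [polar] at h1
    simp only [polar, Prod.snd_add, Prod.smul_snd, Prod.fst_add, smul_zero,
      add_zero, Prod.smul_fst, Pi.add_apply]
    rw [h1]
    by_cases hj : j = i
    · subst hj
      simp only [lift, Prod.fst_add, Prod.smul_fst, Pi.add_apply, Pi.smul_apply, Pi.single_eq_same,
        smul_eq_mul]
      rw [hkey, Complex.arg_real_mul _ hpos]
    · simp [lift, hj]
  · simp [polar, localPolar, lift]

/-- A section of `𝒜` is Lipschitz in polar coordinates up to the boundary. As it is holomorphic in
the interior, its derivative in `x_i` is determined by the radial one, hence bounded. -/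
theorem RealBlowUp.IsHolSection.exists_eulerDeriv_bound {Ω : Set (RealBlowUp n p)}
    {F : RealBlowUp n p → ℂ} (hF : IsHolSection Ω F) (hΩ : IsOpen Ω) {ϑ : RealBlowUp n p}
    (hϑ : ϑ ∈ Ω) :
    ∃ (L : ℝ) (O : Set (RealBlowUp n p)), O ∈ 𝓝 ϑ ∧ O ⊆ Ω ∧ 0 ≤ L ∧ ∀ x ∈ offD O, ∀ i,
      ‖eulerDeriv i (F ∘ lift) x‖ ≤ L * ‖x.1 i‖ := by
  set S : Set ((Fin n → ℝ) × (Fin n → ℝ) × (Fin p → ℂ)) := {c | ∀ i, 0 ≤ c.1 i} with hS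
  have hSconv : Convex ℝ S := by
    intro c hc d hd a b ha hb hab i
    simp only [Prod.fst_add, Prod.smul_fst, Pi.add_apply, Pi.smul_apply, smul_eq_mul]
    exact add_nonneg (mul_nonneg ha (hc i)) (mul_nonneg hb (hd i))
  set c₀ := localPolar ϑ ϑ with hc₀
  have hc₀S : c₀ ∈ S := fun i => NNReal.coe_nonneg _
  have hpc : polar ⁻¹' Ω ∈ 𝓝 c₀ :=
    continuous_polar.continuousAt.preimage_mem_nhds
      (hΩ.mem_nhds (by rw [hc₀, polar_localPolar]; exact hϑ))
  have hcd : ContDiffWithinAt ℝ 1 (F ∘ polar) S c₀ := by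
    have h1 := (hF.smooth c₀ ⟨hc₀S, mem_of_mem_nhds hpc⟩).of_le (m := 1) (by simp)
    rwa [contDiffWithinAt_inter hpc] at h1
  obtain ⟨L, t, ht, hL⟩ := hcd.exists_lipschitzOnWith hSconv
  obtain ⟨r, hr, hrt⟩ := Metric.mem_nhdsWithin_iff.1 ht
  refine ⟨L, localPolar ϑ ⁻¹' ball c₀ r ∩ Ω, inter_mem ((continuousAt_localPolar
    ϑ).preimage_mem_nhds (ball_mem_nhds _ hr)) (hΩ.mem_nhds hϑ), inter_subset_right,
    NNReal.coe_nonneg L, ?_⟩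
  rintro x ⟨hx, hxO, hxΩ⟩ i
  set d := localPolar ϑ (lift x) with hd
  have hxi : 0 < ‖x.1 i‖ := norm_pos_iff.2 (hx i)
  have hsingle : ‖(Pi.single i 1 : Fin n → ℝ)‖ = 1 := by
    rw [Pi.norm_single, norm_one]
  -- along the ray through `x` in the `i`-th coordinate, `F` is Lipschitz
  set v : Ambient n p := (Pi.single i (x.1 i / ‖x.1 i‖), 0) with hv
  have hder : HasDerivAt (fun h : ℝ => (F ∘ lift) (x + (h : ℂ) • v))
      (fderiv ℂ (F ∘ lift) x v) 0 := by
    have h1 : HasDerivAt (fun h : ℝ => x + (h : ℂ) • v) v 0 := by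
      simpa using ((Complex.ofRealCLM.hasDerivAt (x := 0)).smul_const v).const_add x
    have h2 := (hF.holo.differentiableAt ((isOpen_offD hΩ).mem_nhds ⟨hx, hxΩ⟩)).hasFDerivAt
    have h3 : HasFDerivAt (F ∘ lift) (fderiv ℂ (F ∘ lift) x) (x + ((0 : ℝ) : ℂ) • v) := by
      simpa using h2
    exact (h3.restrictScalars ℝ).comp_hasDerivAt 0 h1
  have hlip : ‖fderiv ℂ (F ∘ lift) x v‖ ≤ L := by
    refine hder.le_of_lip' (NNReal.coe_nonneg L) ?_
    have hcont : Continuous fun h : ℝ =>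
        d + h • ((Pi.single i 1, 0) : (Fin n → ℝ) × (Fin n → ℝ) × (Fin p → ℂ)) := by fun_prop
    have e1 : ∀ᶠ h : ℝ in 𝓝 0, d + h • ((Pi.single i 1, 0) :
        (Fin n → ℝ) × (Fin n → ℝ) × (Fin p → ℂ)) ∈ ball c₀ r :=
      hcont.continuousAt.preimage_mem_nhds (isOpen_ball.mem_nhds (by simpa using hxO))
    have e2 : ∀ᶠ h : ℝ in 𝓝 0, -‖x.1 i‖ < h := lt_mem_nhds (by linarith)
    filter_upwards [e1, e2] with h h1 h2
    have hdS : d ∈ S := fun j => NNReal.coe_nonneg _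
    have hdhS : d + h • ((Pi.single i 1, 0) : (Fin n → ℝ) × (Fin n → ℝ) × (Fin p → ℂ)) ∈ S := by
      intro j
      by_cases hj : j = i
      · subst hj
        simp [hd, localPolar, lift]
        linarith
      · simpa [hj] using hdS j
    have h3 := hL.norm_sub_le (hrt ⟨h1, hdhS⟩) (hrt ⟨hxO, hdS⟩)
    simp only [Function.comp_apply] at h3
    rw [localPolar_lift_add hx i h2, polar_localPolar] at h3
    simp only [Function.comp_apply, Complex.ofReal_zero, zero_smul, add_zero, sub_zero]
    refine h3.trans ?_
    rw [add_sub_cancel_left, norm_smul]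
    refine mul_le_mul_of_nonneg_left (mul_le_of_le_one_right (norm_nonneg _) ?_)
      (NNReal.coe_nonneg L)
    rw [Prod.norm_def, norm_zero, max_le_iff]
    exact ⟨hsingle.le, zero_le_one⟩
  have heq : eulerDeriv i (F ∘ lift) x = ‖x.1 i‖ * fderiv ℂ (F ∘ lift) x v := by
    have hvv : v = (x.1 i / ‖x.1 i‖) • ((Pi.single i 1, 0) : Ambient n p) := by
      rw [hv]
      refine Prod.ext ?_ (by simp)
      ext j
      by_cases hj : j = i
      · subst hj; simp
      · simp [hj]
    have hn : (‖x.1 i‖ : ℂ) ≠ 0 := by exact_mod_cast hxi.ne'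
    rw [eulerDeriv, hvv, map_smul, smul_eq_mul]
    field_simp
  rw [heq, norm_mul, Complex.norm_real, norm_norm, mul_comm]
  gcongr

theorem RealBlowUp.IsHolSection.continuousAt {Ω : Set (RealBlowUp n p)} {F : RealBlowUp n p → ℂ}
    (hF : IsHolSection Ω F) (hΩ : IsOpen Ω) {ϑ : RealBlowUp n p} (hϑ : ϑ ∈ Ω) :
    ContinuousAt F ϑ := by
  have h1 := (hF.smooth (localPolar ϑ ϑ) ⟨fun i => NNReal.coe_nonneg _, by
    rw [mem_preimage, polar_localPolar]; exact hϑ⟩).continuousWithinAt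
  have h2 : Tendsto (localPolar ϑ) (𝓝 ϑ)
      (𝓝[{c | ∀ i, 0 ≤ c.1 i} ∩ polar ⁻¹' Ω] (localPolar ϑ ϑ)) := by
    refine tendsto_nhdsWithin_iff.2 ⟨continuousAt_localPolar ϑ, ?_⟩
    filter_upwards [hΩ.mem_nhds hϑ] with b hb
    exact ⟨fun i => NNReal.coe_nonneg _, by rw [mem_preimage, polar_localPolar]; exact hb⟩
  have h3 := Tendsto.comp h1 h2
  rw [Function.comp_apply, polar_localPolar] at h3
  refine h3.congr fun b => ?_
  rw [Function.comp_apply, Function.comp_apply, polar_localPolar]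

end BlowUp

/-! ### Charts and transport of solutions -/

/-- Coordinates `(w, z)` of a sector at `ϑ` in which the operators `∂_{v₁}` and `∂_{v₂}` are
multiples of `∂_w` and `∂_z`. The map `X` parametrizes the sector, and `W` is its inverse near
`ϑ`; along `X` one has `∂_w = σ₁ ∂_{v₁}` and `∂_z = σ₂ ∂_{v₂}`. The growth conditions say that
moderate growth at `D` and polynomial growth in `(w, z)` are the same. -/
structure LogChart {n p : ℕ} (ϑ : RealBlowUp n p) (s : Bool) where
  /-- The parametrization. -/
  X : ℂ × ℂ → Ambient n p
  /-- The coordinates. -/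
  W : Ambient n p → ℂ × ℂ
  /-- The vector field of the first equation. -/
  v₁ : Ambient n p → Ambient n p
  /-- The vector field of the second equation. -/
  v₂ : Ambient n p → Ambient n p
  /-- The factor in `∂_w = σ₁ ∂_{v₁}`, a function of `w` alone. -/
  σ₁ : ℂ → ℂ
  /-- The factor in `∂_z = σ₂ ∂_{v₂}`, a function of `z` alone. -/
  σ₂ : ℂ → ℂ
  exists_mem_offD : ∀ O ∈ 𝓝 ϑ, ∃ R ≥ 1, ∃ ε > 0, ∀ q ∈ cone R ε ×ˢ paramRegion s R ε,
    X q ∈ offD O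
  eventually_W_mem : ∀ R ≥ 1, ∀ ε > 0, ∀ᶠ b in 𝓝 ϑ, (∀ i, (b.1 i).1 ≠ 0) →
    W (proj b) ∈ cone R ε ×ˢ paramRegion s R ε ∧ X (W (proj b)) = proj b
  hasFDerivAt_X : ∀ q : ℂ × ℂ, 0 < q.1.re → 0 < q.2.re → ∃ X' : ℂ × ℂ →L[ℂ] Ambient n p,
    HasFDerivAt X X' q ∧ X' (1, 0) = σ₁ q.1 • v₁ (X q) ∧ X' (0, 1) = σ₂ q.2 • v₂ (X q)
  hasFDerivAt_W : ∀ x : Ambient n p, (∀ i, x.1 i ≠ 0) →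
    ∃ W' : Ambient n p →L[ℂ] ℂ × ℂ, HasFDerivAt W W' x ∧
      σ₁ (W x).1 • W' (v₁ x) = (1, 0) ∧ σ₂ (W x).2 • W' (v₂ x) = (0, 1)
  differentiableAt_σ₁ : ∀ w : ℂ, 0 < w.re → DifferentiableAt ℂ σ₁ w
  differentiableAt_σ₂ : ∀ z : ℂ, 0 < z.re → DifferentiableAt ℂ σ₂ z
  norm_σ₁_le : ∀ w : ℂ, 1 ≤ ‖w‖ → ‖σ₁ w‖ ≤ 1
  norm_σ₂_le : ∀ z : ℂ, 1 ≤ ‖z‖ → ‖σ₂ z‖ ≤ 1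
  growth_X : ∀ N : Fin n → ℕ, ∃ M : ℕ, ∀ q : ℂ × ℂ, 1 ≤ ‖q.1‖ → 1 ≤ ‖q.2‖ →
    ∏ i, ‖(X q).1 i‖ ^ (-(N i : ℤ)) ≤ (‖q.1‖ * ‖q.2‖) ^ M
  growth_W : ∀ (M : ℕ) (ε : ℝ), ∃ (C : ℝ) (N : Fin n → ℕ), 0 ≤ C ∧ ∀ x : Ambient n p,
    (∀ i, x.1 i ≠ 0) → W x ∈ cone 1 ε ×ˢ paramRegion s 1 ε →
    (‖(W x).1‖ * ‖(W x).2‖) ^ M ≤ C * ∏ i, ‖x.1 i‖ ^ (-(N i : ℤ))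

namespace LogChart

variable {n p : ℕ} {ϑ : RealBlowUp n p} {s : Bool} (ch : LogChart ϑ s)

section Pullback

variable {q : ℂ × ℂ} {f : Ambient n p → ℂ}

theorem differentiableAt_comp_X (h1 : 0 < q.1.re) (h2 : 0 < q.2.re)
    (hf : DifferentiableAt ℂ f (ch.X q)) : DifferentiableAt ℂ (fun q => f (ch.X q)) q := by
  obtain ⟨X', hX, -, -⟩ := ch.hasFDerivAt_X q h1 h2
  exact hf.comp q hX.differentiableAt

theorem fderiv_comp_X_fst (h1 : 0 < q.1.re) (h2 : 0 < q.2.re)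
    (hf : DifferentiableAt ℂ f (ch.X q)) :
    fderiv ℂ (fun q => f (ch.X q)) q (1, 0)
      = ch.σ₁ q.1 * fderiv ℂ f (ch.X q) (ch.v₁ (ch.X q)) := by
  obtain ⟨X', hX, hX1, -⟩ := ch.hasFDerivAt_X q h1 h2
  have h : fderiv ℂ (fun q => f (ch.X q)) q = _ := (hf.hasFDerivAt.comp q hX).fderiv
  rw [h, ContinuousLinearMap.comp_apply, hX1, map_smul, smul_eq_mul]

theorem fderiv_comp_X_snd (h1 : 0 < q.1.re) (h2 : 0 < q.2.re)
    (hf : DifferentiableAt ℂ f (ch.X q)) :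
    fderiv ℂ (fun q => f (ch.X q)) q (0, 1)
      = ch.σ₂ q.2 * fderiv ℂ f (ch.X q) (ch.v₂ (ch.X q)) := by
  obtain ⟨X', hX, -, hX2⟩ := ch.hasFDerivAt_X q h1 h2
  have h : fderiv ℂ (fun q => f (ch.X q)) q = _ := (hf.hasFDerivAt.comp q hX).fderiv
  rw [h, ContinuousLinearMap.comp_apply, hX2, map_smul, smul_eq_mul]

end Pullback

/-- The region in `(w, z)` has to map into a compact set, as the bound of a section of `𝒜^{mod D}`
depends on the compact set. -/
theorem polyGrowthOn_pullback {Ω K : Set (RealBlowUp n p)} (hK : IsCompact K) (hKΩ : K ⊆ Ω)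
    {D : Set (ℂ × ℂ)} (hD1 : ∀ q ∈ D, 1 ≤ ‖q.1‖ ∧ 1 ≤ ‖q.2‖) (hX : ∀ q ∈ D, ch.X q ∈ offD K)
    {ρ : Ambient n p → ℂ} (hρ : IsModSection Ω ρ) {σ : ℂ × ℂ → ℂ} (hσ : ∀ q ∈ D, ‖σ q‖ ≤ 1) :
    PolyGrowthOn D (fun q => σ q * ρ (ch.X q)) := by
  obtain ⟨C, N, hCN⟩ := hρ.moderate K hKΩ hK
  obtain ⟨M, hM⟩ := ch.growth_X N
  refine ⟨|C|, M, fun q hq => ?_⟩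
  obtain ⟨h1, h2⟩ := hD1 q hq
  rw [norm_mul]
  have h3 : (0 : ℝ) ≤ ∏ i, ‖(ch.X q).1 i‖ ^ (-(N i : ℤ)) :=
    Finset.prod_nonneg fun i _ => zpow_nonneg (norm_nonneg _) _
  calc ‖σ q‖ * ‖ρ (ch.X q)‖ ≤ 1 * ‖ρ (ch.X q)‖ := by gcongr; exact hσ q hq
    _ ≤ C * ∏ i, ‖(ch.X q).1 i‖ ^ (-(N i : ℤ)) := by rw [one_mul]; exact hCN _ (hX q hq)
    _ ≤ |C| * ∏ i, ‖(ch.X q).1 i‖ ^ (-(N i : ℤ)) := by gcongr; exact le_abs_self C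
    _ ≤ |C| * (‖q.1‖ * ‖q.2‖) ^ M := by gcongr; exact hM q h1 h2

theorem exists_nhd {Ω : Set (RealBlowUp n p)} (hΩ : IsOpen Ω) (hϑ : ϑ ∈ Ω) {R ε : ℝ}
    (hR : 1 ≤ R) (hε : 0 < ε) :
    ∃ Ω' ⊆ Ω, IsOpen Ω' ∧ ϑ ∈ Ω' ∧ ∀ x ∈ offD Ω',
      ch.W x ∈ cone R ε ×ˢ paramRegion s R ε ∧ ch.X (ch.W x) = x := by
  obtain ⟨O, hO, hOo, hϑO⟩ := _root_.mem_nhds_iff.1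
    ((ch.eventually_W_mem R hR ε hε).and (hΩ.mem_nhds hϑ))
  refine ⟨O, fun b hb => (hO hb).2, hOo, hϑO, fun x hx => ?_⟩
  have h := (hO hx.2).1 (fun i => by simpa [lift] using hx.1 i)
  rwa [proj_lift] at h

section Transport

variable {Ω K : Set (RealBlowUp n p)} {R₀ ε₀ : ℝ} {α : Ambient n p → ℂ} {A : ℂ × ℂ → ℂ}
  {l₁ l₂ μ₁ μ₂ : ℂ}

theorem isModSection_comp_W {Ω' : Set (RealBlowUp n p)} {R ε : ℝ} (hR : 1 ≤ R)
    (hW : ∀ x ∈ offD Ω', ch.W x ∈ cone R ε ×ˢ paramRegion s R ε)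
    {u : ℂ × ℂ → ℂ} (hu : DifferentiableOn ℂ u (cone R ε ×ˢ paramRegion s R ε))
    (hg : PolyGrowthOn (cone R ε ×ˢ paramRegion s R ε) u) :
    IsModSection Ω' (fun x => u (ch.W x)) := by
  refine ⟨fun x hx => ?_, fun K hK _ => ?_⟩
  · obtain ⟨W', hW', -, -⟩ := ch.hasFDerivAt_W x hx.1
    exact ((hu.differentiableAt ((isOpen_cone_prod R ε).mem_nhds (hW x hx))).comp x
      hW'.differentiableAt).differentiableWithinAt
  · obtain ⟨C, M, hCM⟩ := hg
    obtain ⟨C', N, hC', hN⟩ := ch.growth_W M ε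
    refine ⟨|C| * C', N, fun x hx => ?_⟩
    have hx' := offD_mono hK hx
    calc ‖u (ch.W x)‖ ≤ C * (‖(ch.W x).1‖ * ‖(ch.W x).2‖) ^ M := hCM _ (hW x hx')
      _ ≤ |C| * (‖(ch.W x).1‖ * ‖(ch.W x).2‖) ^ M := by gcongr; exact le_abs_self C
      _ ≤ |C| * (C' * ∏ i, ‖x.1 i‖ ^ (-(N i : ℤ))) := by
        gcongr
        exact hN x hx'.1 (cone_prod_mono le_rfl hR le_rfl (hW x hx'))
      _ = _ := by ring

theorem fderiv_comp_W {D : Set (ℂ × ℂ)} (hD : IsOpen D) {u : ℂ × ℂ → ℂ}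
    (hu : DifferentiableOn ℂ u D) {x : Ambient n p} (hx : ∀ i, x.1 i ≠ 0) (hxD : ch.W x ∈ D) :
    (ch.σ₁ (ch.W x).1 ≠ 0 ∧ ch.σ₁ (ch.W x).1 * fderiv ℂ (fun x => u (ch.W x)) x (ch.v₁ x)
      = fderiv ℂ u (ch.W x) (1, 0)) ∧
    (ch.σ₂ (ch.W x).2 ≠ 0 ∧ ch.σ₂ (ch.W x).2 * fderiv ℂ (fun x => u (ch.W x)) x (ch.v₂ x)
      = fderiv ℂ u (ch.W x) (0, 1)) := by
  obtain ⟨W', hW', h1, h2⟩ := ch.hasFDerivAt_W x hx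
  have h : fderiv ℂ (fun x => u (ch.W x)) x = _ :=
    ((hu.differentiableAt (hD.mem_nhds hxD)).hasFDerivAt.comp x hW').fderiv
  refine ⟨⟨fun h0 => ?_, ?_⟩, ⟨fun h0 => ?_, ?_⟩⟩
  · rw [h0, zero_smul] at h1
    exact zero_ne_one (congrArg Prod.fst h1)
  · rw [h, ContinuousLinearMap.comp_apply, ← smul_eq_mul, ← map_smul, h1]
  · rw [h0, zero_smul] at h2
    exact zero_ne_one (congrArg Prod.snd h2)
  · rw [h, ContinuousLinearMap.comp_apply, ← smul_eq_mul, ← map_smul, h2]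

/-- The terms `μ_i log` in the exponent produce the constant terms `l_i` of the operators. -/
theorem fderiv_exponent {D : Set (ℂ × ℂ)} (hD : IsOpen D) (hre : ∀ q ∈ D, 0 < q.1.re ∧ 0 < q.2.re)
    (hA : ∀ q ∈ D, A q = α (ch.X q) + μ₁ * Complex.log q.1 + μ₂ * Complex.log q.2)
    (hμ₁ : ∀ w : ℂ, 0 < w.re → ch.σ₁ w * l₁ = μ₁ / w)
    (hμ₂ : ∀ z : ℂ, 0 < z.re → ch.σ₂ z * l₂ = μ₂ / z)
    {q : ℂ × ℂ} (hq : q ∈ D) (hα : DifferentiableAt ℂ α (ch.X q)) :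
    fderiv ℂ A q (1, 0) = ch.σ₁ q.1 * (fderiv ℂ α (ch.X q) (ch.v₁ (ch.X q)) + l₁) ∧
    fderiv ℂ A q (0, 1) = ch.σ₂ q.2 * (fderiv ℂ α (ch.X q) (ch.v₂ (ch.X q)) + l₂) := by
  obtain ⟨h1, h2⟩ := hre q hq
  have heq : A =ᶠ[𝓝 q] fun q => α (ch.X q) + μ₁ * Complex.log q.1 + μ₂ * Complex.log q.2 := by
    filter_upwards [hD.mem_nhds hq] with q hq using hA q hq
  have hd := (((ch.differentiableAt_comp_X h1 h2 hα).hasFDerivAt).add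
    (((hasFDerivAt_fst (p := q)).clog (Or.inl h1)).const_mul μ₁)).add
    (((hasFDerivAt_snd (p := q)).clog (Or.inl h2)).const_mul μ₂)
  have hfd : fderiv ℂ A q = _ := heq.fderiv_eq.trans hd.fderiv
  have h3 := hμ₁ q.1 h1
  have h4 := hμ₂ q.2 h2
  rw [div_eq_mul_inv] at h3 h4
  constructor
  · rw [hfd, mul_add, h3, ← ch.fderiv_comp_X_fst h1 h2 hα]
    simp
  · rw [hfd, mul_add, h4, ← ch.fderiv_comp_X_snd h1 h2 hα]
    simp

/-- Solutions for the pulled-back exponent descend to solutions near `ϑ`. -/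
theorem exists_solutions (hΩ : IsOpen Ω) (hϑ : ϑ ∈ Ω) (hK : IsCompact K) (hKΩ : K ⊆ Ω)
    (hR₀ : 1 ≤ R₀) (hX : ∀ q ∈ cone R₀ ε₀ ×ˢ paramRegion s R₀ ε₀, ch.X q ∈ offD K)
    (hα : DifferentiableOn ℂ α (offD Ω))
    (hA : ∀ q ∈ cone R₀ ε₀ ×ˢ paramRegion s R₀ ε₀,
      A q = α (ch.X q) + μ₁ * Complex.log q.1 + μ₂ * Complex.log q.2)
    (hμ₁ : ∀ w : ℂ, 0 < w.re → ch.σ₁ w * l₁ = μ₁ / w)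
    (hμ₂ : ∀ z : ℂ, 0 < z.re → ch.σ₂ z * l₂ = μ₂ / z)
    (hsol : HasTwistedSolutions s R₀ ε₀ A) {ρ₁ : Ambient n p → ℂ} (hρ₁ : IsModSection Ω ρ₁) :
    (∃ Ω' ⊆ Ω, IsOpen Ω' ∧ ϑ ∈ Ω' ∧ ∃ u : Ambient n p → ℂ, IsModSection Ω' u ∧
      ∀ x ∈ offD Ω', fderiv ℂ u x (ch.v₁ x)
        = - fderiv ℂ α x (ch.v₁ x) * u x - l₁ * u x + ρ₁ x) ∧
    ∀ ρ₂ : Ambient n p → ℂ, IsModSection Ω ρ₂ →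
      (∀ x ∈ offD Ω, fderiv ℂ ρ₂ x (ch.v₁ x) + fderiv ℂ α x (ch.v₁ x) * ρ₂ x + l₁ * ρ₂ x
        = fderiv ℂ ρ₁ x (ch.v₂ x) + fderiv ℂ α x (ch.v₂ x) * ρ₁ x + l₂ * ρ₁ x) →
      ∃ Ω' ⊆ Ω, IsOpen Ω' ∧ ϑ ∈ Ω' ∧ ∃ u : Ambient n p → ℂ, IsModSection Ω' u ∧
        ∀ x ∈ offD Ω', fderiv ℂ u x (ch.v₁ x)
            = - fderiv ℂ α x (ch.v₁ x) * u x - l₁ * u x + ρ₁ x ∧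
          fderiv ℂ u x (ch.v₂ x)
            = - fderiv ℂ α x (ch.v₂ x) * u x - l₂ * u x + ρ₂ x := by
  set D₀ : Set (ℂ × ℂ) := cone R₀ ε₀ ×ˢ paramRegion s R₀ ε₀ with hD₀
  have hD₀o : IsOpen D₀ := isOpen_cone_prod R₀ ε₀
  have hre : ∀ q ∈ D₀, 0 < q.1.re ∧ 0 < q.2.re := fun q hq =>
    ⟨by linarith [hq.1.1], by linarith [one_le_re_of_mem_paramRegion hR₀ hq.2]⟩
  have hD1 : ∀ q ∈ D₀, 1 ≤ ‖q.1‖ ∧ 1 ≤ ‖q.2‖ := fun q hq =>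
    ⟨hR₀.trans (lt_norm_of_mem_cone hq.1).le, one_le_norm_of_mem_paramRegion hR₀ hq.2⟩
  have hXΩ : ∀ q ∈ D₀, ch.X q ∈ offD Ω := fun q hq => offD_mono hKΩ (hX q hq)
  have hat : ∀ {f : Ambient n p → ℂ}, DifferentiableOn ℂ f (offD Ω) → ∀ q ∈ D₀,
      DifferentiableAt ℂ f (ch.X q) := fun hf q hq =>
    hf.differentiableAt ((isOpen_offD hΩ).mem_nhds (hXΩ q hq))
  have hσ₁at : ∀ q ∈ D₀, DifferentiableAt ℂ (fun q : ℂ × ℂ => ch.σ₁ q.1) q := fun q hq =>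
    DifferentiableAt.comp (g := ch.σ₁) q (ch.differentiableAt_σ₁ q.1 (hre q hq).1)
      differentiableAt_fst
  have hσ₂at : ∀ q ∈ D₀, DifferentiableAt ℂ (fun q : ℂ × ℂ => ch.σ₂ q.2) q := fun q hq =>
    DifferentiableAt.comp (g := ch.σ₂) q (ch.differentiableAt_σ₂ q.2 (hre q hq).2)
      differentiableAt_snd
  set r₁ : ℂ × ℂ → ℂ := fun q => ch.σ₁ q.1 * ρ₁ (ch.X q) with hr₁
  have hρat : ∀ {ρ : Ambient n p → ℂ}, IsModSection Ω ρ → ∀ q ∈ D₀,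
      DifferentiableAt ℂ (fun q => ρ (ch.X q)) q := fun hρ q hq =>
    ch.differentiableAt_comp_X (hre q hq).1 (hre q hq).2 (hat hρ.holo q hq)
  have hr₁d : DifferentiableOn ℂ r₁ D₀ := fun q hq =>
    ((hσ₁at q hq).mul (hρat hρ₁ q hq)).differentiableWithinAt
  have hr₁g : PolyGrowthOn D₀ r₁ := ch.polyGrowthOn_pullback hK hKΩ hD1 hX hρ₁
    (σ := fun q => ch.σ₁ q.1) fun q hq => ch.norm_σ₁_le _ (hD1 q hq).1
  obtain ⟨R, hR, ε, hε, hεε, hone, hsys⟩ := hsol r₁ hr₁d hr₁g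
  have hR1 := hR₀.trans hR
  have hDsub : cone R ε ×ˢ paramRegion s R ε ⊆ D₀ := cone_prod_mono hR₀ hR hεε
  obtain ⟨Ω', hΩ'Ω, hΩ'o, hϑΩ', hW⟩ := ch.exists_nhd hΩ hϑ hR1 hε
  have hexp : ∀ q ∈ D₀, _ := fun q hq =>
    ch.fderiv_exponent hD₀o hre hA hμ₁ hμ₂ hq (hat hα q hq)
  have hsolve₁ : ∀ u : ℂ × ℂ → ℂ, DifferentiableOn ℂ u (cone R ε ×ˢ paramRegion s R ε) →
      SolvesTwisted (cone R ε ×ˢ paramRegion s R ε) A (1, 0) r₁ u → ∀ x ∈ offD Ω',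
      fderiv ℂ (fun x => u (ch.W x)) x (ch.v₁ x)
        = - fderiv ℂ α x (ch.v₁ x) * u (ch.W x) - l₁ * u (ch.W x) + ρ₁ x := by
    intro u hu hs x hx
    obtain ⟨hWx, hXW⟩ := hW x hx
    obtain ⟨⟨h0, h1⟩, -⟩ := ch.fderiv_comp_W (isOpen_cone_prod R ε) hu hx.1 hWx
    have h2 := hs _ hWx
    have h3 := (hexp _ (hDsub hWx)).1
    simp only [hr₁] at h2
    rw [hXW] at h2 h3
    refine mul_left_cancel₀ h0 ?_
    rw [h1]
    linear_combination h2 - u (ch.W x) * h3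
  refine ⟨?_, fun ρ₂ hρ₂ hcl => ?_⟩
  · obtain ⟨u, hu, hug, hus⟩ := hone
    exact ⟨Ω', hΩ'Ω, hΩ'o, hϑΩ', fun x => u (ch.W x),
      ch.isModSection_comp_W hR1 (fun x hx => (hW x hx).1) hu hug, hsolve₁ u hu hus⟩
  · set r₂ : ℂ × ℂ → ℂ := fun q => ch.σ₂ q.2 * ρ₂ (ch.X q) with hr₂
    have hr₂d : DifferentiableOn ℂ r₂ D₀ := fun q hq =>
      ((hσ₂at q hq).mul (hρat hρ₂ q hq)).differentiableWithinAt
    have hr₂g : PolyGrowthOn D₀ r₂ := ch.polyGrowthOn_pullback hK hKΩ hD1 hX hρ₂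
      (σ := fun q => ch.σ₂ q.2) fun q hq => ch.norm_σ₂_le _ (hD1 q hq).2
    obtain ⟨u, hu, hug, hus₁, hus₂⟩ := hsys r₂ hr₂d hr₂g (by
      intro q hq
      obtain ⟨h1, h2⟩ := hre q hq
      have hd1 : fderiv ℂ r₁ q (0, 1) = ch.σ₁ q.1 * (ch.σ₂ q.2 *
          fderiv ℂ ρ₁ (ch.X q) (ch.v₂ (ch.X q))) := by
        have h : fderiv ℂ r₁ q = _ :=
          ((((ch.differentiableAt_σ₁ q.1 h1).hasFDerivAt).comp q hasFDerivAt_fst).mul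
            (hρat hρ₁ q hq).hasFDerivAt).fderiv
        rw [h, ← ch.fderiv_comp_X_snd h1 h2 (hat hρ₁.holo q hq)]
        simp
      have hd2 : fderiv ℂ r₂ q (1, 0) = ch.σ₂ q.2 * (ch.σ₁ q.1 *
          fderiv ℂ ρ₂ (ch.X q) (ch.v₁ (ch.X q))) := by
        have h : fderiv ℂ r₂ q = _ :=
          ((((ch.differentiableAt_σ₂ q.2 h2).hasFDerivAt).comp q hasFDerivAt_snd).mul
            (hρat hρ₂ q hq).hasFDerivAt).fderiv
        rw [h, ← ch.fderiv_comp_X_fst h1 h2 (hat hρ₂.holo q hq)]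
        simp
      obtain ⟨hA1, hA2⟩ := hexp q hq
      rw [hd1, hd2, hA1, hA2]
      simp only [hr₁, hr₂]
      linear_combination (ch.σ₁ q.1 * ch.σ₂ q.2) * hcl _ (hXΩ q hq))
    refine ⟨Ω', hΩ'Ω, hΩ'o, hϑΩ', fun x => u (ch.W x),
      ch.isModSection_comp_W hR1 (fun x hx => (hW x hx).1) hu hug, fun x hx =>
      ⟨hsolve₁ u hu hus₁ x hx, ?_⟩⟩
    obtain ⟨hWx, hXW⟩ := hW x hx
    obtain ⟨-, h0, h1⟩ := ch.fderiv_comp_W (isOpen_cone_prod R ε) hu hx.1 hWx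
    have h2 := hus₂ _ hWx
    have h3 := (hexp _ (hDsub hWx)).2
    simp only [hr₂] at h2
    rw [hXW] at h2 h3
    refine mul_left_cancel₀ h0 ?_
    rw [h1]
    linear_combination h2 - u (ch.W x) * h3

end Transport

end LogChart

/-! ### Asymptotics of the unit -/

/-- If the Euler derivative of `f` is at most `η` on a cone, `f` varies by at most `ε η` between a
point and its real part. -/
theorem norm_sub_re_le {f : ℂ → ℂ} {f' : ℂ → ℂ} {R ε η : ℝ} (hR : 0 < R)
    (hf : ∀ w ∈ cone R ε, HasDerivAt f (f' w) w) (hη : ∀ w ∈ cone R ε, ‖w * f' w‖ ≤ η)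
    {w : ℂ} (hw : w ∈ cone R ε) : ‖f w - f (w.re : ℂ)‖ ≤ ε * η := by
  obtain ⟨h1, h2⟩ := hw
  have hre : 0 < w.re := hR.trans h1
  have hε : 0 < ε := by
    by_contra h
    have := (abs_nonneg _).trans_lt h2
    nlinarith
  have hsub : w - (w.re : ℂ) = (w.im : ℂ) * Complex.I := by
    apply Complex.ext <;> simp
  have hmem : ∀ t ∈ Icc (0 : ℝ) 1, (w.re : ℂ) + t * (w - (w.re : ℂ)) ∈ cone R ε := fun t ht =>
    add_mul_sub_mem (convex_cone R ε) ⟨by simpa using h1, by simpa using by positivity⟩ ⟨h1, h2⟩ ht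
  refine norm_sub_le_of_segment_bound (fun t ht => hf _ (hmem t ht)) fun t ht => ?_
  set v := (w.re : ℂ) + t * (w - (w.re : ℂ)) with hv
  have hvre : v.re = w.re := by simp [hv]
  have h3 : ‖w - (w.re : ℂ)‖ ≤ ε * ‖v‖ := by
    rw [hsub, norm_mul, Complex.norm_I, mul_one, Complex.norm_real, Real.norm_eq_abs]
    refine h2.le.trans ?_
    gcongr
    rw [← hvre]
    exact Complex.re_le_norm v
  calc ‖(w - (w.re : ℂ)) * f' v‖ ≤ ε * ‖v‖ * ‖f' v‖ := by
        rw [norm_mul]; gcongr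
    _ = ε * ‖v * f' v‖ := by rw [norm_mul]; ring
    _ ≤ ε * η := by gcongr; exact hη v (hmem t ht)

theorem ofReal_re_mem_cone {R ε ε' : ℝ} (hR : 0 < R) (hε' : 0 < ε') {w : ℂ} (hw : w ∈ cone R ε) :
    (w.re : ℂ) ∈ cone R ε' := by
  have := hR.trans hw.1
  exact ⟨by simpa using hw.1, by simpa using by positivity⟩

/-- Continuity on the blow-up gives `V → V₀` only on cones whose aperture shrinks with the
precision. The Euler derivatives tending to `0` extend it to the full aperture, by comparison with
the real axis. -/
theorem isAsymptoticUnit_of_euler_bounds {s : Bool} {b : ℕ} {V : ℂ × ℂ → ℂ} {V₀ : ℂ} {R₀ ε₀ : ℝ}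
    (hR₀ : 1 ≤ R₀) (hε₀ : 0 < ε₀) (hb : b = 1 → s = true)
    (hV : DifferentiableOn ℂ V (cone R₀ ε₀ ×ˢ paramRegion s R₀ ε₀))
    (h₁ : ∀ η > 0, ∃ R, ∀ p ∈ cone R₀ ε₀ ×ˢ paramRegion s R₀ ε₀, R ≤ ‖p.1‖ →
      ‖p.1 * fderiv ℂ V p (1, 0)‖ ≤ η)
    (h₂ : s = true → ∀ η > 0, ∃ R, ∀ p ∈ cone R₀ ε₀ ×ˢ paramRegion s R₀ ε₀, R ≤ ‖p.2‖ →
      ‖p.2 * fderiv ℂ V p (0, 1)‖ ≤ η)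
    (h₃ : ∀ η > 0, ∃ R ≥ 1, ∃ ε > 0, ∀ p ∈ cone R ε ×ˢ paramRegion s R ε, ‖V p - V₀‖ ≤ η) :
    IsAsymptoticUnit s b V V₀ R₀ ε₀ := by
  refine ⟨hV, fun η hη => ?_⟩
  -- `V p - V₀` is split into two moves to the real axis, of cost `ε₀ η'` each, and a limit there
  set η' := η / (2 * ε₀ + 1) with hη'
  have hη'pos : 0 < η' := by positivity
  have hη'eq : η' * (2 * ε₀ + 1) = η := div_mul_cancel₀ _ (by positivity)
  have hη'le : η' ≤ η := by nlinarith
  obtain ⟨R₁, hR₁⟩ := h₁ η' hη'pos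
  obtain ⟨R₃, hR₃1, ε₃, hε₃, hR₃⟩ := h₃ η' hη'pos
  obtain ⟨R₂, hR₂⟩ : ∃ R₂, s = true → ∀ p ∈ cone R₀ ε₀ ×ˢ paramRegion s R₀ ε₀, R₂ ≤ ‖p.2‖ →
      ‖p.2 * fderiv ℂ V p (0, 1)‖ ≤ η' := by
    cases s
    · exact ⟨0, by simp⟩
    · obtain ⟨R₂, h⟩ := h₂ rfl η' hη'pos
      exact ⟨R₂, fun _ => h⟩
  set R := max R₀ (max R₁ (max R₂ R₃)) with hR
  have hRR₀ : R₀ ≤ R := le_max_left _ _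
  have hRR₁ : R₁ ≤ R := (le_max_left _ _).trans (le_max_right _ _)
  have hRR₂ : R₂ ≤ R := ((le_max_left _ _).trans (le_max_right _ _)).trans (le_max_right _ _)
  have hRR₃ : R₃ ≤ R := ((le_max_right _ _).trans (le_max_right _ _)).trans (le_max_right _ _)
  have hRpos : 0 < R := by linarith
  have hsub : cone R ε₀ ×ˢ paramRegion s R ε₀ ⊆ cone R₀ ε₀ ×ˢ paramRegion s R₀ ε₀ :=
    cone_prod_mono hR₀ hRR₀ le_rfl
  have hat : ∀ p ∈ cone R ε₀ ×ˢ paramRegion s R ε₀, DifferentiableAt ℂ V p := fun p hp =>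
    hV.differentiableAt ((isOpen_cone_prod R₀ ε₀).mem_nhds (hsub hp))
  have hb₁ : ∀ p ∈ cone R ε₀ ×ˢ paramRegion s R ε₀, ‖p.1 * fderiv ℂ V p (1, 0)‖ ≤ η' :=
    fun p hp => hR₁ p (hsub hp) (hRR₁.trans (lt_norm_of_mem_cone hp.1).le)
  have hb₂ : s = true → ∀ p ∈ cone R ε₀ ×ˢ paramRegion s R ε₀,
      ‖p.2 * fderiv ℂ V p (0, 1)‖ ≤ η' := by
    intro hs p hp
    refine hR₂ hs p (hsub hp) (hRR₂.trans ?_)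
    subst hs
    exact (lt_norm_of_mem_cone hp.2).le
  refine ⟨R, hRR₀, fun p hp => ⟨?_, (hb₁ p hp).trans hη'le, fun hb1 =>
    (hb₂ (hb hb1) p hp).trans hη'le⟩⟩
  obtain ⟨w, z⟩ := p
  have hw : w ∈ cone R ε₀ := hp.1
  have hz : z ∈ paramRegion s R ε₀ := hp.2
  have hwre : (w.re : ℂ) ∈ cone R ε₀ := ofReal_re_mem_cone hRpos hε₀ hw
  have hA : ‖V (w, z) - V ((w.re : ℂ), z)‖ ≤ ε₀ * η' :=
    norm_sub_re_le (f := fun w => V (w, z)) (f' := fun w => fderiv ℂ V (w, z) (1, 0)) hRpos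
      (fun v hv => (hat (v, z) ⟨hv, hz⟩).hasFDerivAt.comp_hasDerivAt v
        ((hasDerivAt_id v).prodMk (hasDerivAt_const v z)))
      (fun v hv => hb₁ (v, z) ⟨hv, hz⟩) hw
  -- a parameter is left unchanged; its disc shrinks with `R` anyway
  obtain ⟨z', hz', hB⟩ : ∃ z' ∈ paramRegion s R₃ ε₃,
      ‖V ((w.re : ℂ), z) - V ((w.re : ℂ), z')‖ ≤ ε₀ * η' := by
    cases s
    · refine ⟨z, paramRegion_mono (ε := ε₃) (ε' := ε₃) hR₃1 hRR₃ le_rfl hz, ?_⟩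
      rw [sub_self, norm_zero]
      positivity
    · have hz : z ∈ cone R ε₀ := hz
      refine ⟨z.re, cone_mono (by linarith) hRR₃ le_rfl (ofReal_re_mem_cone hRpos hε₃ hz), ?_⟩
      exact norm_sub_re_le (f := fun z => V ((w.re : ℂ), z))
        (f' := fun z => fderiv ℂ V ((w.re : ℂ), z) (0, 1)) hRpos
        (fun v hv => (hat ((w.re : ℂ), v) ⟨hwre, hv⟩).hasFDerivAt.comp_hasDerivAt v
          ((hasDerivAt_const v (w.re : ℂ)).prodMk (hasDerivAt_id v)))
        (fun v hv => hb₂ rfl ((w.re : ℂ), v) ⟨hwre, hv⟩) hz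
  have hC := hR₃ ((w.re : ℂ), z')
    ⟨cone_mono (by linarith) hRR₃ le_rfl (ofReal_re_mem_cone hRpos hε₃ hw), hz'⟩
  calc ‖V (w, z) - V₀‖ = ‖(V (w, z) - V ((w.re : ℂ), z)) +
        (V ((w.re : ℂ), z) - V ((w.re : ℂ), z')) + (V ((w.re : ℂ), z') - V₀)‖ := by ring_nf
    _ ≤ ε₀ * η' + ε₀ * η' + η' := (norm_add₃_le).trans (by gcongr)
    _ = η := by rw [← hη'eq]; ring

namespace LogChart

variable {n p : ℕ} {ϑ : RealBlowUp n p} {s : Bool} (ch : LogChart ϑ s)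

/-- Solvability in a chart in which the exponent is `c f w^a z^b`, where `f` is a function on the
blow-up with `f ϑ ≠ 0` whose derivatives along the vector fields of the chart tend to `0`. -/
theorem exists_solutions_of_unit {Ω : Set (RealBlowUp n p)} (hΩ : IsOpen Ω) (hϑ : ϑ ∈ Ω)
    {α : Ambient n p → ℂ} (hα : DifferentiableOn ℂ α (offD Ω))
    {f : RealBlowUp n p → ℂ} (hf : DifferentiableOn ℂ (f ∘ lift) (offD Ω))
    (hfc : ContinuousAt f ϑ) (hf0 : f ϑ ≠ 0) {c : ℂ} (hc : c ≠ 0) {a b : ℕ}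
    (hb : b ≤ 1) (hs : s = false → b = 0) (hab : a = 1 ∨ a = 0 ∧ b = 0)
    (hαX : ∀ q : ℂ × ℂ, 0 < q.1.re → 0 < q.2.re →
      α (ch.X q) = c * f (lift (ch.X q)) * q.1 ^ a * q.2 ^ b)
    {O : Set (RealBlowUp n p)} (hO : O ∈ 𝓝 ϑ)
    (hσ₁ : ∀ w : ℂ, ‖w * ch.σ₁ w‖ ≤ 1)
    (hf₁ : ∀ η > 0, ∃ R, ∀ q : ℂ × ℂ, R ≤ ‖q.1‖ → ch.X q ∈ offD O →
      ‖fderiv ℂ (f ∘ lift) (ch.X q) (ch.v₁ (ch.X q))‖ ≤ η)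
    (hσ₂ : s = true → ∀ z : ℂ, ‖z * ch.σ₂ z‖ ≤ 1)
    (hf₂ : s = true → ∀ η > 0, ∃ R, ∀ q : ℂ × ℂ, R ≤ ‖q.2‖ → ch.X q ∈ offD O →
      ‖fderiv ℂ (f ∘ lift) (ch.X q) (ch.v₂ (ch.X q))‖ ≤ η)
    {l₁ l₂ μ₁ μ₂ : ℂ}
    (hμ₁ : ∀ w : ℂ, 0 < w.re → ch.σ₁ w * l₁ = μ₁ / w)
    (hμ₂ : ∀ z : ℂ, 0 < z.re → ch.σ₂ z * l₂ = μ₂ / z)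
    {ρ₁ : Ambient n p → ℂ} (hρ₁ : IsModSection Ω ρ₁) :
    (∃ Ω' ⊆ Ω, IsOpen Ω' ∧ ϑ ∈ Ω' ∧ ∃ u : Ambient n p → ℂ, IsModSection Ω' u ∧
      ∀ x ∈ offD Ω', fderiv ℂ u x (ch.v₁ x)
        = - fderiv ℂ α x (ch.v₁ x) * u x - l₁ * u x + ρ₁ x) ∧
    ∀ ρ₂ : Ambient n p → ℂ, IsModSection Ω ρ₂ →
      (∀ x ∈ offD Ω, fderiv ℂ ρ₂ x (ch.v₁ x) + fderiv ℂ α x (ch.v₁ x) * ρ₂ x + l₁ * ρ₂ x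
        = fderiv ℂ ρ₁ x (ch.v₂ x) + fderiv ℂ α x (ch.v₂ x) * ρ₁ x + l₂ * ρ₁ x) →
      ∃ Ω' ⊆ Ω, IsOpen Ω' ∧ ϑ ∈ Ω' ∧ ∃ u : Ambient n p → ℂ, IsModSection Ω' u ∧
        ∀ x ∈ offD Ω', fderiv ℂ u x (ch.v₁ x)
            = - fderiv ℂ α x (ch.v₁ x) * u x - l₁ * u x + ρ₁ x ∧
          fderiv ℂ u x (ch.v₂ x)
            = - fderiv ℂ α x (ch.v₂ x) * u x - l₂ * u x + ρ₂ x := by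
  obtain ⟨K, hK, hKϑ, hKsub⟩ := exists_compact_subset (isOpen_interior (s := Ω ∩ O))
    (mem_interior_iff_mem_nhds.2 (inter_mem (hΩ.mem_nhds hϑ) hO))
  have hKΩ : K ⊆ Ω := fun b hb => (interior_subset (hKsub hb)).1
  have hKO : K ⊆ O := fun b hb => (interior_subset (hKsub hb)).2
  obtain ⟨R₀, hR₀, ε₀, hε₀, hX⟩ := ch.exists_mem_offD K (mem_interior_iff_mem_nhds.1 hKϑ)
  have hre : ∀ q ∈ cone R₀ ε₀ ×ˢ paramRegion s R₀ ε₀, 0 < q.1.re ∧ 0 < q.2.re := fun q hq =>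
    ⟨by linarith [hq.1.1], by linarith [one_le_re_of_mem_paramRegion hR₀ hq.2]⟩
  have hfat : ∀ q ∈ cone R₀ ε₀ ×ˢ paramRegion s R₀ ε₀,
      DifferentiableAt ℂ (f ∘ lift) (ch.X q) := fun q hq =>
    hf.differentiableAt ((isOpen_offD hΩ).mem_nhds (offD_mono hKΩ (hX q hq)))
  set V : ℂ × ℂ → ℂ := fun q => (f ∘ lift) (ch.X q) with hV
  have hunit : IsAsymptoticUnit s b V (f ϑ) R₀ ε₀ := by
    refine isAsymptoticUnit_of_euler_bounds hR₀ hε₀ ?_ ?_ ?_ ?_ ?_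
    · intro hb1
      by_contra hs'
      have := hs (by simpa using hs')
      omega
    · intro q hq
      exact (ch.differentiableAt_comp_X (hre q hq).1 (hre q hq).2
        (hfat q hq)).differentiableWithinAt
    · intro η hη
      obtain ⟨R, hR⟩ := hf₁ η hη
      refine ⟨R, fun q hq hqR => ?_⟩
      rw [hV, ch.fderiv_comp_X_fst (hre q hq).1 (hre q hq).2 (hfat q hq), ← mul_assoc, norm_mul]
      exact (mul_le_of_le_one_left (norm_nonneg _) (hσ₁ _)).trans
        (hR q hqR (offD_mono hKO (hX q hq)))
    · intro hs' η hη
      obtain ⟨R, hR⟩ := hf₂ hs' η hη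
      refine ⟨R, fun q hq hqR => ?_⟩
      rw [hV, ch.fderiv_comp_X_snd (hre q hq).1 (hre q hq).2 (hfat q hq), ← mul_assoc, norm_mul]
      exact (mul_le_of_le_one_left (norm_nonneg _) (hσ₂ hs' _)).trans
        (hR q hqR (offD_mono hKO (hX q hq)))
    · intro η hη
      have hnear : {b | ‖f b - f ϑ‖ ≤ η} ∈ 𝓝 ϑ := by
        filter_upwards [hfc.preimage_mem_nhds (closedBall_mem_nhds (f ϑ) hη)] with b hb
        exact mem_closedBall_iff_norm.1 hb
      obtain ⟨R, hR, ε, hε, h⟩ := ch.exists_mem_offD _ hnear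
      exact ⟨R, hR, ε, hε, fun q hq => (h q hq).2⟩
  exact ch.exists_solutions hΩ hϑ hK hKΩ hR₀ hX hα
    (fun q hq => by
      rw [hαX q (hre q hq).1 (hre q hq).2]
      rfl) hμ₁ hμ₂
    (hasTwistedSolutions (c := c) (a := a) (μ₁ := μ₁) (μ₂ := μ₂) hR₀ hε₀ hb hs hab hunit
      (mul_ne_zero hc hf0)) hρ₁

end LogChart

/-! ### The two charts -/

theorem exists_pi_prod_subset {n p : ℕ} {ϑ : RealBlowUp n p} {O : Set (RealBlowUp n p)}
    (hO : O ∈ 𝓝 ϑ) :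
    ∃ (S : Fin n → Set (ℝ≥0 × Circle)) (T : Set (Fin p → ℂ)), (∀ i, S i ∈ 𝓝 (ϑ.1 i)) ∧
      T ∈ 𝓝 ϑ.2 ∧ ∀ b : RealBlowUp n p, (∀ i, b.1 i ∈ S i) → b.2 ∈ T → b ∈ O := by
  rw [nhds_prod_eq, mem_prod_iff] at hO
  obtain ⟨S', hS', T, hT, h⟩ := hO
  rw [nhds_pi, Filter.mem_pi] at hS'
  obtain ⟨I, -, S, hS, hSS⟩ := hS'
  exact ⟨S, T, hS, hT, fun b hb hbT => h ⟨hSS fun i _ => hb i, hbT⟩⟩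

theorem fst_eq_zero_of_proj_eq_zero {n p : ℕ} {ϑ : RealBlowUp n p} (h : proj ϑ = 0) (i : Fin n) :
    ϑ.1 i = (0, (ϑ.1 i).2) := by
  have h1 : (((ϑ.1 i).1 : ℝ) : ℂ) * ((ϑ.1 i).2 : ℂ) = 0 := congrFun (congrArg Prod.fst h) i
  have h2 := (mul_eq_zero.1 h1).resolve_right (Circle.coe_ne_zero _)
  exact Prod.ext (by exact_mod_cast h2) rfl

theorem inv_norm_zpow_neg_le {a Q : ℝ} (ha : 0 ≤ a) (h : a⁻¹ ≤ Q) (N : ℕ) :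
    a ^ (-(N : ℤ)) ≤ Q ^ N := by
  rw [zpow_neg, zpow_natCast, ← inv_pow]
  exact pow_le_pow_left₀ (inv_nonneg.2 ha) h N

/-- The logarithmic vector field `x_i ∂/∂x_i`. -/
noncomputable def eulerField {n p : ℕ} (i : Fin n) (x : Ambient n p) : Ambient n p :=
  x.1 i • (Pi.single i 1, 0)

theorem fderiv_eulerField {n p : ℕ} (i : Fin n) (f : Ambient n p → ℂ) (x : Ambient n p) :
    fderiv ℂ f x (eulerField i x) = eulerDeriv i f x := by
  rw [eulerField, map_smul, smul_eq_mul, eulerDeriv]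

/-- The function `-1 / (k w)`; for `x = ζ w^{-1/k}` one has `∂/∂w = logWeight k w · x ∂/∂x`. -/
noncomputable def logWeight (k : ℕ) (w : ℂ) : ℂ := -(1 / (k * w))

section LogWeight

variable {k : ℕ}

theorem norm_mul_logWeight_le (hk : 1 ≤ k) (w : ℂ) : ‖w * logWeight k w‖ ≤ 1 := by
  rcases eq_or_ne w 0 with rfl | hw
  · simp
  · have h : w * logWeight k w = -(k : ℂ)⁻¹ := by
      rw [logWeight, one_div, mul_inv]
      field_simp
    rw [h, norm_neg, norm_inv, Complex.norm_natCast]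
    exact inv_le_one_of_one_le₀ (by exact_mod_cast hk)

theorem norm_logWeight_le (hk : 1 ≤ k) {w : ℂ} (hw : 1 ≤ ‖w‖) : ‖logWeight k w‖ ≤ 1 := by
  refine le_trans ?_ (norm_mul_logWeight_le hk w)
  rw [norm_mul]
  exact le_mul_of_one_le_left (norm_nonneg _) hw

theorem differentiableAt_logWeight (hk : 1 ≤ k) {w : ℂ} (hw : 0 < w.re) :
    DifferentiableAt ℂ (logWeight k) w := by
  have hw0 : w ≠ 0 := fun h => by simp [h] at hw
  have hk0 : (k : ℂ) ≠ 0 := by exact_mod_cast (by omega : k ≠ 0)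
  unfold logWeight
  exact ((differentiableAt_const _).div (by fun_prop) (mul_ne_zero hk0 hw0)).neg

theorem logWeight_mul (w l : ℂ) : logWeight k w * l = (-l / k) / w := by
  rw [logWeight, one_div, mul_inv]
  ring

theorem logWeight_sectorCoord_mul (hk : 1 ≤ k) {ζ : Circle} {x : ℂ} (hx : x ≠ 0) :
    logWeight k (sectorCoord ζ k x) * (x * (-(k * sectorCoord ζ k x) / x)) = 1 := by
  have hk0 : (k : ℂ) ≠ 0 := by exact_mod_cast (by omega : k ≠ 0)
  have h : sectorCoord ζ k x ≠ 0 :=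
    inv_ne_zero (pow_ne_zero _ (mul_ne_zero (inv_ne_zero (Circle.coe_ne_zero ζ)) hx))
  rw [logWeight]
  field_simp

end LogWeight

theorem hasFDerivAt_sectorCoord_comp {n p : ℕ} (ζ : Circle) (k : ℕ) {i : Fin n} {x : Ambient n p}
    (hx : x.1 i ≠ 0) :
    ∃ L : Ambient n p →L[ℂ] ℂ, HasFDerivAt (fun x : Ambient n p => sectorCoord ζ k (x.1 i)) L x ∧
      ∀ v, L v = v.1 i * (-(k * sectorCoord ζ k (x.1 i)) / x.1 i) := by
  have h1 : HasFDerivAt (fun x : Ambient n p => x.1 i)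
      ((ContinuousLinearMap.proj (R := ℂ) (φ := fun _ : Fin n => ℂ) i).comp
        (ContinuousLinearMap.fst ℂ _ _)) x :=
    ((ContinuousLinearMap.proj (R := ℂ) (φ := fun _ : Fin n => ℂ) i).comp
      (ContinuousLinearMap.fst ℂ (Fin n → ℂ) (Fin p → ℂ))).hasFDerivAt
  exact ⟨_, HasFDerivAt.comp (g := sectorCoord ζ k) x
    (hasDerivAt_sectorCoord (ζ := ζ) (k := k) hx).hasFDerivAt h1, fun v => by simp⟩

/-- The chart at a crossing point, with the variable `x_i` first: both variables become
coordinates at infinity. -/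
noncomputable def crossingChart (ϑ : RealBlowUp 2 0) (hϑ : proj ϑ = 0) (k : Fin 2 → ℕ)
    (hk : ∀ t, 1 ≤ k t) {i j : Fin 2} (hij : i ≠ j) : LogChart ϑ true where
  X q := (fun t => sectorMap (ϑ.1 t).2 (k t) (if t = i then q.1 else q.2), 0)
  W x := (sectorCoord (ϑ.1 i).2 (k i) (x.1 i), sectorCoord (ϑ.1 j).2 (k j) (x.1 j))
  v₁ := eulerField i
  v₂ := eulerField j
  σ₁ := logWeight (k i)
  σ₂ := logWeight (k j)
  exists_mem_offD O hO := by
    obtain ⟨S, T, hS, hT, hST⟩ := exists_pi_prod_subset hO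
    have h : ∀ t, ∃ R ≥ 1, ∃ ε > 0, ∀ w ∈ cone R ε, sectorLift (ϑ.1 t).2 (k t) w ∈ S t :=
      fun t => exists_cone_sectorLift_mem (hk t) (fst_eq_zero_of_proj_eq_zero hϑ t ▸ hS t)
    choose R hR ε hε hRε using h
    refine ⟨max (R 0) (R 1), (hR 0).le.trans (le_max_left _ _), min (ε 0) (ε 1),
      lt_min (hε 0) (hε 1), fun q hq => ?_⟩
    have hRm : ∀ t, R t ≤ max (R 0) (R 1) := by
      intro t; fin_cases t
      exacts [le_max_left _ _, le_max_right _ _]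
    have hεm : ∀ t, min (ε 0) (ε 1) ≤ ε t := by
      intro t; fin_cases t
      exacts [min_le_left _ _, min_le_right _ _]
    set B : RealBlowUp 2 0 := (fun t => sectorLift (ϑ.1 t).2 (k t) (if t = i then q.1 else q.2), 0)
    have hB : proj B = (fun t => sectorMap (ϑ.1 t).2 (k t) (if t = i then q.1 else q.2), 0) :=
      Prod.ext (funext fun t => (sectorMap_eq _).symm) rfl
    rw [← hB]
    refine proj_mem_offD (fun t => sectorLift_fst_ne_zero _) (hST _ (fun t => ?_) ?_)
    · refine hRε t _ (cone_mono ?_ (hRm t) (hεm t) ?_)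
      · linarith [hR t, hRm t]
      · split_ifs
        exacts [hq.1, hq.2]
    · rw [Subsingleton.elim B.2 ϑ.2]
      exact mem_of_mem_nhds hT
  eventually_W_mem R hR ε hε := by
    have h : ∀ t, ∀ᶠ b : RealBlowUp 2 0 in 𝓝 ϑ, (b.1 t).1 ≠ 0 →
        sectorCoord (ϑ.1 t).2 (k t) ((proj b).1 t) ∈ cone R ε ∧
        sectorMap (ϑ.1 t).2 (k t) (sectorCoord (ϑ.1 t).2 (k t) ((proj b).1 t)) = (proj b).1 t := by
      intro t
      have hc : ContinuousAt (fun b : RealBlowUp 2 0 => b.1 t) ϑ :=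
        Continuous.continuousAt (by fun_prop)
      have h2 := eventually_sectorCoord_mem_cone (ζ := (ϑ.1 t).2) (hk t) hR hε
      rw [← fst_eq_zero_of_proj_eq_zero hϑ t] at h2
      exact hc.eventually h2
    filter_upwards [h i, h j] with b hi hj hb
    refine ⟨⟨(hi (hb i)).1, (hj (hb j)).1⟩, Prod.ext (funext fun t => ?_) (Subsingleton.elim _ _)⟩
    by_cases ht : t = i
    · subst ht
      simpa using (hi (hb t)).2
    · have ht' : t = j := by omega
      subst ht'
      simpa [ht] using (hj (hb t)).2
  hasFDerivAt_X q h1 h2 := by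
    have h : ∀ t, ∃ L : ℂ × ℂ →L[ℂ] ℂ,
        HasFDerivAt (fun q : ℂ × ℂ => sectorMap (ϑ.1 t).2 (k t) (if t = i then q.1 else q.2)) L q ∧
        ∀ v, L v = (if t = i then v.1 else v.2) * (logWeight (k t) (if t = i then q.1 else q.2) *
          sectorMap (ϑ.1 t).2 (k t) (if t = i then q.1 else q.2)) := by
      intro t
      by_cases ht : t = i
      · simp only [ht, if_true]
        exact ⟨_, (hasDerivAt_sectorMap h1).hasFDerivAt.comp q hasFDerivAt_fst,
          fun v => by simp [logWeight]⟩
      · simp only [ht, if_false]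
        exact ⟨_, (hasDerivAt_sectorMap h2).hasFDerivAt.comp q hasFDerivAt_snd,
          fun v => by simp [logWeight]⟩
    choose L hL hLv using h
    refine ⟨(ContinuousLinearMap.pi L).prod 0,
      (hasFDerivAt_pi.2 hL).prodMk (hasFDerivAt_const _ _), ?_, ?_⟩
    · refine Prod.ext (funext fun t => ?_) (Subsingleton.elim _ _)
      by_cases ht : t = i
      · subst ht
        simp [hLv, eulerField]
      · simp [hLv, eulerField, ht]
    · refine Prod.ext (funext fun t => ?_) (Subsingleton.elim _ _)
      by_cases ht : t = i
      · subst ht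
        simp [hLv, eulerField, hij]
      · have ht' : t = j := by omega
        subst ht'
        simp [hLv, eulerField, ht]
  hasFDerivAt_W x hx := by
    obtain ⟨L₁, hL₁, hv₁⟩ := hasFDerivAt_sectorCoord_comp (ϑ.1 i).2 (k i) (hx i)
    obtain ⟨L₂, hL₂, hv₂⟩ := hasFDerivAt_sectorCoord_comp (ϑ.1 j).2 (k j) (hx j)
    refine ⟨L₁.prod L₂, hL₁.prodMk hL₂, Prod.ext ?_ ?_, Prod.ext ?_ ?_⟩
    · simpa [hv₁, eulerField] using logWeight_sectorCoord_mul (hk i) (hx i)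
    · simp [hv₂, eulerField, hij.symm]
    · simp [hv₁, eulerField, hij]
    · simpa [hv₂, eulerField] using logWeight_sectorCoord_mul (hk j) (hx j)
  differentiableAt_σ₁ _ := differentiableAt_logWeight (hk i)
  differentiableAt_σ₂ _ := differentiableAt_logWeight (hk j)
  norm_σ₁_le _ := norm_logWeight_le (hk i)
  norm_σ₂_le _ := norm_logWeight_le (hk j)
  growth_X N := by
    refine ⟨∑ t, N t, fun q h1 h2 => ?_⟩
    rw [← Finset.prod_pow_eq_pow_sum]
    refine Finset.prod_le_prod (fun t _ => zpow_nonneg (norm_nonneg _) _) fun t _ => ?_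
    refine inv_norm_zpow_neg_le (norm_nonneg _) ?_ _
    dsimp only
    split_ifs
    · exact (norm_sectorMap_inv_le (hk t) h1).trans (le_mul_of_one_le_right (norm_nonneg _) h2)
    · exact (norm_sectorMap_inv_le (hk t) h2).trans (le_mul_of_one_le_left (norm_nonneg _) h1)
  growth_W M ε := by
    refine ⟨1, fun t => k t * M, zero_le_one, fun x hx _ => ?_⟩
    have h : ∏ t, ‖x.1 t‖ ^ (-((k t * M : ℕ) : ℤ))
        = ‖x.1 i‖ ^ (-((k i * M : ℕ) : ℤ)) * ‖x.1 j‖ ^ (-((k j * M : ℕ) : ℤ)) := by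
      exact Fintype.prod_eq_mul i j hij fun t ht => absurd (by omega) ht.2
    rw [one_mul, h, norm_sectorCoord, norm_sectorCoord, mul_pow, zpow_neg, zpow_neg, zpow_natCast,
      zpow_natCast, inv_pow, inv_pow, pow_mul, pow_mul]

/-- The vector field `∂/∂y_j`. -/
noncomputable def paramField {n p : ℕ} (j : Fin p) (_ : Ambient n p) : Ambient n p :=
  (0, Pi.single j 1)

theorem hasFDerivAt_param {n p : ℕ} (j : Fin p) (x : Ambient n p) :
    HasFDerivAt (fun x : Ambient n p => x.2 j)
      ((ContinuousLinearMap.proj (R := ℂ) (φ := fun _ : Fin p => ℂ) j).comp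
        (ContinuousLinearMap.snd ℂ (Fin n → ℂ) (Fin p → ℂ))) x :=
  ((ContinuousLinearMap.proj (R := ℂ) (φ := fun _ : Fin p => ℂ) j).comp
    (ContinuousLinearMap.snd ℂ (Fin n → ℂ) (Fin p → ℂ))).hasFDerivAt

/-- The chart at a smooth point: `z = y + 2` is the translated parameter. -/
noncomputable def smoothChart (ϑ : RealBlowUp 1 1) (hϑ : proj ϑ = 0) {k : ℕ} (hk : 1 ≤ k) :
    LogChart ϑ false where
  X q := (fun _ => sectorMap (ϑ.1 0).2 k q.1, fun _ => q.2 - 2)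
  W x := (sectorCoord (ϑ.1 0).2 k (x.1 0), x.2 0 + 2)
  v₁ := eulerField 0
  v₂ := paramField 0
  σ₁ := logWeight k
  σ₂ _ := 1
  exists_mem_offD O hO := by
    obtain ⟨S, T, hS, hT, hST⟩ := exists_pi_prod_subset hO
    obtain ⟨R, hR, ε, hε, hRε⟩ :=
      exists_cone_sectorLift_mem hk (fst_eq_zero_of_proj_eq_zero hϑ 0 ▸ hS 0)
    have hϑ2 : ϑ.2 = 0 := congrArg Prod.snd hϑ
    obtain ⟨δ, hδ, hδT⟩ := Metric.mem_nhds_iff.1 hT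
    -- the disc has radius at most `δ`
    refine ⟨max R (1 / δ), hR.le.trans (le_max_left _ _), ε, hε, fun q hq => ?_⟩
    set B : RealBlowUp 1 1 := (fun _ => sectorLift (ϑ.1 0).2 k q.1, fun _ => q.2 - 2)
    have hB : proj B = (fun _ => sectorMap (ϑ.1 0).2 k q.1, fun _ => q.2 - 2) :=
      Prod.ext (funext fun t => (sectorMap_eq _).symm) rfl
    rw [← hB]
    refine proj_mem_offD (fun t => sectorLift_fst_ne_zero _) (hST _ (fun t => ?_) (hδT ?_))
    · rw [Subsingleton.elim t 0]
      exact hRε _ (cone_mono (le_max_of_le_left (by linarith)) (le_max_left _ _) le_rfl hq.1)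
    · rw [hϑ2, mem_ball_zero_iff]
      have h1 : ‖q.2 - 2‖ < 1 / max R (1 / δ) := mem_ball_iff_norm.1 hq.2
      have h2 : 1 / max R (1 / δ) ≤ δ := by
        rw [one_div_le (lt_of_lt_of_le (by positivity) (le_max_right _ _)) hδ]
        exact le_max_right _ _
      exact (pi_norm_const (ι := Fin 1) (q.2 - 2)).trans_lt (h1.trans_le h2)
  eventually_W_mem R hR ε hε := by
    have hc : ContinuousAt (fun b : RealBlowUp 1 1 => b.1 0) ϑ :=
      Continuous.continuousAt (by fun_prop)
    have h2 := eventually_sectorCoord_mem_cone (ζ := (ϑ.1 0).2) hk hR hε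
    rw [← fst_eq_zero_of_proj_eq_zero hϑ 0] at h2
    have hϑ2 : ϑ.2 0 = 0 := congrFun (congrArg Prod.snd hϑ) 0
    have hc2 : ContinuousAt (fun b : RealBlowUp 1 1 => ‖b.2 0‖) ϑ :=
      Continuous.continuousAt (by fun_prop)
    have h3 : ∀ᶠ b : RealBlowUp 1 1 in 𝓝 ϑ, ‖b.2 0‖ < 1 / R :=
      hc2.eventually_lt_const (by simp only [hϑ2, norm_zero]; positivity)
    filter_upwards [hc.eventually h2, h3] with b hb hb2 hb0
    refine ⟨⟨(hb (hb0 0)).1, ?_⟩, Prod.ext (funext fun t => ?_) (funext fun t => ?_)⟩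
    · exact mem_ball_iff_norm.2 (by simpa [proj] using hb2)
    · rw [Subsingleton.elim t 0]
      exact (hb (hb0 0)).2
    · rw [Subsingleton.elim t 0]
      exact add_sub_cancel_right _ _
  hasFDerivAt_X q h1 h2 := by
    refine ⟨_, (hasFDerivAt_pi.2 fun _ => (hasDerivAt_sectorMap h1).hasFDerivAt.comp q
      hasFDerivAt_fst).prodMk (hasFDerivAt_pi.2 fun _ => hasFDerivAt_snd.sub_const 2), ?_, ?_⟩
    · refine Prod.ext (funext fun t => ?_) (funext fun t => ?_)
      · simp [eulerField, logWeight, Subsingleton.elim t 0]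
      · simp [eulerField]
    · refine Prod.ext (funext fun t => ?_) (funext fun t => ?_)
      · simp [paramField]
      · simp [paramField, Subsingleton.elim t 0]
  hasFDerivAt_W x hx := by
    obtain ⟨L₁, hL₁, hv₁⟩ := hasFDerivAt_sectorCoord_comp (ϑ.1 0).2 k (hx 0)
    refine ⟨L₁.prod _, hL₁.prodMk ((hasFDerivAt_param 0 x).add_const 2),
      Prod.ext ?_ ?_, Prod.ext ?_ ?_⟩
    · simpa [hv₁, eulerField] using logWeight_sectorCoord_mul hk (hx 0)
    · simp [eulerField]
    · simp [hv₁, paramField]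
    · simp [paramField]
  differentiableAt_σ₁ _ := differentiableAt_logWeight hk
  differentiableAt_σ₂ _ _ := differentiableAt_const _
  norm_σ₁_le _ := norm_logWeight_le hk
  norm_σ₂_le _ _ := norm_one.le
  growth_X N := by
    refine ⟨N 0, fun q h1 h2 => ?_⟩
    rw [Fin.prod_univ_one]
    exact inv_norm_zpow_neg_le (norm_nonneg _)
      ((norm_sectorMap_inv_le hk h1).trans (le_mul_of_one_le_right (norm_nonneg _) h2)) _
  growth_W M ε := by
    refine ⟨3 ^ M, fun _ => k * M, by positivity, fun x hx hW => ?_⟩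
    have h1 : ‖x.2 0 + 2 - 2‖ < 1 / 1 := mem_ball_iff_norm.1 hW.2
    have h2 : ‖x.2 0 + 2‖ ≤ 3 := by
      have := norm_add_le (x.2 0) 2
      rw [add_sub_cancel_right, div_one] at h1
      rw [Complex.norm_ofNat] at this
      linarith
    rw [Fin.prod_univ_one, zpow_neg, zpow_natCast, pow_mul, norm_sectorCoord, mul_pow, inv_pow,
      mul_comm]
    gcongr

/-! ### Crossing points and smooth points -/

theorem crossingExponent_eq (m : Fin 2 → ℕ) (U : RealBlowUp 2 0 → ℂ) (x : Ambient 2 0)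
    {i j : Fin 2} (hij : i ≠ j) :
    crossingExponent m U x = x.1 i ^ (-(m i : ℤ)) * x.1 j ^ (-(m j : ℤ)) * U (lift x) := by
  rw [crossingExponent, ← Fintype.prod_eq_mul i j (f := fun t => x.1 t ^ (-(m t : ℤ))) hij
    fun t ht => absurd (by omega) ht.2, Fin.prod_univ_two]

/-- Solvability at a crossing point, where the variable `x_i`, taken first, has a pole unless `α`
has no pole at all. -/
theorem exists_crossing_solutions {ϑ : RealBlowUp 2 0} {Ω : Set (RealBlowUp 2 0)}
    {U : RealBlowUp 2 0 → ℂ} (hD : CrossingData ϑ Ω U) (m : Fin 2 → ℕ) {i j : Fin 2}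
    (hij : i ≠ j) (hm : 0 < m i ∨ m = 0) (l₁ l₂ : ℂ) {ρ₁ : Ambient 2 0 → ℂ}
    (hρ₁ : IsModSection Ω ρ₁) :
    (∃ Ω' ⊆ Ω, IsOpen Ω' ∧ ϑ ∈ Ω' ∧ ∃ u : Ambient 2 0 → ℂ, IsModSection Ω' u ∧
      SolvesLog Ω' i (crossingExponent m U) l₁ ρ₁ u) ∧
    ∀ ρ₂ : Ambient 2 0 → ℂ, IsModSection Ω ρ₂ →
      (∀ x ∈ offD Ω, logOp i (crossingExponent m U) l₁ ρ₂ x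
        = logOp j (crossingExponent m U) l₂ ρ₁ x) →
      ∃ Ω' ⊆ Ω, IsOpen Ω' ∧ ϑ ∈ Ω' ∧ ∃ u : Ambient 2 0 → ℂ, IsModSection Ω' u ∧
        SolvesLog Ω' i (crossingExponent m U) l₁ ρ₁ u ∧
        SolvesLog Ω' j (crossingExponent m U) l₂ ρ₂ u := by
  obtain ⟨L, O, hO, -, hL, hbound⟩ := hD.section_U.exists_eulerDeriv_bound hD.isOpen hD.mem
  have hk : ∀ t, 1 ≤ max (m t) 1 := fun t => le_max_right _ _
  have hsmall : ∀ t, ∀ η > 0, ∃ R, ∀ (x : Ambient 2 0) (w : ℂ), R ≤ ‖w‖ → x ∈ offD O →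
      x.1 t = sectorMap (ϑ.1 t).2 (max (m t) 1) w → ‖eulerDeriv t (U ∘ lift) x‖ ≤ η := by
    intro t η hη
    obtain ⟨R, -, hR⟩ := exists_norm_sectorMap_le (ζ := (ϑ.1 t).2) (hk t)
      (show 0 < η / (L + 1) by positivity)
    refine ⟨R, fun x w hw hx hxw => (hbound x hx t).trans ?_⟩
    rw [hxw]
    calc L * ‖sectorMap (ϑ.1 t).2 (max (m t) 1) w‖ ≤ (L + 1) * (η / (L + 1)) := by
          gcongr
          · linarith
          · exact hR w hw
      _ = η := by field_simp
  have hα : DifferentiableOn ℂ (crossingExponent m U) (offD Ω) := by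
    have h : ∀ t, DifferentiableOn ℂ (fun x : Ambient 2 0 => x.1 t ^ (-(m t : ℤ))) (offD Ω) :=
      fun t => DifferentiableOn.zpow (by fun_prop) (Or.inl fun x hx => hx.1 t)
    exact ((h 0).mul (h 1)).mul hD.section_U.holo
  have key := (crossingChart ϑ hD.base (fun t => max (m t) 1) hk hij).exists_solutions_of_unit
    hD.isOpen hD.mem hα hD.section_U.holo (hD.section_U.continuousAt hD.isOpen hD.mem) hD.ne_zero
    (c := ((ϑ.1 i).2 : ℂ) ^ (-(m i : ℤ)) * ((ϑ.1 j).2 : ℂ) ^ (-(m j : ℤ)))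
    (a := min (m i) 1) (b := min (m j) 1) (l₁ := l₁) (l₂ := l₂)
    (mul_ne_zero (zpow_ne_zero _ (Circle.coe_ne_zero _)) (zpow_ne_zero _ (Circle.coe_ne_zero _)))
    (min_le_right _ _) (fun h => by simp at h)
    (hm.imp (fun h => min_eq_right h) fun h => by simp [h])
    (fun q h1 h2 => by
      rw [crossingExponent_eq m U _ hij]
      have e1 := sectorMap_zpow_neg_eq (ζ := (ϑ.1 i).2) (m := m i) (w := q.1)
        fun h => by simp [h] at h1
      have e2 := sectorMap_zpow_neg_eq (ζ := (ϑ.1 j).2) (m := m j) (w := q.2)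
        fun h => by simp [h] at h2
      simp only [crossingChart, if_true, if_neg hij.symm, e1, e2]
      ring)
    hO (norm_mul_logWeight_le (hk i))
    (fun η hη => by
      obtain ⟨R, hR⟩ := hsmall i η hη
      refine ⟨R, fun q hq hqO => ?_⟩
      refine (congrArg norm (fderiv_eulerField i _ _)).trans_le (hR _ q.1 hq hqO ?_)
      simp [crossingChart])
    (fun _ => norm_mul_logWeight_le (hk j))
    (fun _ η hη => by
      obtain ⟨R, hR⟩ := hsmall j η hη
      refine ⟨R, fun q hq hqO => ?_⟩
      refine (congrArg norm (fderiv_eulerField j _ _)).trans_le (hR _ q.2 hq hqO ?_)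
      simp [crossingChart, hij.symm])
    (fun w _ => logWeight_mul w l₁) (fun z _ => logWeight_mul z l₂) hρ₁
  simp only [crossingChart, fderiv_eulerField] at key
  refine ⟨key.1, fun ρ₂ hρ₂ hint => ?_⟩
  obtain ⟨Ω', h1, h2, h3, u, hu, hsol⟩ := key.2 ρ₂ hρ₂ hint
  exact ⟨Ω', h1, h2, h3, u, hu, fun x hx => (hsol x hx).1, fun x hx => (hsol x hx).2⟩

theorem exists_smooth_solutions {ϑ : RealBlowUp 1 1} {Ω : Set (RealBlowUp 1 1)} {ν : ℂ → ℂ}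
    {U : RealBlowUp 1 1 → ℂ} (hD : SmoothData ϑ Ω ν U) (m : ℕ) (l : ℂ) {ρ₁ : Ambient 1 1 → ℂ}
    (hρ₁ : IsModSection Ω ρ₁) :
    (∃ Ω' ⊆ Ω, IsOpen Ω' ∧ ϑ ∈ Ω' ∧ ∃ u : Ambient 1 1 → ℂ, IsModSection Ω' u ∧
      SolvesLog Ω' 0 (smoothExponent m ν U) l ρ₁ u) ∧
    ∀ ρ₂ : Ambient 1 1 → ℂ, IsModSection Ω ρ₂ →
      (∀ x ∈ offD Ω, logOp 0 (smoothExponent m ν U) l ρ₂ x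
        = paramOp 0 (smoothExponent m ν U) ρ₁ x) →
      ∃ Ω' ⊆ Ω, IsOpen Ω' ∧ ϑ ∈ Ω' ∧ ∃ u : Ambient 1 1 → ℂ, IsModSection Ω' u ∧
        SolvesLog Ω' 0 (smoothExponent m ν U) l ρ₁ u ∧
        SolvesParam Ω' 0 (smoothExponent m ν U) ρ₂ u := by
  obtain ⟨L, O, hO, hOΩ, hL, hbound⟩ := hD.section_U.exists_eulerDeriv_bound hD.isOpen hD.mem
  have hk : 1 ≤ max m 1 := le_max_right _ _
  have hy : Continuous fun b : RealBlowUp 1 1 => b.2 0 := by fun_prop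
  have hνc : ContinuousAt (fun b : RealBlowUp 1 1 => ν (b.2 0)) ϑ :=
    (hD.analytic_ν ϑ hD.mem).continuousAt.comp (f := fun b : RealBlowUp 1 1 => b.2 0)
      hy.continuousAt
  have hUϑ : U ϑ = 1 := hD.eq_one ϑ.2 hD.mem
  set B : ℝ := ‖ν (ϑ.2 0)‖ + 1 with hB
  have hBpos : 0 < B := by positivity
  have hνB : {b : RealBlowUp 1 1 | ‖ν (b.2 0)‖ < B} ∈ 𝓝 ϑ :=
    hνc.norm.eventually_lt_const (lt_add_one _)
  have hνd : ∀ x ∈ offD Ω, DifferentiableAt ℂ (fun x : Ambient 1 1 => ν (x.2 0)) x := fun x hx =>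
    (hD.analytic_ν (lift x) hx.2).differentiableAt.comp (f := fun x : Ambient 1 1 => x.2 0) x
      (by fun_prop)
  have hUd : ∀ x ∈ offD Ω, DifferentiableAt ℂ (U ∘ lift) x := fun x hx =>
    hD.section_U.holo.differentiableAt ((isOpen_offD hD.isOpen).mem_nhds hx)
  -- the factor `ν` is constant along `x₁ ∂/∂x₁`
  have heuler : ∀ x ∈ offD Ω,
      eulerDeriv 0 ((fun b : RealBlowUp 1 1 => ν (b.2 0) * U b) ∘ lift) x
        = ν (x.2 0) * eulerDeriv 0 (U ∘ lift) x := by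
    intro x hx
    have h1 := HasFDerivAt.comp (g := ν) x
      (hD.analytic_ν (lift x) hx.2).differentiableAt.hasFDerivAt (hasFDerivAt_param 0 x)
    have h2 := (h1.mul (hUd x hx).hasFDerivAt).fderiv
    have h3 : fderiv ℂ ((fun b : RealBlowUp 1 1 => ν (b.2 0) * U b) ∘ lift) x = _ := h2
    rw [eulerDeriv, h3, eulerDeriv]
    simp [lift]
    ring
  have hα : DifferentiableOn ℂ (smoothExponent m ν U) (offD Ω) := by
    refine DifferentiableOn.mul (DifferentiableOn.mul ?_ fun x hx =>
      (hνd x hx).differentiableWithinAt) hD.section_U.holo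
    exact DifferentiableOn.zpow (by fun_prop) (Or.inl fun x hx => hx.1 0)
  have key := (smoothChart ϑ hD.base hk).exists_solutions_of_unit
    hD.isOpen hD.mem hα (f := fun b => ν (b.2 0) * U b)
    (fun x hx => ((hνd x hx).mul (hUd x hx)).differentiableWithinAt)
    (hνc.mul (hD.section_U.continuousAt hD.isOpen hD.mem))
    (by rw [hUϑ, mul_one]; exact hD.ν_ne_zero ϑ hD.mem)
    -- the parameter equation has no constant term, so no logarithm of `z` is needed
    (c := ((ϑ.1 0).2 : ℂ) ^ (-(m : ℤ))) (a := min m 1) (b := 0) (l₁ := l) (l₂ := 0) (μ₂ := 0)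
    (zpow_ne_zero _ (Circle.coe_ne_zero _)) zero_le_one (fun _ => rfl)
    (by omega)
    (fun q h1 h2 => by
      have e1 := sectorMap_zpow_neg_eq (ζ := (ϑ.1 0).2) (m := m) (w := q.1)
        fun h => by simp [h] at h1
      simp only [smoothExponent, smoothChart, e1, lift]
      ring)
    (inter_mem hO hνB) (norm_mul_logWeight_le hk)
    (fun η hη => by
      obtain ⟨R, -, hR⟩ := exists_norm_sectorMap_le (ζ := (ϑ.1 0).2) hk
        (show 0 < η / (B * (L + 1)) by positivity)
      refine ⟨R, fun q hq hqO => ?_⟩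
      refine (congrArg norm (fderiv_eulerField 0 _ _)).trans_le ?_
      rw [heuler _ ⟨hqO.1, hOΩ hqO.2.1⟩, norm_mul]
      have h1 := hbound _ ⟨hqO.1, hqO.2.1⟩ 0
      have h2 : ‖ν (((smoothChart ϑ hD.base hk).X q).2 0)‖ ≤ B := hqO.2.2.le
      have h3 : ‖((smoothChart ϑ hD.base hk).X q).1 0‖ ≤ η / (B * (L + 1)) := hR _ hq
      calc _ ≤ B * ((L + 1) * (η / (B * (L + 1)))) := by
            gcongr
            refine h1.trans ?_
            gcongr
            linarith
        _ = η := by field_simp)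
    (fun h => by simp at h) (fun h => by simp at h)
    (fun w _ => logWeight_mul w l) (fun z _ => by simp) hρ₁
  simp only [smoothChart, fderiv_eulerField] at key
  refine ⟨key.1, fun ρ₂ hρ₂ hint => ?_⟩
  obtain ⟨Ω', h1, h2, h3, u, hu, hsol⟩ := key.2 ρ₂ hρ₂ fun x hx => by
    rw [zero_mul, add_zero]
    exact hint x hx
  refine ⟨Ω', h1, h2, h3, u, hu, fun x hx => (hsol x hx).1, fun x hx => (hsol x hx).2.trans ?_⟩
  rw [zero_mul, sub_zero]
  rfl

end

theorem mainTheorem9 :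
    -- crossing point, the integrable system
    (∀ (ϑ : RealBlowUp 2 0) (Ω : Set (RealBlowUp 2 0)) (m : Fin 2 → ℕ)
        (U : RealBlowUp 2 0 → ℂ) (l : Fin 2 → ℂ) (ρ : Fin 2 → Ambient 2 0 → ℂ),
      CrossingData ϑ Ω U → (∀ i, IsModSection Ω (ρ i)) →
      (∀ x ∈ offD Ω, logOp 0 (crossingExponent m U) (l 0) (ρ 1) x
        = logOp 1 (crossingExponent m U) (l 1) (ρ 0) x) →
      ∃ Ω' ⊆ Ω, IsOpen Ω' ∧ ϑ ∈ Ω' ∧ ∃ u : Ambient 2 0 → ℂ, IsModSection Ω' u ∧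
        ∀ i, SolvesLog Ω' i (crossingExponent m U) (l i) (ρ i) u) ∧
    -- crossing point, one equation alone
    (∀ (ϑ : RealBlowUp 2 0) (Ω : Set (RealBlowUp 2 0)) (m : Fin 2 → ℕ)
        (U : RealBlowUp 2 0 → ℂ) (i : Fin 2) (l : ℂ) (ρ : Ambient 2 0 → ℂ),
      CrossingData ϑ Ω U → (0 < m i ∨ m = 0) → IsModSection Ω ρ →
      ∃ Ω' ⊆ Ω, IsOpen Ω' ∧ ϑ ∈ Ω' ∧ ∃ u : Ambient 2 0 → ℂ, IsModSection Ω' u ∧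
        SolvesLog Ω' i (crossingExponent m U) l ρ u) ∧
    -- smooth point, the integrable system
    (∀ (ϑ : RealBlowUp 1 1) (Ω : Set (RealBlowUp 1 1)) (m : ℕ) (ν : ℂ → ℂ)
        (U : RealBlowUp 1 1 → ℂ) (l : ℂ) (ρ₁ ρ₂ : Ambient 1 1 → ℂ),
      SmoothData ϑ Ω ν U → IsModSection Ω ρ₁ → IsModSection Ω ρ₂ →
      (∀ x ∈ offD Ω, logOp 0 (smoothExponent m ν U) l ρ₂ x
        = paramOp 0 (smoothExponent m ν U) ρ₁ x) →
      ∃ Ω' ⊆ Ω, IsOpen Ω' ∧ ϑ ∈ Ω' ∧ ∃ u : Ambient 1 1 → ℂ, IsModSection Ω' u ∧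
        SolvesLog Ω' 0 (smoothExponent m ν U) l ρ₁ u ∧
        SolvesParam Ω' 0 (smoothExponent m ν U) ρ₂ u) ∧
    -- smooth point, the first equation alone
    (∀ (ϑ : RealBlowUp 1 1) (Ω : Set (RealBlowUp 1 1)) (m : ℕ) (ν : ℂ → ℂ)
        (U : RealBlowUp 1 1 → ℂ) (l : ℂ) (ρ : Ambient 1 1 → ℂ),
      SmoothData ϑ Ω ν U → IsModSection Ω ρ →
      ∃ Ω' ⊆ Ω, IsOpen Ω' ∧ ϑ ∈ Ω' ∧ ∃ u : Ambient 1 1 → ℂ, IsModSection Ω' u ∧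
        SolvesLog Ω' 0 (smoothExponent m ν U) l ρ u) := by
  refine ⟨?_, ?_, ?_, ?_⟩
  · intro ϑ Ω m U l ρ hD hρ hint
    -- a variable with a pole is taken first
    rcases Nat.eq_zero_or_pos (m 0) with h0 | h0
    · rcases Nat.eq_zero_or_pos (m 1) with h1 | h1
      · have hm : m = 0 := funext (Fin.forall_fin_two.2 ⟨h0, h1⟩)
        obtain ⟨Ω', hΩ', ho, hϑ, u, hu, hs0, hs1⟩ := (exists_crossing_solutions hD m
          (show (0 : Fin 2) ≠ 1 by decide) (Or.inr hm) (l 0) (l 1) (hρ 0)).2 (ρ 1) (hρ 1) hint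
        exact ⟨Ω', hΩ', ho, hϑ, u, hu, Fin.forall_fin_two.2 ⟨hs0, hs1⟩⟩
      · obtain ⟨Ω', hΩ', ho, hϑ, u, hu, hs1, hs0⟩ := (exists_crossing_solutions hD m
          (show (1 : Fin 2) ≠ 0 by decide) (Or.inl h1) (l 1) (l 0) (hρ 1)).2 (ρ 0) (hρ 0)
          fun x hx => (hint x hx).symm
        exact ⟨Ω', hΩ', ho, hϑ, u, hu, Fin.forall_fin_two.2 ⟨hs0, hs1⟩⟩
    · obtain ⟨Ω', hΩ', ho, hϑ, u, hu, hs0, hs1⟩ := (exists_crossing_solutions hD m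
        (show (0 : Fin 2) ≠ 1 by decide) (Or.inl h0) (l 0) (l 1) (hρ 0)).2 (ρ 1) (hρ 1) hint
      exact ⟨Ω', hΩ', ho, hϑ, u, hu, Fin.forall_fin_two.2 ⟨hs0, hs1⟩⟩
  · intro ϑ Ω m U i l ρ hD hm hρ
    obtain ⟨j, hij⟩ := exists_ne i
    exact (exists_crossing_solutions hD m hij.symm hm l 0 hρ).1
  · intro ϑ Ω m ν U l ρ₁ ρ₂ hD hρ₁ hρ₂ hint
    exact (exists_smooth_solutions hD m l hρ₁).2 ρ₂ hρ₂ hint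
  · intro ϑ Ω m ν U l ρ hD hρ
    exact (exists_smooth_solutions hD m l hρ).1
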